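/- Let $1\le q<\infty$. Let $M$ be a complete non-compact connected smooth Riemannian manifold with Riemannian distance $d$, Riemannian measure $\mu$ and Riemannian gradient $\nabla$; $B(x,r)$ denotes the open ball, and $f_B$ the $\mu$-mean of $f$ over $B$. Assume that $M$ satisfies - $(D)$, with constant $D$: $\mu(B(x,2r))\le D\,\mu(B(x,r))$ for all $x\in M$, $r>0$; - $(P_q)$, with constant $P$: for every ball $B=B(x,r)$ and every real function $f$ such that $f$ and its weak gradient $\nabla f$ are locally $q$-integrable, $\int_B|f-f_B|^q\,d\mu\le P\,r^q\int_B|\nabla f|^q\,d\mu$. Let $f\in C_0^\infty(M)$ be a real-valued function with $\int_M|\nabla f|^q\,d\mu<\infty$, and let $\alpha>0$. Then there are a countable (possibly empty) collection of open balls $B_i$ of positive radius, $C^1$ functions $b_i:M\to\mathbb R$, and a Lipschitz function $g:M\to\mathbb R$ such that $$f=g+\sum_i b_i \quad\text{everywhere on } M,$$ $$|\nabla g(x)|\le C\alpha\quad\text{for }\mu\text{-a.e. }x\in M\quad(\nabla g\text{ the weak gradient}),$$ $$\operatorname{supp} b_i\subset B_i\quad\text{and}\quad\int_{B_i}|\nabla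 b_i|^q\,d\mu\le C\alpha^q\mu(B_i)\quad\text{for all } i,$$ $$\sum_i\mu(B_i)\le C_0\,\alpha^{-q}\int_M|\nabla f|^q\,d\mu,$$ $$\sum_i\mathbf 1_{B_i}\le N\quad\text{everywhere on } M.$$ Here the constants $N$ and $C_0$ depend only on $q$ and $D$, and $C$ depends only on $q$, $D$ and $P$; none of them depends on $M$ (nor on its dimension), $f$ or $\alpha$. -/

import Mathlib

open MeasureTheory Manifold Bundle Topology Set Metric
open scoped ContDiff ENNReal NNReal

noncomputable section

namespace RiemannianCZ

/-- On a nonempty second countable manifold, countably many of the preferred charts cover. -/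
theorem exists_chart_cover (E : Type*) [NormedAddCommGroup E] [InnerProductSpace ℝ E]
    (M : Type*) [TopologicalSpace M] [ChartedSpace E M] [SecondCountableTopology M] [Nonempty M] :
    ∃ c : ℕ → M, ⋃ i, (extChartAt 𝓘(ℝ, E) (c i)).source = univ := by
  obtain ⟨s, hs, hU⟩ := TopologicalSpace.countable_cover_nhds
    (fun x : M => extChartAt_source_mem_nhds (I := 𝓘(ℝ, E)) x)
  have hne : s.Nonempty := by
    by_contra h
    rw [Set.not_nonempty_iff_eq_empty] at h
    subst h
    simp only [mem_empty_iff_false, iUnion_of_empty, iUnion_empty] at hU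
    exact Set.empty_ne_univ hU
  obtain ⟨c, rfl⟩ := hs.exists_eq_range hne
  exact ⟨c, by simpa using hU⟩

section Gradient

-- The manifolds are modelled on a finite-dimensional Euclidean space `E`; the inner product of `E`
-- is that of the coordinate space, unrelated to the Riemannian metric of `M`.
variable {E : Type*} [NormedAddCommGroup E] [InnerProductSpace ℝ E] [FiniteDimensional ℝ E]
  {M : Type*} [TopologicalSpace M] [ChartedSpace E M]

/-- The coordinate vector field of the preferred chart around `x` in the direction `v` of the
coordinate space (`∂/∂yₐ` if `v` is the `a`-th basis vector), at the point of `M` whose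
coordinates in this chart are `y`. -/
def coordVec (x : M) (y v : E) : TangentSpace 𝓘(ℝ, E) ((extChartAt 𝓘(ℝ, E) x).symm y) :=
  mfderiv 𝓘(ℝ, E) 𝓘(ℝ, E) (extChartAt 𝓘(ℝ, E) x).symm y v

variable [RiemannianBundle (fun p : M => TangentSpace 𝓘(ℝ, E) p)]

/-- The Riemannian gradient of `f` at `p`: the vector `v` with `⟨v, w⟩ = df_p(w)` for all `w`. -/
def grad (f : M → ℝ) (p : M) : TangentSpace 𝓘(ℝ, E) p :=
  haveI : FiniteDimensional ℝ (TangentSpace 𝓘(ℝ, E) p) :=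
    inferInstanceAs (FiniteDimensional ℝ E)
  haveI : CompleteSpace (TangentSpace 𝓘(ℝ, E) p) := FiniteDimensional.complete ℝ _
  (InnerProductSpace.toDual ℝ (TangentSpace 𝓘(ℝ, E) p)).symm (mfderiv 𝓘(ℝ, E) 𝓘(ℝ, ℝ) f p)

variable [MeasurableSpace E] [BorelSpace E]

/-- The vector field `G` is the weak (distributional) gradient of `f`: both are locally integrable
and, in every preferred chart, the components `⟨G, ∂_v⟩` are the weak partial derivatives of
the coordinate expression of `f`. -/
def IsWeakGrad (f : M → ℝ) (G : ∀ p : M, TangentSpace 𝓘(ℝ, E) p) : Prop :=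
  ∀ x : M,
    LocallyIntegrableOn (fun y => f ((extChartAt 𝓘(ℝ, E) x).symm y))
      (extChartAt 𝓘(ℝ, E) x).target volume ∧
    ∀ v : E,
      LocallyIntegrableOn
        (fun y => (inner ℝ (G ((extChartAt 𝓘(ℝ, E) x).symm y)) (coordVec x y v) : ℝ))
        (extChartAt 𝓘(ℝ, E) x).target volume ∧
      ∀ ψ : E → ℝ, ContDiff ℝ ∞ ψ → HasCompactSupport ψ →
        tsupport ψ ⊆ (extChartAt 𝓘(ℝ, E) x).target →
        ∫ y in (extChartAt 𝓘(ℝ, E) x).target,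
            f ((extChartAt 𝓘(ℝ, E) x).symm y) * fderiv ℝ ψ y v =
          - ∫ y in (extChartAt 𝓘(ℝ, E) x).target,
              (inner ℝ (G ((extChartAt 𝓘(ℝ, E) x).symm y)) (coordVec x y v) : ℝ) * ψ y

/-- The matrix `g_{ab} = ⟨∂/∂yₐ, ∂/∂y_b⟩` of the metric in the preferred chart around `x`, with
respect to orthonormal coordinates of `E`. -/
def metricMatrix (x : M) (y : E) :
    Matrix (Fin (Module.finrank ℝ E)) (Fin (Module.finrank ℝ E)) ℝ :=
  Matrix.of fun a b =>
    inner ℝ (coordVec x y (stdOrthonormalBasis ℝ E a)) (coordVec x y (stdOrthonormalBasis ℝ E b))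

/-- The measure `√(det g) dy` on the domain of the preferred chart around `x`. -/
def chartVolume [MeasurableSpace M] (x : M) : Measure M :=
  ((volume.restrict (extChartAt 𝓘(ℝ, E) x).target).withDensity
    fun y => ENNReal.ofReal (Real.sqrt (metricMatrix x y).det)).map (extChartAt 𝓘(ℝ, E) x).symm

end Gradient

/-- The Riemannian measure: `√(det g) dy` in local coordinates. The manifold is cut into countably
many disjoint Borel pieces, each inside the domain of a chart; by the change of variables formula
the result does not depend on how this is done. -/
def riemannianVolume (E : Type*) [NormedAddCommGroup E] [InnerProductSpace ℝ E]
    [FiniteDimensional ℝ E] [MeasurableSpace E] [BorelSpace E]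
    (M : Type*) [TopologicalSpace M] [ChartedSpace E M] [SecondCountableTopology M] [Nonempty M]
    [RiemannianBundle (fun p : M => TangentSpace 𝓘(ℝ, E) p)] [MeasurableSpace M] : Measure M :=
  Measure.sum fun i : ℕ =>
    (chartVolume (E := E) ((exists_chart_cover E M).choose i)).restrict
      (disjointed (fun j => (extChartAt 𝓘(ℝ, E) ((exists_chart_cover E M).choose j)).source) i)

/-- The doubling property with constant `D`: `μ(B(x, 2r)) ≤ D μ(B(x, r))`. -/
def Doubling {M : Type*} [MetricSpace M] [MeasurableSpace M] (μ : Measure M) (D : ℝ≥0) : Prop :=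
  ∀ (x : M) (r : ℝ), 0 < r → μ (ball x (2 * r)) ≤ D * μ (ball x r)

/-- The scaled `L^q` Poincaré inequality with constant `P`, on all balls and for all `f` that are,
with their weak gradient `G`, locally `q`-integrable:
`∫_B |f - f_B|^q dμ ≤ P r^q ∫_B |∇f|^q dμ`. -/
def Poincare (E : Type*) [NormedAddCommGroup E] [InnerProductSpace ℝ E]
    [FiniteDimensional ℝ E] [MeasurableSpace E] [BorelSpace E]
    {M : Type*} [MetricSpace M] [ChartedSpace E M]
    [RiemannianBundle (fun p : M => TangentSpace 𝓘(ℝ, E) p)] [MeasurableSpace M]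
    (μ : Measure M) (q : ℝ) (P : ℝ≥0) : Prop :=
  ∀ (f : M → ℝ) (G : ∀ p : M, TangentSpace 𝓘(ℝ, E) p), IsWeakGrad f G →
    LocallyIntegrable (fun p => |f p| ^ q) μ → LocallyIntegrable (fun p => ‖G p‖ ^ q) μ →
    ∀ (x : M) (r : ℝ), 0 < r →
      ∫⁻ y in ball x r, ‖f y - ⨍ z in ball x r, f z ∂μ‖ₑ ^ q ∂μ ≤
        P * ENNReal.ofReal r ^ q * ∫⁻ y in ball x r, ‖G y‖ₑ ^ q ∂μ

end RiemannianCZ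

end

open RiemannianCZ

set_option linter.unusedSectionVars false

namespace RiemannianCZ

/-! Put w = |∇f|^q and let Ω be the set where the uncentered maximal function of w exceeds α^q. It
is open, and Vitali's covering lemma gives μ(Ω) ≤ D³ α^{-q} ∫ w. An unbounded doubling space has
infinite measure, so F = Ωᶜ is nonempty (`Doubling.maximalSet_bounds`). Cover Ω by Whitney balls B_n
whose radius is a tenth of the distance from the center to F (`exists_isWhitney`), take a
subordinate partition of unity χ_n, and set b_n = (f - f_{B_n}) χ_n. Then g = f - Σ b_n equals f on
F and Σ f_{B_n} χ_n on Ω: it is a Whitney extension of f restricted to F.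

A ball that contains a point of F has mean of w at most α^q. By Poincaré, the means of f over two
comparable balls near a point of F therefore differ by O(α · radius)
(`abs_setAverage_sub_setAverage_le`). Telescoping over shrinking balls shows that f is
O(α)-Lipschitz on F and that f_{B_n} is within O(α · radius) of f at nearby points of F. Whitney's
argument makes g O(α)-Lipschitz on M (`IsBumpFamily.abs_whitneyExtension_sub_whitneyExtension_le`),
which bounds ∇g without differentiating the series. For b_n, the product rule, |∇χ_n| = O(1/r_n) and
Poincaré on B_n suffice (`lintegral_grad_sub_const_mul_le`).

The constants must not see the dimension. The smooth bumps are therefore built from tent functions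
of the distance, mollified in charts so small that the metric is almost constant, and glued with
negligible error (`exists_smooth_approx`). Rademacher's theorem and integration by parts in charts
identify the pointwise gradient of a Lipschitz function with its weak gradient
(`isWeakGrad_grad_of_lipschitzWith`). Beyond doubling and Poincaré, the only fact used about the
Riemannian measure is that some ball has positive finite measure; doubling carries this to all
balls. -/

theorem exists_lt_dist_of_noncompactSpace {X : Type*} [MetricSpace X] [ProperSpace X]
    [NoncompactSpace X] (x : X) (R : ℝ) :
    ∃ y, R < dist y x := by
  by_contra! h
  refine noncompact_univ X ?_
  convert isCompact_closedBall x R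
  exact (eq_univ_of_forall fun y => mem_closedBall.2 (h y)).symm

/-! ### Doubling measures: comparison of balls, properness, infinite total mass -/

section DoublingMeasures

variable {X : Type*} [MetricSpace X] [MeasurableSpace X] {μ : Measure X} {D : ℝ≥0}

theorem Doubling.measure_ball_pow_le (hD : Doubling μ D) (x : X) {r : ℝ} (hr : 0 < r) (k : ℕ) :
    μ (ball x (2 ^ k * r)) ≤ (D : ℝ≥0∞) ^ k * μ (ball x r) := by
  induction k with
  | zero => simp
  | succ k ih =>
    calc μ (ball x (2 ^ (k + 1) * r)) = μ (ball x (2 * (2 ^ k * r))) := by ring_nf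
      _ ≤ D * μ (ball x (2 ^ k * r)) := hD x _ (by positivity)
      _ ≤ D * ((D : ℝ≥0∞) ^ k * μ (ball x r)) := by gcongr
      _ = _ := by ring

/-- Comparison of the measures of two balls, the first one lying in a dyadic dilate of the
second one. -/
theorem Doubling.measure_ball_le (hD : Doubling μ D) {x y : X} {r s : ℝ} (hs : 0 < s) (k : ℕ)
    (h : r + dist x y ≤ 2 ^ k * s) : μ (ball x r) ≤ (D : ℝ≥0∞) ^ k * μ (ball y s) :=
  (measure_mono (ball_subset_ball' h)).trans (hD.measure_ball_pow_le y hs k)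

theorem exists_le_two_pow_mul {s : ℝ} (hs : 0 < s) (r : ℝ) : ∃ k : ℕ, r ≤ 2 ^ k * s := by
  obtain ⟨k, hk⟩ := pow_unbounded_of_one_lt (r / s) one_lt_two
  exact ⟨k, ((div_lt_iff₀ hs).1 hk).le⟩

theorem Doubling.measure_ball_lt_top (hD : Doubling μ D) {x₀ : X} {r₀ : ℝ} (hr₀ : 0 < r₀)
    (h : μ (ball x₀ r₀) ≠ ⊤) (x : X) (r : ℝ) : μ (ball x r) < ⊤ := by
  obtain ⟨k, hk⟩ := exists_le_two_pow_mul hr₀ (r + dist x x₀)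
  exact (hD.measure_ball_le hr₀ k hk).trans_lt
    (ENNReal.mul_lt_top (ENNReal.pow_lt_top ENNReal.coe_lt_top) h.lt_top)

theorem Doubling.measure_ball_pos (hD : Doubling μ D) {x₀ : X} {r₀ : ℝ}
    (h : μ (ball x₀ r₀) ≠ 0) (x : X) {r : ℝ} (hr : 0 < r) : 0 < μ (ball x r) := by
  obtain ⟨k, hk⟩ := exists_le_two_pow_mul hr (r₀ + dist x₀ x)
  refine pos_iff_ne_zero.2 fun h0 => h ?_
  simpa [h0] using hD.measure_ball_le hr k hk

/-- Packing: disjoint balls of radius ε/6 centered in the ball each carry a fixed fraction of its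
measure, by doubling, so there are finitely many. Their fivefold enlargements have radius 5ε/6 < ε.
-/
theorem Doubling.totallyBounded_ball [BorelSpace X] (hD : Doubling μ D)
    (hpos : ∀ (x : X) (r : ℝ), 0 < r → 0 < μ (ball x r))
    (hfin : ∀ (x : X) (r : ℝ), μ (ball x r) < ⊤) (x₀ : X) (R : ℝ) :
    TotallyBounded (ball x₀ R) := by
  rw [Metric.totallyBounded_iff]
  intro ε hε
  rcases le_or_gt R 0 with hR | hR
  · exact ⟨∅, finite_empty, by simp [ball_eq_empty.2 hR]⟩
  obtain ⟨u, hu, hdisj, hcov⟩ := Vitali.exists_disjoint_subfamily_covering_enlargement_closedBall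
    (ball x₀ R) (fun x => x) (fun _ => ε / 6) (ε / 6) (fun _ _ => le_rfl) 5 (by norm_num)
  obtain ⟨k, hk⟩ := exists_le_two_pow_mul (show 0 < ε / 6 by positivity) (R + R)
  have hsub : (⋃ x : u, ball (x : X) (ε / 6)) ⊆ ball x₀ (R + ε) := by
    refine iUnion_subset fun x => ball_subset_ball' ?_
    have := mem_ball.1 (hu x.2)
    linarith
  have hDk : (D : ℝ≥0∞) ^ k ≠ ⊤ := ENNReal.pow_ne_top ENNReal.coe_ne_top
  have hfinite : (univ : Set u).Finite := by
    have hc : 0 < μ (ball x₀ R) / (D : ℝ≥0∞) ^ k :=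
      ENNReal.div_pos (hpos _ _ hR).ne' hDk
    refine (Measure.finite_const_le_meas_of_disjoint_iUnion μ hc
      (As := fun x : u => ball (x : X) (ε / 6)) (fun _ => measurableSet_ball) ?_ ?_).subset ?_
    · intro x y hxy
      exact (hdisj x.2 y.2 (fun h => hxy (Subtype.ext h))).mono ball_subset_closedBall
        ball_subset_closedBall
    · exact ((measure_mono hsub).trans_lt (hfin _ _)).ne
    · intro x _
      refine ENNReal.div_le_of_le_mul ?_
      rw [mul_comm]
      refine hD.measure_ball_le (by positivity) k ?_
      have := mem_ball.1 (hu x.2)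
      rw [dist_comm] at this
      linarith
  refine ⟨u, by simpa using hfinite.image Subtype.val, fun x hx => ?_⟩
  obtain ⟨b, hb, hsub⟩ := hcov x hx
  refine mem_biUnion hb ?_
  have := mem_closedBall.1 (hsub (mem_closedBall_self (by positivity)))
  rw [mem_ball]
  linarith

theorem Doubling.properSpace [BorelSpace X] [CompleteSpace X] (hD : Doubling μ D)
    (hpos : ∀ (x : X) (r : ℝ), 0 < r → 0 < μ (ball x r))
    (hfin : ∀ (x : X) (r : ℝ), μ (ball x r) < ⊤) : ProperSpace X := by
  refine ⟨fun x r => isCompact_iff_totallyBounded_isComplete.2 ⟨?_, isClosed_closedBall.isComplete⟩⟩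
  exact (hD.totallyBounded_ball hpos hfin x (r + 1)).subset
    (closedBall_subset_ball (by linarith))

/-- An unbounded space has infinite doubling measure. -/
theorem Doubling.measure_univ_eq_top [BorelSpace X] (hD : Doubling μ D)
    (hpos : ∀ (x : X) (r : ℝ), 0 < r → 0 < μ (ball x r)) (x₀ : X)
    (hunb : ∀ R, ∃ y, R < dist y x₀) : μ univ = ⊤ := by
  by_contra htop
  have hDpos : (D : ℝ≥0∞) ^ 2 ≠ 0 := by
    intro h0
    have := hD.measure_ball_pow_le x₀ one_pos 2
    rw [h0, zero_mul] at this
    exact (hpos x₀ (2 ^ 2 * 1) (by norm_num)).ne' (le_antisymm this bot_le)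
  have hDtop : (D : ℝ≥0∞) ^ 2 ≠ ⊤ := ENNReal.pow_ne_top ENNReal.coe_ne_top
  set c : ℝ≥0∞ := ((D : ℝ≥0∞) ^ 2)⁻¹ with hc
  -- A point farther than 2n + 1 from x₀ is the center of a ball disjoint from `ball x₀ n` and with
  -- at least c times its measure. Letting n tend to infinity gives (1 + c) μ(X) ≤ μ(X), impossible
  -- for a finite positive mass.
  have key : ∀ n : ℕ, (1 + c) * μ (ball x₀ n) ≤ μ univ := by
    intro n
    obtain ⟨y, hy⟩ := hunb (2 * n + 1)
    have hn : (0 : ℝ) ≤ n := n.cast_nonneg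
    have hd : Disjoint (ball x₀ n) (ball y (dist y x₀ / 2)) := by
      refine ball_disjoint_ball ?_
      rw [dist_comm x₀ y]
      linarith
    have h1 : μ (ball x₀ n) ≤ (D : ℝ≥0∞) ^ 2 * μ (ball y (dist y x₀ / 2)) := by
      refine hD.measure_ball_le (by linarith) 2 ?_
      rw [dist_comm x₀ y]
      linarith
    have h2 : c * μ (ball x₀ n) ≤ μ (ball y (dist y x₀ / 2)) := by
      rw [hc, mul_comm, ← div_eq_mul_inv]
      exact ENNReal.div_le_of_le_mul' h1
    calc (1 + c) * μ (ball x₀ n) = μ (ball x₀ n) + c * μ (ball x₀ n) := by ring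
      _ ≤ μ (ball x₀ n) + μ (ball y (dist y x₀ / 2)) := by gcongr
      _ = μ (ball x₀ n ∪ ball y (dist y x₀ / 2)) := (measure_union hd measurableSet_ball).symm
      _ ≤ μ univ := measure_mono (subset_univ _)
  have hlim : Filter.Tendsto (fun n : ℕ => μ (ball x₀ n)) Filter.atTop (𝓝 (μ univ)) := by
    rw [← iUnion_ball_nat x₀]
    exact tendsto_measure_iUnion_atTop fun m n h => ball_subset_ball (by exact_mod_cast h)
  have h3 : (1 + c) * μ univ ≤ μ univ :=
    le_of_tendsto (ENNReal.Tendsto.const_mul hlim (Or.inr (by simp [hc, hDpos]))) (.of_forall key)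
  have hm : 0 < μ univ := (hpos x₀ 1 one_pos).trans_le (measure_mono (subset_univ _))
  have hcm : 0 < c * μ univ := ENNReal.mul_pos (by simp [hc, hDtop]) hm.ne'
  rw [add_mul, one_mul] at h3
  exact absurd h3 (not_le.2 (ENNReal.lt_add_right htop hcm.ne'))

end DoublingMeasures

/-! ### The superlevel set of the maximal function -/

section MaximalSet

variable {X : Type*} [MetricSpace X] [MeasurableSpace X]

/-- The set where the uncentered maximal function of `w` exceeds `t`. -/
def maximalSet (μ : Measure X) (w : X → ℝ≥0∞) (t : ℝ≥0∞) : Set X :=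
  {x | ∃ c r, 0 < r ∧ x ∈ ball c r ∧ t * μ (ball c r) < ∫⁻ y in ball c r, w y ∂μ}

variable {μ : Measure X} {w : X → ℝ≥0∞} {t : ℝ≥0∞} {D : ℝ≥0}

theorem isOpen_maximalSet : IsOpen (maximalSet μ w t) := by
  rw [Metric.isOpen_iff]
  rintro x ⟨c, r, hr, hx, h⟩
  obtain ⟨ε, hε, hsub⟩ := Metric.isOpen_iff.1 isOpen_ball x hx
  exact ⟨ε, hε, fun y hy => ⟨c, r, hr, hsub hy, h⟩⟩

theorem lintegral_ball_le_of_notMem_maximalSet {x c : X} {r : ℝ} (hx : x ∉ maximalSet μ w t)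
    (h : x ∈ ball c r) : ∫⁻ y in ball c r, w y ∂μ ≤ t * μ (ball c r) := by
  by_contra! hlt
  exact hx ⟨c, r, pos_of_mem_ball h, h, hlt⟩

/-- Such a ball must meet the support of w, which locates its center, and its measure is at most ∫ w
/ t. If it were very large, its fourfold dilate would contain a ball about x₀ of measure above D² ∫
w / t. Vitali's lemma needs the bound on radii; both bounds together keep the maximal set bounded.
-/
theorem Doubling.exists_radius_bound [BorelSpace X] (hD : Doubling μ D) (htop : μ univ = ⊤)
    (ht : t ≠ 0) (ht' : t ≠ ⊤) (hw : ∫⁻ y, w y ∂μ ≠ ⊤) {x₀ : X} {R₀ : ℝ}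
    (hsupp : ∀ y, y ∉ ball x₀ R₀ → w y = 0) :
    ∃ R, ∀ (c : X) (r : ℝ), 0 < r → t * μ (ball c r) < ∫⁻ y in ball c r, w y ∂μ →
      r ≤ R ∧ dist c x₀ ≤ R₀ + r := by
  have hlim : Filter.Tendsto (fun n : ℕ => μ (ball x₀ n)) Filter.atTop (𝓝 (μ univ)) := by
    rw [← iUnion_ball_nat x₀]
    exact tendsto_measure_iUnion_atTop fun m n h => ball_subset_ball (by exact_mod_cast h)
  rw [htop] at hlim
  set A : ℝ≥0∞ := (D : ℝ≥0∞) ^ 2 * ((∫⁻ y, w y ∂μ) / t) with hA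
  have hAtop : A < ⊤ := ENNReal.mul_lt_top (ENNReal.pow_lt_top ENNReal.coe_lt_top)
    (ENNReal.div_lt_top hw ht)
  obtain ⟨n, hn⟩ := (hlim.eventually (lt_mem_nhds hAtop)).exists
  refine ⟨max n R₀, fun c r hr h => ?_⟩
  have hdist : dist c x₀ ≤ R₀ + r := by
    by_contra! hlt
    have : ∫⁻ y in ball c r, w y ∂μ = 0 := by
      refine (setLIntegral_congr_fun measurableSet_ball fun y hy => hsupp y fun hy' => ?_).trans
        (lintegral_zero)
      have := dist_triangle_left c x₀ y
      rw [mem_ball] at hy hy'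
      linarith
    simp [this] at h
  refine ⟨?_, hdist⟩
  by_contra! hlt
  obtain ⟨hnr, hRr⟩ := max_lt_iff.1 hlt
  have h1 : μ (ball x₀ n) ≤ (D : ℝ≥0∞) ^ 2 * μ (ball c r) := by
    refine hD.measure_ball_le hr 2 ?_
    rw [dist_comm]
    linarith
  have h2 : μ (ball c r) ≤ (∫⁻ y, w y ∂μ) / t := by
    rw [ENNReal.le_div_iff_mul_le (Or.inl ht) (Or.inl ht'), mul_comm]
    exact h.le.trans (setLIntegral_le_lintegral _ _)
  exact absurd (hn.trans_le (h1.trans (by rw [hA]; gcongr))) (lt_irrefl _)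

/-- Weak type (1,1) by Vitali: a disjoint subfamily whose fivefold enlargements cover. The factor 5
is rounded up to 2³, hence D³. -/
theorem Doubling.mul_measure_maximalSet_le [BorelSpace X] [SecondCountableTopology X]
    (hD : Doubling μ D) {R : ℝ}
    (hR : ∀ (c : X) (r : ℝ), 0 < r → t * μ (ball c r) < ∫⁻ y in ball c r, w y ∂μ → r ≤ R) :
    t * μ (maximalSet μ w t) ≤ (D : ℝ≥0∞) ^ 3 * ∫⁻ y, w y ∂μ := by
  obtain ⟨u, hu, hdisj, hcov⟩ := Vitali.exists_disjoint_subfamily_covering_enlargement_closedBall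
    {p : X × ℝ | 0 < p.2 ∧ t * μ (ball p.1 p.2) < ∫⁻ y in ball p.1 p.2, w y ∂μ}
    Prod.fst Prod.snd R (fun p hp => hR _ _ hp.1 hp.2) 5 (by norm_num)
  have hdisj' : u.PairwiseDisjoint fun p => ball p.1 p.2 :=
    hdisj.mono_on fun p _ => ball_subset_closedBall
  have hcount : u.Countable := hdisj'.countable_of_isOpen (fun _ _ => isOpen_ball)
    fun p hp => nonempty_ball.2 (hu hp).1
  have hsub : maximalSet μ w t ⊆ ⋃ p ∈ u, ball p.1 (2 ^ 3 * p.2) := by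
    rintro x ⟨c, r, hr, hx, h⟩
    obtain ⟨b, hb, hsub⟩ := hcov (c, r) ⟨hr, h⟩
    refine mem_biUnion hb (closedBall_subset_ball ?_ (hsub (ball_subset_closedBall hx)))
    have := (hu hb).1
    linarith
  calc t * μ (maximalSet μ w t) ≤ t * ∑' p : u, μ (ball p.1.1 (2 ^ 3 * p.1.2)) := by
        gcongr
        exact (measure_mono hsub).trans (measure_biUnion_le _ hcount _)
    _ = ∑' p : u, t * μ (ball p.1.1 (2 ^ 3 * p.1.2)) := ENNReal.tsum_mul_left.symm
    _ ≤ ∑' p : u, (D : ℝ≥0∞) ^ 3 * ∫⁻ y in ball p.1.1 p.1.2, w y ∂μ := by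
        refine ENNReal.tsum_le_tsum fun p => ?_
        calc t * μ (ball p.1.1 (2 ^ 3 * p.1.2))
            ≤ t * ((D : ℝ≥0∞) ^ 3 * μ (ball p.1.1 p.1.2)) := by
              gcongr
              exact hD.measure_ball_pow_le _ (hu p.2).1 3
          _ = (D : ℝ≥0∞) ^ 3 * (t * μ (ball p.1.1 p.1.2)) := by ring
          _ ≤ _ := by
              gcongr
              exact (hu p.2).2.le
    _ = (D : ℝ≥0∞) ^ 3 * ∫⁻ y in ⋃ p ∈ u, ball p.1 p.2, w y ∂μ := by
        rw [ENNReal.tsum_mul_left, lintegral_biUnion hcount (fun _ _ => measurableSet_ball) hdisj']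
    _ ≤ _ := by
        gcongr
        exact Measure.restrict_le_self

end MaximalSet

/-! ### Whitney coverings -/

section Whitney

variable {X : Type*} [MetricSpace X] {F : Set X}

/-- A Whitney family for the complement of the closed set `F`: centers `c n`, `n ∈ s`, such that
the balls of radius `infDist (c n) F / 100` are disjoint and their fivefold dilates cover. -/
structure IsWhitney (F : Set X) (s : Set ℕ) (c : ℕ → X) : Prop where
  notMem : ∀ n ∈ s, c n ∉ F
  disjoint : s.PairwiseDisjoint fun n => closedBall (c n) (infDist (c n) F / 100)
  cover : ∀ x ∉ F, ∃ n ∈ s, x ∈ closedBall (c n) (infDist (c n) F / 20)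

/-- Vitali's lemma for the balls of radius `infDist x F / 100`. The centers are indexed by natural
numbers because the partition of unity below uses an order on the indices. -/
theorem exists_isWhitney [SecondCountableTopology X] [Nonempty X] (hF : IsClosed F)
    (hne : F.Nonempty) {R : ℝ} (hR : ∀ x ∉ F, infDist x F ≤ R) :
    ∃ (s : Set ℕ) (c : ℕ → X), IsWhitney F s c := by
  obtain ⟨u, hu, hdisj, hcov⟩ := Vitali.exists_disjoint_subfamily_covering_enlargement_closedBall
    Fᶜ (fun x => x) (fun x => infDist x F / 100) (R / 100)
    (fun x hx => by have := hR x hx; linarith) 5 (by norm_num)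
  have hpos : ∀ x ∈ u, 0 < infDist x F := fun x hx => (hF.notMem_iff_infDist_pos hne).1 (hu hx)
  have hcount : u.Countable :=
    (hdisj.mono_on fun p _ => ball_subset_closedBall).countable_of_isOpen (fun _ _ => isOpen_ball)
      fun p hp => nonempty_ball.2 (by have := hpos p hp; positivity)
  obtain ⟨e, he⟩ := hcount.exists_injective_nat
  have hc : ∀ x : u, Function.extend e Subtype.val (fun _ => Classical.arbitrary X) (e x) = x :=
    fun x => he.extend_apply _ _ x
  refine ⟨range e, Function.extend e Subtype.val fun _ => Classical.arbitrary X, ?_, ?_, ?_⟩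
  · rintro _ ⟨x, rfl⟩
    rw [hc]
    exact hu x.2
  · rintro _ ⟨x, rfl⟩ _ ⟨y, rfl⟩ hxy
    simp only [Function.onFun, hc]
    exact hdisj x.2 y.2 fun h => hxy (congrArg e (Subtype.ext h))
  · intro x hx
    obtain ⟨b, hb, hsub⟩ := hcov x hx
    refine ⟨e ⟨b, hb⟩, mem_range_self _, ?_⟩
    rw [hc]
    have := hsub (mem_closedBall_self (by have := infDist_nonneg (x := x) (s := F); positivity))
    rw [mem_closedBall] at this ⊢
    simp only at this ⊢
    linarith

namespace IsWhitney

variable {s : Set ℕ} {c : ℕ → X} {n : ℕ} {x : X}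

theorem infDist_pos (h : IsWhitney F s c) (hF : IsClosed F) (hne : F.Nonempty) (hn : n ∈ s) :
    0 < infDist (c n) F := (hF.notMem_iff_infDist_pos hne).1 (h.notMem n hn)

/-- On a Whitney ball the distance to `F` is comparable to the one of the center. -/
theorem infDist_bounds (hx : x ∈ ball (c n) (infDist (c n) F / 10)) :
    9 / 10 * infDist (c n) F < infDist x F ∧ infDist x F < 11 / 10 * infDist (c n) F := by
  have h1 := infDist_le_infDist_add_dist (s := F) (x := x) (y := c n)
  have h2 := infDist_le_infDist_add_dist (s := F) (x := c n) (y := x)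
  rw [dist_comm] at h2
  rw [mem_ball] at hx
  constructor <;> linarith

theorem notMem_of_mem_ball (hx : x ∈ ball (c n) (infDist (c n) F / 10)) : x ∉ F := by
  intro hxF
  have h0 := infDist_zero_of_mem hxF
  have h1 := (infDist_bounds hx).1
  have h2 := infDist_nonneg (x := c n) (s := F)
  linarith

variable [MeasurableSpace X] [BorelSpace X] {μ : Measure X} {D : ℝ≥0}

/-- Volume count: if x lies in several of the balls, the disjoint small balls with the same centers
all lie in a ball about x of radius `infDist x F / 2`, and each carries at least the fraction D⁻⁷ of
its measure. -/
theorem encard_le (h : IsWhitney F s c) (hD : Doubling μ D)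
    (hpos : ∀ (x : X) (r : ℝ), 0 < r → 0 < μ (ball x r))
    (hfin : ∀ (x : X) (r : ℝ), μ (ball x r) < ⊤) {N : ℕ} (hN : D ^ 7 ≤ N) (x : X) :
    {n ∈ s | x ∈ ball (c n) (infDist (c n) F / 10)}.encard ≤ N := by
  by_contra! hlt
  obtain ⟨t, hts, htcard⟩ := exists_subset_encard_eq (Order.add_one_le_of_lt hlt)
  have htfin : t.Finite := finite_of_encard_eq_coe (k := N + 1) (by simpa using htcard)
  lift t to Finset ℕ using htfin
  rw [encard_coe_eq_coe_finsetCard] at htcard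
  have hcard : t.card = N + 1 := by exact_mod_cast htcard
  obtain ⟨m, hm⟩ : t.Nonempty := Finset.card_pos.1 (by omega)
  have hx : 0 < infDist x F := by
    have h1 := (infDist_bounds (hts hm).2).1
    have h2 := infDist_nonneg (x := c m) (s := F)
    linarith
  have hsmall : ∀ n ∈ t, μ (ball x (infDist x F / 2)) ≤
      (D : ℝ≥0∞) ^ 7 * μ (ball (c n) (infDist (c n) F / 100)) := by
    -- With δ = `infDist (c n) F`, radius plus distance is at most 0.55 δ + 0.1 δ = 0.65 δ. This is
    -- below 2⁷ δ/100 but not below 2⁶ δ/100, hence the exponent 7.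
    intro n hn
    have hb := infDist_bounds (hts hn).2
    have hd := mem_ball.1 (hts hn).2
    refine hD.measure_ball_le (by linarith) 7 (by linarith)
  have hsum : ∑ n ∈ t, μ (ball (c n) (infDist (c n) F / 100)) ≤ μ (ball x (infDist x F / 2)) := by
    rw [← measure_biUnion_finset _ fun _ _ => measurableSet_ball]
    · refine measure_mono (iUnion₂_subset fun n hn => ball_subset_ball' ?_)
      have hb := infDist_bounds (hts hn).2
      have hd := mem_ball.1 (hts hn).2
      rw [dist_comm] at hd
      linarith
    · intro i hi j hj hij
      exact (h.disjoint (hts hi).1 (hts hj).1 hij).mono ball_subset_closedBall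
        ball_subset_closedBall
  have hmain : ((N + 1 : ℕ) : ℝ≥0∞) * μ (ball x (infDist x F / 2)) ≤
      (D : ℝ≥0∞) ^ 7 * μ (ball x (infDist x F / 2)) := by
    calc ((N + 1 : ℕ) : ℝ≥0∞) * μ (ball x (infDist x F / 2))
        = ∑ n ∈ t, μ (ball x (infDist x F / 2)) := by
          rw [Finset.sum_const, hcard, nsmul_eq_mul]
      _ ≤ ∑ n ∈ t, (D : ℝ≥0∞) ^ 7 * μ (ball (c n) (infDist (c n) F / 100)) :=
          Finset.sum_le_sum hsmall
      _ ≤ _ := by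
          rw [← Finset.mul_sum]
          gcongr
  rw [ENNReal.mul_le_mul_iff_left (hpos _ _ (by positivity)).ne' (hfin _ _).ne] at hmain
  have h1 : ((N + 1 : ℕ) : ℝ≥0) ≤ D ^ 7 := by exact_mod_cast hmain
  have h2 := h1.trans hN
  have h3 : N + 1 ≤ N := by exact_mod_cast h2
  omega

/-- The balls of radius δ/100 are disjoint and avoid F; enlarging them to δ/10 costs D⁴ since 10 ≤
2⁴. -/
theorem tsum_measure_le (h : IsWhitney F s c) (hF : IsClosed F) (hne : F.Nonempty)
    (hD : Doubling μ D) :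
    ∑' n : s, μ (ball (c n) (infDist (c n) F / 10)) ≤ (D : ℝ≥0∞) ^ 4 * μ Fᶜ := by
  calc ∑' n : s, μ (ball (c n) (infDist (c n) F / 10))
      ≤ ∑' n : s, (D : ℝ≥0∞) ^ 4 * μ (ball (c n) (infDist (c n) F / 100)) := by
        refine ENNReal.tsum_le_tsum fun n => ?_
        have := h.infDist_pos hF hne n.2
        refine hD.measure_ball_le (by positivity) 4 ?_
        rw [dist_self]
        linarith
    _ = (D : ℝ≥0∞) ^ 4 * ∑' n : s, μ (ball (c n) (infDist (c n) F / 100)) :=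
        ENNReal.tsum_mul_left
    _ ≤ (D : ℝ≥0∞) ^ 4 * μ (⋃ n : s, ball (c n) (infDist (c n) F / 100)) := by
        gcongr
        refine tsum_meas_le_meas_iUnion_of_disjoint μ (fun _ => measurableSet_ball) ?_
        intro i j hij
        exact (h.disjoint i.2 j.2 fun h => hij (Subtype.ext h)).mono ball_subset_closedBall
          ball_subset_closedBall
    _ ≤ _ := by
        gcongr
        refine iUnion_subset fun n x hx => ?_
        have := h.infDist_pos hF hne n.2
        exact notMem_of_mem_ball (ball_subset_ball (by linarith) hx)

end IsWhitney

end Whitney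

/-! ### Partition of unity and Whitney extension -/

theorem abs_prod_sub_prod_le {ι : Type*} (t : Finset ι) (a b : ι → ℝ)
    (ha : ∀ i, 0 ≤ a i ∧ a i ≤ 1) (hb : ∀ i, 0 ≤ b i ∧ b i ≤ 1) :
    |∏ i ∈ t, a i - ∏ i ∈ t, b i| ≤ ∑ i ∈ t, |a i - b i| := by
  classical
  induction t using Finset.induction_on with
  | empty => simp
  | insert i t hi ih =>
    rw [Finset.prod_insert hi, Finset.prod_insert hi, Finset.sum_insert hi]
    have h1 : a i * ∏ j ∈ t, a j - b i * ∏ j ∈ t, b j =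
        (a i - b i) * ∏ j ∈ t, a j + b i * (∏ j ∈ t, a j - ∏ j ∈ t, b j) := by ring
    have h2 : 0 ≤ ∏ j ∈ t, a j := Finset.prod_nonneg fun j _ => (ha j).1
    have h3 : ∏ j ∈ t, a j ≤ 1 := Finset.prod_le_one (fun j _ => (ha j).1) fun j _ => (ha j).2
    rw [h1]
    refine (abs_add_le _ _).trans (add_le_add ?_ ?_)
    · rw [abs_mul, abs_of_nonneg h2]
      exact mul_le_of_le_one_right (abs_nonneg _) h3
    · rw [abs_mul, abs_of_nonneg (hb i).1]
      exact (mul_le_of_le_one_left (abs_nonneg _) (hb i).2).trans ih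

section Partition

variable {X : Type*} [MetricSpace X] {F : Set X} {s : Set ℕ} {c : ℕ → X} {ψ : ℕ → X → ℝ} {L : ℝ}
  {N : ℕ}

/-- Bump functions adapted to the Whitney balls with centers `c n`, `n ∈ s`. -/
structure IsBumpFamily (F : Set X) (s : Set ℕ) (c : ℕ → X) (ψ : ℕ → X → ℝ) (L : ℝ) : Prop where
  nonneg : ∀ n x, 0 ≤ ψ n x
  le_one : ∀ n x, ψ n x ≤ 1
  mem : ∀ n x, ψ n x ≠ 0 → n ∈ s ∧ x ∈ ball (c n) (infDist (c n) F / 10)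
  eq_one : ∀ n ∈ s, ∀ x ∈ closedBall (c n) (infDist (c n) F / 20), ψ n x = 1
  lip : ∀ n ∈ s, ∀ x y, |ψ n x - ψ n y| ≤ L / infDist (c n) F * dist x y

/-- The partition of unity obtained from a sequence of bump functions. -/
def bumpPartition {X : Type*} (ψ : ℕ → X → ℝ) (n : ℕ) (x : X) : ℝ :=
  ψ n x * ∏ j ∈ Finset.range n, (1 - ψ j x)

theorem sum_range_bumpPartition {X : Type*} (ψ : ℕ → X → ℝ) (m : ℕ) (x : X) :
    ∑ n ∈ Finset.range m, bumpPartition ψ n x = 1 - ∏ j ∈ Finset.range m, (1 - ψ j x) := by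
  induction m with
  | zero => simp
  | succ m ih =>
    rw [Finset.sum_range_succ, ih, Finset.prod_range_succ, bumpPartition]
    ring

theorem exists_finset_of_encard_le {t : Set ℕ} (h : t.encard ≤ N) :
    ∃ T : Finset ℕ, T.card ≤ N ∧ ∀ n, n ∈ T ↔ n ∈ t := by
  have hfin : t.Finite := finite_of_encard_le_coe h
  lift t to Finset ℕ using hfin
  rw [encard_coe_eq_coe_finsetCard] at h
  exact ⟨t, by exact_mod_cast h, fun n => by simp⟩

namespace IsBumpFamily

variable (h : IsBumpFamily F s c ψ L)

include h

theorem prod_mem_Icc (t : Finset ℕ) (x : X) :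
    0 ≤ ∏ j ∈ t, (1 - ψ j x) ∧ ∏ j ∈ t, (1 - ψ j x) ≤ 1 :=
  ⟨Finset.prod_nonneg fun j _ => sub_nonneg.2 (h.le_one j x),
    Finset.prod_le_one (fun j _ => sub_nonneg.2 (h.le_one j x))
      fun j _ => sub_le_self _ (h.nonneg j x)⟩

theorem partition_nonneg (n : ℕ) (x : X) : 0 ≤ bumpPartition ψ n x :=
  mul_nonneg (h.nonneg n x) (h.prod_mem_Icc _ x).1

theorem partition_le (n : ℕ) (x : X) : bumpPartition ψ n x ≤ ψ n x :=
  mul_le_of_le_one_right (h.nonneg n x) (h.prod_mem_Icc _ x).2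

theorem partition_mem (n : ℕ) (x : X) (hn : bumpPartition ψ n x ≠ 0) :
    n ∈ s ∧ x ∈ ball (c n) (infDist (c n) F / 10) :=
  h.mem n x (left_ne_zero_of_mul hn)

/-- Partial sums telescope to 1 - ∏ (1 - ψ j x), and the product vanishes because x lies in a
covering ball on which some ψ k equals 1. -/
theorem sum_partition (hW : IsWhitney F s c) {x : X} (hx : x ∉ F) {T : Finset ℕ}
    (hT : ∀ n ∈ s, x ∈ ball (c n) (infDist (c n) F / 10) → n ∈ T) :
    ∑ n ∈ T, bumpPartition ψ n x = 1 := by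
  classical
  obtain ⟨k, hk, hxk⟩ := hW.cover x hx
  set m := (T.sup id) + k + 1
  have hsub : T ⊆ Finset.range m := fun n hn => by
    have : n ≤ T.sup id := Finset.le_sup (f := id) hn
    exact Finset.mem_range.2 (by omega)
  rw [Finset.sum_subset hsub, sum_range_bumpPartition,
    Finset.prod_eq_zero (Finset.mem_range.2 (show k < m by omega)), sub_zero]
  · rw [h.eq_one k hk x hxk, sub_self]
  · intro n _ hn
    by_contra h0
    exact hn (hT n (h.partition_mem n x h0).1 (h.partition_mem n x h0).2)

theorem nonneg_const (hF : IsClosed F) (hne : F.Nonempty) (hW : IsWhitney F s c) {n : ℕ}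
    (hn : n ∈ s) {x y : X} (hxy : x ≠ y) : 0 ≤ L := by
  have h1 := (abs_nonneg _).trans (h.lip n hn x y)
  have h2 := hW.infDist_pos hF hne hn
  have h3 := dist_pos.2 hxy
  have h4 : 0 ≤ L / infDist (c n) F := nonneg_of_mul_nonneg_left h1 h3
  exact (div_nonneg_iff.1 h4).elim (fun h => h.1) fun h => absurd h.2 (not_le.2 h2)

/-- The partition is defined by products rather than quotients, so differences of products suffice.
At most 2N bumps are nonzero at x or y, each with Lipschitz constant at most 2L/δ because the
distances to F are comparable. This gives 2N · 2L, plus L from the factor ψ n itself. -/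
theorem partition_lip (hF : IsClosed F) (hne : F.Nonempty) (hW : IsWhitney F s c)
    (hN : ∀ x, {n ∈ s | x ∈ ball (c n) (infDist (c n) F / 10)}.encard ≤ N) {n : ℕ} (hn : n ∈ s)
    (x y : X) : |bumpPartition ψ n x - bumpPartition ψ n y| ≤
      (4 * N + 1) * L / infDist (c n) F * dist x y := by
  classical
  rcases eq_or_ne x y with rfl | hxy
  · simp
  have hL := h.nonneg_const hF hne hW hn hxy
  have hδ := hW.infDist_pos hF hne hn
  have hd := dist_nonneg (x := x) (y := y)
  have hle : L / infDist (c n) F * dist x y ≤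
      (4 * N + 1) * L / infDist (c n) F * dist x y := by
    gcongr
    nlinarith [mul_nonneg (Nat.cast_nonneg (α := ℝ) N) hL]
  -- If the bump vanishes at one of the points, its own Lipschitz bound already suffices.
  have key : ∀ z w, z ∉ ball (c n) (infDist (c n) F / 10) →
      |bumpPartition ψ n z - bumpPartition ψ n w| ≤ L / infDist (c n) F * dist z w := by
    intro z w hz
    have hz0 : ψ n z = 0 := by
      by_contra h0
      exact hz (h.mem n z h0).2
    have := h.lip n hn z w
    rw [hz0, zero_sub, abs_neg, abs_of_nonneg (h.nonneg n w)] at this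
    rw [bumpPartition, hz0, zero_mul, zero_sub, abs_neg, abs_of_nonneg (h.partition_nonneg n w)]
    exact (h.partition_le n w).trans this
  by_cases hx : x ∈ ball (c n) (infDist (c n) F / 10)
  swap
  · exact (key x y hx).trans hle
  by_cases hy : y ∈ ball (c n) (infDist (c n) F / 10)
  swap
  · rw [abs_sub_comm, dist_comm]
    rw [dist_comm] at hle
    exact (key y x hy).trans hle
  obtain ⟨Tx, hTx, hTx'⟩ := exists_finset_of_encard_le (hN x)
  obtain ⟨Ty, hTy, hTy'⟩ := exists_finset_of_encard_le (hN y)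
  have hterm : ∀ j ∈ Tx ∪ Ty, |ψ j x - ψ j y| ≤ 2 * L / infDist (c n) F * dist x y := by
    intro j hj
    have : j ∈ s ∧ infDist (c n) F / 2 ≤ infDist (c j) F := by
      rcases Finset.mem_union.1 hj with hj | hj
      · have hj := (hTx' j).1 hj
        have h1 := IsWhitney.infDist_bounds hj.2
        have h2 := IsWhitney.infDist_bounds hx
        exact ⟨hj.1, by linarith⟩
      · have hj := (hTy' j).1 hj
        have h1 := IsWhitney.infDist_bounds hj.2
        have h2 := IsWhitney.infDist_bounds hy
        exact ⟨hj.1, by linarith⟩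
    refine (h.lip j this.1 x y).trans ?_
    gcongr ?_ * _
    calc L / infDist (c j) F ≤ L / (infDist (c n) F / 2) := by
          gcongr
          exact this.2
      _ = 2 * L / infDist (c n) F := by field_simp
  have hsum : ∑ j ∈ Finset.range n, |ψ j x - ψ j y| ≤
      (2 * N) * (2 * L / infDist (c n) F * dist x y) := by
    calc ∑ j ∈ Finset.range n, |ψ j x - ψ j y|
        ≤ ∑ j ∈ Tx ∪ Ty, |ψ j x - ψ j y| := by
          have hzero : ∀ j ∉ Tx ∪ Ty, |ψ j x - ψ j y| = 0 := by
            intro j hj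
            have hx0 : ψ j x = 0 := by
              by_contra h0
              exact hj (Finset.mem_union_left _ ((hTx' j).2 (h.mem j x h0)))
            have hy0 : ψ j y = 0 := by
              by_contra h0
              exact hj (Finset.mem_union_right _ ((hTy' j).2 (h.mem j y h0)))
            simp [hx0, hy0]
          rw [← Finset.sum_inter_add_sum_sdiff (Finset.range n) (Tx ∪ Ty),
            Finset.sum_eq_zero (s := Finset.range n \ (Tx ∪ Ty))
              fun j hj => hzero j (Finset.mem_sdiff.1 hj).2, add_zero]
          exact Finset.sum_le_sum_of_subset_of_nonneg Finset.inter_subset_right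
            fun _ _ _ => abs_nonneg _
      _ ≤ (Tx ∪ Ty).card • (2 * L / infDist (c n) F * dist x y) :=
          Finset.sum_le_card_nsmul _ _ _ hterm
      _ ≤ _ := by
          rw [nsmul_eq_mul]
          gcongr
          have := Finset.card_union_le Tx Ty
          exact_mod_cast (by omega : (Tx ∪ Ty).card ≤ 2 * N)
  have hprod := abs_prod_sub_prod_le (Finset.range n) (fun j => 1 - ψ j x) (fun j => 1 - ψ j y)
    (fun j => ⟨sub_nonneg.2 (h.le_one j x), sub_le_self _ (h.nonneg j x)⟩)
    (fun j => ⟨sub_nonneg.2 (h.le_one j y), sub_le_self _ (h.nonneg j y)⟩)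
  have hprod' : |∏ j ∈ Finset.range n, (1 - ψ j x) - ∏ j ∈ Finset.range n, (1 - ψ j y)| ≤
      ∑ j ∈ Finset.range n, |ψ j x - ψ j y| := by
    refine hprod.trans (Finset.sum_le_sum fun j _ => ?_)
    rw [sub_sub_sub_cancel_left, abs_sub_comm]
  have hsplit : bumpPartition ψ n x - bumpPartition ψ n y =
      (ψ n x - ψ n y) * ∏ j ∈ Finset.range n, (1 - ψ j x) +
      ψ n y * (∏ j ∈ Finset.range n, (1 - ψ j x) - ∏ j ∈ Finset.range n, (1 - ψ j y)) := by
    rw [bumpPartition, bumpPartition]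
    ring
  rw [hsplit]
  calc _ ≤ |(ψ n x - ψ n y) * ∏ j ∈ Finset.range n, (1 - ψ j x)| +
      |ψ n y * (∏ j ∈ Finset.range n, (1 - ψ j x) - ∏ j ∈ Finset.range n, (1 - ψ j y))| :=
        abs_add_le _ _
    _ ≤ |ψ n x - ψ n y| + ∑ j ∈ Finset.range n, |ψ j x - ψ j y| := by
        refine add_le_add ?_ ?_
        · rw [abs_mul, abs_of_nonneg (h.prod_mem_Icc _ x).1]
          exact mul_le_of_le_one_right (abs_nonneg _) (h.prod_mem_Icc _ x).2
        · rw [abs_mul, abs_of_nonneg (h.nonneg n y)]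
          exact (mul_le_of_le_one_left (abs_nonneg _) (h.le_one n y)).trans hprod'
    _ ≤ L / infDist (c n) F * dist x y + (2 * N) * (2 * L / infDist (c n) F * dist x y) :=
        add_le_add (h.lip n hn x y) hsum
    _ = _ := by ring

end IsBumpFamily

/-- The Whitney extension of the restriction of `f` to `F`, with value `a n` at the `n`-th ball. -/
noncomputable def whitneyExtension (F : Set X) (f : X → ℝ) (ψ : ℕ → X → ℝ) (a : ℕ → ℝ) (x : X) :
    ℝ :=
  open Classical in if x ∈ F then f x else ∑' n, a n * bumpPartition ψ n x

variable {f : X → ℝ} {a : ℕ → ℝ} {A : ℝ}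

/-- Compare through a point w of F almost nearest to the center. As δ ≤ (10/9) `infDist x F` ≤
(10/9) `dist x z`, the factor is at most 3.1 · 10/9 + 1 < 5. -/
theorem IsWhitney.abs_value_sub_le (hW : IsWhitney F s c) (hF : IsClosed F) (hne : F.Nonempty)
    (hA : 0 ≤ A) (hfA : ∀ z ∈ F, ∀ w ∈ F, |f z - f w| ≤ A * dist z w)
    (haA : ∀ n ∈ s, ∀ z ∈ F, dist (c n) z ≤ 2 * infDist (c n) F →
      |a n - f z| ≤ A * infDist (c n) F)
    {n : ℕ} (hn : n ∈ s) {x z : X} (hx : x ∈ ball (c n) (infDist (c n) F / 10)) (hz : z ∈ F) :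
    |a n - f z| ≤ A * (5 * dist x z) := by
  have hδ := hW.infDist_pos hF hne hn
  obtain ⟨w, hw, hwd⟩ := (infDist_lt_iff hne (r := 2 * infDist (c n) F)).1 (by linarith)
  have h1 := haA n hn w hw hwd.le
  have h2 := hfA w hw z hz
  have h3 : dist w z ≤ dist (c n) w + dist x (c n) + dist x z := by
    have e1 := dist_triangle w (c n) z
    have e2 := dist_triangle (c n) x z
    rw [dist_comm w (c n)] at e1
    rw [dist_comm (c n) x] at e2
    linarith
  have h4 := mem_ball.1 hx
  have h5 := (infDist_bounds hx).1
  have h6 : infDist x F ≤ dist x z := infDist_le_dist_of_mem hz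
  calc |a n - f z| ≤ |a n - f w| + |f w - f z| := abs_sub_le _ _ _
    _ ≤ A * infDist (c n) F + A * dist w z := add_le_add h1 h2
    _ = A * (infDist (c n) F + dist w z) := by ring
    _ ≤ _ := by
      gcongr
      linarith

namespace IsBumpFamily

theorem whitneyExtension_eq_sum (h : IsBumpFamily F s c ψ L) {x : X} (hx : x ∉ F) {T : Finset ℕ}
    (hT : ∀ n ∈ s, x ∈ ball (c n) (infDist (c n) F / 10) → n ∈ T) :
    whitneyExtension F f ψ a x = ∑ n ∈ T, a n * bumpPartition ψ n x := by
  rw [whitneyExtension, if_neg hx]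
  refine tsum_eq_sum fun n hn => ?_
  have : bumpPartition ψ n x = 0 := by
    by_contra h0
    exact hn (hT n (h.partition_mem n x h0).1 (h.partition_mem n x h0).2)
  rw [this, mul_zero]

/-- Off F the extension is a convex combination of values a n attached to balls containing x, and
each of these is close to f z. -/
theorem abs_whitneyExtension_sub_le (h : IsBumpFamily F s c ψ L) (hF : IsClosed F)
    (hne : F.Nonempty) (hW : IsWhitney F s c)
    (hN : ∀ x, {n ∈ s | x ∈ ball (c n) (infDist (c n) F / 10)}.encard ≤ N)
    (hA : 0 ≤ A) (hfA : ∀ z ∈ F, ∀ w ∈ F, |f z - f w| ≤ A * dist z w)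
    (haA : ∀ n ∈ s, ∀ z ∈ F, dist (c n) z ≤ 2 * infDist (c n) F →
      |a n - f z| ≤ A * infDist (c n) F)
    (x : X) {z : X} (hz : z ∈ F) :
    |whitneyExtension F f ψ a x - f z| ≤ A * (5 * dist x z) := by
  by_cases hx : x ∈ F
  · rw [whitneyExtension, if_pos hx]
    refine (hfA x hx z hz).trans ?_
    gcongr
    linarith [dist_nonneg (x := x) (y := z)]
  obtain ⟨T, -, hT⟩ := exists_finset_of_encard_le (hN x)
  have hT1 : ∀ n ∈ s, x ∈ ball (c n) (infDist (c n) F / 10) → n ∈ T := fun n h1 h2 =>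
    (hT n).2 ⟨h1, h2⟩
  have hone := h.sum_partition hW hx hT1
  have : whitneyExtension F f ψ a x - f z = ∑ n ∈ T, (a n - f z) * bumpPartition ψ n x := by
    rw [h.whitneyExtension_eq_sum hx hT1]
    simp only [sub_mul, Finset.sum_sub_distrib]
    rw [← Finset.mul_sum, hone, mul_one]
  rw [this]
  calc _ ≤ ∑ n ∈ T, |(a n - f z) * bumpPartition ψ n x| := Finset.abs_sum_le_sum_abs _ _
    _ ≤ ∑ n ∈ T, A * (5 * dist x z) * bumpPartition ψ n x := by
        refine Finset.sum_le_sum fun n hn => ?_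
        rw [abs_mul, abs_of_nonneg (h.partition_nonneg n x)]
        gcongr
        · exact h.partition_nonneg n x
        · have := (hT n).1 hn
          exact hW.abs_value_sub_le hF hne hA hfA haA this.1 this.2 hz
    _ = _ := by rw [← Finset.mul_sum, hone, mul_one]

/-- The Whitney extension is Lipschitz. -/
theorem abs_whitneyExtension_sub_whitneyExtension_le (h : IsBumpFamily F s c ψ L)
    (hF : IsClosed F) (hne : F.Nonempty) (hW : IsWhitney F s c)
    (hN : ∀ x, {n ∈ s | x ∈ ball (c n) (infDist (c n) F / 10)}.encard ≤ N)
    (hL : 0 ≤ L) (hA : 0 ≤ A) (hfA : ∀ z ∈ F, ∀ w ∈ F, |f z - f w| ≤ A * dist z w)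
    (haA : ∀ n ∈ s, ∀ z ∈ F, dist (c n) z ≤ 2 * infDist (c n) F →
      |a n - f z| ≤ A * infDist (c n) F) (x y : X) :
    |whitneyExtension F f ψ a x - whitneyExtension F f ψ a y| ≤
      A * (45 + 2 * N * (40 * ((4 * N + 1) * L))) * dist x y := by
  classical
  set K : ℝ := (4 * N + 1) * L with hK
  have hK0 : 0 ≤ K := by positivity
  have hest := h.abs_whitneyExtension_sub_le (f := f) (a := a) hF hne hW hN hA hfA haA
  have hle : A * (45 * dist x y) ≤ A * (45 + 2 * N * (40 * K)) * dist x y := by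
    rw [mul_assoc]
    gcongr
    linarith [show 0 ≤ 2 * (N : ℝ) * (40 * K) by positivity]
  have hd := dist_nonneg (x := x) (y := y)
  by_cases hx : x ∈ F
  · rw [abs_sub_comm]
    have := hest y hx
    rw [dist_comm] at this
    have e : whitneyExtension F f ψ a x = f x := by rw [whitneyExtension, if_pos hx]
    rw [e]
    refine this.trans (le_trans ?_ hle)
    gcongr
    linarith
  by_cases hy : y ∈ F
  · have := hest x hy
    have e : whitneyExtension F f ψ a y = f y := by rw [whitneyExtension, if_pos hy]
    rw [e]
    refine this.trans (le_trans ?_ hle)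
    gcongr
    linarith
  have hδ : 0 < infDist x F := (hF.notMem_iff_infDist_pos hne).1 hx
  obtain ⟨z, hz, hzd⟩ := (infDist_lt_iff hne (r := 2 * infDist x F)).1 (by linarith)
  have hyz : dist y z ≤ dist x y + dist x z := by
    rw [dist_comm x y]
    exact dist_triangle _ _ _
  -- Far points are compared through z: there `dist x z` < 4 `dist x y`, which yields 5 · 4 + 5 · 5
  -- = 45. Near points use the Lipschitz bound of the partition.
  rcases le_or_gt (dist x y) (infDist x F / 2) with hclose | hfar
  swap
  · calc _ ≤ |whitneyExtension F f ψ a x - f z| + |f z - whitneyExtension F f ψ a y| :=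
          abs_sub_le _ _ _
      _ ≤ A * (5 * dist x z) + A * (5 * dist y z) := by
          rw [abs_sub_comm (f z)]
          exact add_le_add (hest x hz) (hest y hz)
      _ = A * (5 * dist x z + 5 * dist y z) := by ring
      _ ≤ A * (45 * dist x y) := by
          gcongr
          linarith
      _ ≤ _ := hle
  obtain ⟨Tx, hTx, hTx'⟩ := exists_finset_of_encard_le (hN x)
  obtain ⟨Ty, hTy, hTy'⟩ := exists_finset_of_encard_le (hN y)
  have hT1 : ∀ n ∈ s, x ∈ ball (c n) (infDist (c n) F / 10) → n ∈ Tx ∪ Ty := fun n h1 h2 =>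
    Finset.mem_union_left _ ((hTx' n).2 ⟨h1, h2⟩)
  have hT2 : ∀ n ∈ s, y ∈ ball (c n) (infDist (c n) F / 10) → n ∈ Tx ∪ Ty := fun n h1 h2 =>
    Finset.mem_union_right _ ((hTy' n).2 ⟨h1, h2⟩)
  -- The weights sum to 1 at both points, so f z may be subtracted from every a n. The resulting
  -- factor of order `infDist x F` cancels the 1/δ in the Lipschitz bound of the partition.
  have hdiff : whitneyExtension F f ψ a x - whitneyExtension F f ψ a y =
      ∑ n ∈ Tx ∪ Ty, (a n - f z) * (bumpPartition ψ n x - bumpPartition ψ n y) := by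
    rw [h.whitneyExtension_eq_sum hx hT1, h.whitneyExtension_eq_sum hy hT2]
    simp only [sub_mul, mul_sub, Finset.sum_sub_distrib]
    rw [← Finset.mul_sum, ← Finset.mul_sum, h.sum_partition hW hx hT1, h.sum_partition hW hy hT2]
    ring
  have hxy := infDist_le_infDist_add_dist (s := F) (x := x) (y := y)
  have hterm : ∀ n ∈ Tx ∪ Ty, |(a n - f z) * (bumpPartition ψ n x - bumpPartition ψ n y)| ≤
      A * (40 * K * dist x y) := by
    intro n hn
    -- As `dist x y` ≤ `infDist x F / 2`, y is at distance at least half of `infDist x F` from F and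
    -- at most 5/2 of it from z. Hence 2/5 < 10/22 and 15 > 5 · 5/2.
    have hn' : n ∈ s ∧ 2 / 5 * infDist x F ≤ infDist (c n) F ∧
        |a n - f z| ≤ A * (15 * infDist x F) := by
      rcases Finset.mem_union.1 hn with hn | hn
      · have hn := (hTx' n).1 hn
        have hb := IsWhitney.infDist_bounds hn.2
        refine ⟨hn.1, by linarith, (hW.abs_value_sub_le hF hne hA hfA haA hn.1 hn.2 hz).trans ?_⟩
        exact mul_le_mul_of_nonneg_left (by linarith) hA
      · have hn := (hTy' n).1 hn
        have hb := IsWhitney.infDist_bounds hn.2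
        refine ⟨hn.1, by linarith, (hW.abs_value_sub_le hF hne hA hfA haA hn.1 hn.2 hz).trans ?_⟩
        exact mul_le_mul_of_nonneg_left (by linarith) hA
    rw [abs_mul]
    calc _ ≤ A * (15 * infDist x F) * (K / infDist (c n) F * dist x y) :=
          mul_le_mul hn'.2.2 (h.partition_lip hF hne hW hN hn'.1 x y) (abs_nonneg _)
            (by positivity)
      _ ≤ A * (15 * infDist x F) * (K / (2 / 5 * infDist x F) * dist x y) := by
          gcongr
          exact hn'.2.1
      _ = A * (75 / 2 * K * dist x y) := by
          field_simp
          ring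
      _ ≤ _ := by
          gcongr
          norm_num
  rw [hdiff]
  calc _ ≤ ∑ n ∈ Tx ∪ Ty, |(a n - f z) * (bumpPartition ψ n x - bumpPartition ψ n y)| :=
        Finset.abs_sum_le_sum_abs _ _
    _ ≤ (Tx ∪ Ty).card • (A * (40 * K * dist x y)) := Finset.sum_le_card_nsmul _ _ _ hterm
    _ ≤ (2 * N) * (A * (40 * K * dist x y)) := by
        rw [nsmul_eq_mul]
        gcongr
        have := Finset.card_union_le Tx Ty
        exact_mod_cast (by omega : (Tx ∪ Ty).card ≤ 2 * N)
    _ ≤ _ := by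
        nlinarith [mul_nonneg hA hd]

end IsBumpFamily

end Partition

/-! ### Poincaré inequality and oscillation of averages near the good set -/

theorem enorm_setAverage_sub_rpow_mul_le {X : Type*} [MeasurableSpace X] {μ : Measure X}
    {f : X → ℝ} {q : ℝ} (hq : 1 ≤ q) {s : Set X} (hs : μ s ≠ 0) (hs' : μ s ≠ ⊤)
    (hf : IntegrableOn f s μ) (a : ℝ) :
    ‖(⨍ y in s, f y ∂μ) - a‖ₑ ^ q * μ s ≤ ∫⁻ y in s, ‖f y - a‖ₑ ^ q ∂μ := by
  have hq0 : 0 < q := by linarith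
  set ν : Measure X := (μ s)⁻¹ • μ.restrict s with hν
  have hprob : IsProbabilityMeasure ν := ⟨by simp [hν, ENNReal.inv_mul_cancel hs hs']⟩
  have hfν : Integrable f ν := hf.integrable.smul_measure (by simpa using hs)
  have havg : (⨍ y in s, f y ∂μ) - a = ∫ y, (f y - a) ∂ν := by
    rw [integral_sub hfν (integrable_const a)]
    simp [average, hν]
  -- Jensen's inequality, in the form of monotonicity of L^p norms for the normalized measure on s.
  have h1 : ‖(⨍ y in s, f y ∂μ) - a‖ₑ ≤ (∫⁻ y, ‖f y - a‖ₑ ^ q ∂ν) ^ (1 / q) := by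
    rw [havg]
    refine (enorm_integral_le_lintegral_enorm _).trans ?_
    have := eLpNorm'_le_eLpNorm'_of_exponent_le one_pos hq ν
      (hfν.sub (integrable_const a)).aestronglyMeasurable
    simpa [eLpNorm'_eq_lintegral_enorm] using this
  have h2 : ‖(⨍ y in s, f y ∂μ) - a‖ₑ ^ q ≤ ∫⁻ y, ‖f y - a‖ₑ ^ q ∂ν := by
    have := ENNReal.rpow_le_rpow h1 hq0.le
    rwa [← ENNReal.rpow_mul, one_div, inv_mul_cancel₀ hq0.ne', ENNReal.rpow_one] at this
  calc _ ≤ (∫⁻ y, ‖f y - a‖ₑ ^ q ∂ν) * μ s := by gcongr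
    _ = (μ s)⁻¹ * μ s * ∫⁻ y in s, ‖f y - a‖ₑ ^ q ∂μ := by
        rw [hν, lintegral_smul_measure, smul_eq_mul]
        ring
    _ = _ := by rw [ENNReal.inv_mul_cancel hs hs', one_mul]

section Oscillation

variable {X : Type*} [MetricSpace X] [MeasurableSpace X] {μ : Measure X} {f : X → ℝ} {q : ℝ}
  {w : X → ℝ≥0∞} {D P : ℝ≥0} {α : ℝ}

/-- Continuity makes every point a Lebesgue point, so the estimates on F hold at all of its points
and not just almost everywhere. -/
theorem tendsto_setAverage_ball [BorelSpace X] (hpos : ∀ (x : X) (r : ℝ), 0 < r → 0 < μ (ball x r))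
    (hfin : ∀ (x : X) (r : ℝ), μ (ball x r) < ⊤) (hf : Continuous f)
    (hfint : ∀ x r, IntegrableOn f (ball x r) μ) (z : X) :
    Filter.Tendsto (fun r => ⨍ y in ball z r, f y ∂μ) (𝓝[>] 0) (𝓝 (f z)) := by
  rw [Metric.tendsto_nhdsWithin_nhds]
  intro ε hε
  obtain ⟨δ, hδ, h⟩ := Metric.continuous_iff.1 hf z (ε / 2) (by positivity)
  refine ⟨δ, hδ, fun {r} hr hrδ => ?_⟩
  rw [Real.dist_eq, sub_zero, abs_of_pos hr] at hrδ
  have h1 := enorm_setAverage_sub_rpow_mul_le le_rfl (hpos z r hr).ne' (hfin z r).ne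
    (hfint z r) (f z)
  have h2 : ∫⁻ y in ball z r, ‖f y - f z‖ₑ ^ (1 : ℝ) ∂μ ≤
      ENNReal.ofReal (ε / 2) * μ (ball z r) := by
    rw [← setLIntegral_const]
    refine setLIntegral_mono' measurableSet_ball fun y hy => ?_
    rw [ENNReal.rpow_one, Real.enorm_eq_ofReal_abs]
    exact ENNReal.ofReal_le_ofReal (h y ((mem_ball.1 hy).trans hrδ)).le
  have h3 := (ENNReal.mul_le_mul_iff_left (hpos z r hr).ne' (hfin z r).ne).1 (h1.trans h2)
  rw [ENNReal.rpow_one, Real.enorm_eq_ofReal_abs,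
    ENNReal.ofReal_le_ofReal_iff (by positivity)] at h3
  rw [Real.dist_eq]
  linarith

/-- The constant in the comparison of averages over two balls of comparable size. -/
noncomputable def oscConst (q : ℝ) (D P : ℝ≥0) : ℝ := ((P * D ^ 6 : ℝ≥0) : ℝ) ^ (1 / q)

theorem oscConst_nonneg : 0 ≤ oscConst q D P := Real.rpow_nonneg (NNReal.coe_nonneg _) _

/-- An `L^q` Poincaré inequality for the function `f`, where `w` plays the role of `|∇f|^q`. -/
def HasPoincare (μ : Measure X) (q : ℝ) (P : ℝ≥0) (f : X → ℝ) (w : X → ℝ≥0∞) : Prop :=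
  ∀ (x : X) (r : ℝ), 0 < r → ∫⁻ y in ball x r, ‖f y - ⨍ z in ball x r, f z ∂μ‖ₑ ^ q ∂μ ≤
    P * ENNReal.ofReal r ^ q * ∫⁻ y in ball x r, w y ∂μ

/-- The key estimate. Jensen on the small ball, enlargement to the large one, and Poincaré there
reduce the claim to the mean of w over the large ball. That ball contains z, so the mean is at most
α^q; returning to the measure of the small ball costs D⁶. -/
theorem abs_setAverage_sub_setAverage_le (hq : 1 ≤ q) (hD : Doubling μ D)
    (hpos : ∀ (x : X) (r : ℝ), 0 < r → 0 < μ (ball x r))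
    (hfin : ∀ (x : X) (r : ℝ), μ (ball x r) < ⊤) (hfint : ∀ x r, IntegrableOn f (ball x r) μ)
    (hP : HasPoincare μ q P f w) (hα : 0 < α) {z : X}
    (hz : z ∉ maximalSet μ w (ENNReal.ofReal α ^ q)) {x y : X} {r R : ℝ} (hr : 0 < r)
    (hzy : dist z y < R) (h1 : r + dist x y ≤ R) (h2 : R + dist y x ≤ 2 ^ 6 * r) :
    |(⨍ u in ball x r, f u ∂μ) - ⨍ u in ball y R, f u ∂μ| ≤ oscConst q D P * R * α := by
  have hq0 : 0 < q := by linarith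
  have hR : 0 < R := by linarith [dist_nonneg (x := x) (y := y)]
  set a := ⨍ u in ball y R, f u ∂μ
  have hE : ‖(⨍ u in ball x r, f u ∂μ) - a‖ₑ ^ q * μ (ball x r) ≤
      (((P * D ^ 6 : ℝ≥0) : ℝ≥0∞) * ENNReal.ofReal R ^ q * ENNReal.ofReal α ^ q) *
        μ (ball x r) := by
    calc _ ≤ ∫⁻ u in ball x r, ‖f u - a‖ₑ ^ q ∂μ :=
          enorm_setAverage_sub_rpow_mul_le hq (hpos x r hr).ne' (hfin x r).ne (hfint x r) a
      _ ≤ ∫⁻ u in ball y R, ‖f u - a‖ₑ ^ q ∂μ := lintegral_mono_set (ball_subset_ball' h1)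
      _ ≤ P * ENNReal.ofReal R ^ q * ∫⁻ u in ball y R, w u ∂μ := hP y R hR
      _ ≤ P * ENNReal.ofReal R ^ q * (ENNReal.ofReal α ^ q * μ (ball y R)) := by
          gcongr
          exact lintegral_ball_le_of_notMem_maximalSet hz hzy
      _ ≤ P * ENNReal.ofReal R ^ q * (ENNReal.ofReal α ^ q *
            ((D : ℝ≥0∞) ^ 6 * μ (ball x r))) := by
          gcongr
          exact hD.measure_ball_le hr 6 h2
      _ = _ := by
          push_cast
          ring
  rw [ENNReal.mul_le_mul_iff_left (hpos x r hr).ne' (hfin x r).ne] at hE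
  have hrhs : ((P * D ^ 6 : ℝ≥0) : ℝ≥0∞) * ENNReal.ofReal R ^ q * ENNReal.ofReal α ^ q =
      ENNReal.ofReal (oscConst q D P * R * α) ^ q := by
    rw [ENNReal.ofReal_mul (mul_nonneg oscConst_nonneg hR.le),
      ENNReal.ofReal_mul oscConst_nonneg, ENNReal.mul_rpow_of_nonneg _ _ hq0.le,
      ENNReal.mul_rpow_of_nonneg _ _ hq0.le, oscConst,
      ← ENNReal.ofReal_rpow_of_nonneg (NNReal.coe_nonneg _) (by positivity),
      ← ENNReal.rpow_mul, one_div, inv_mul_cancel₀ hq0.ne', ENNReal.rpow_one,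
      ENNReal.ofReal_coe_nnreal]
  rw [hrhs, ENNReal.rpow_le_rpow_iff hq0, Real.enorm_eq_ofReal_abs, ENNReal.ofReal_le_ofReal_iff
    (mul_nonneg (mul_nonneg oscConst_nonneg hR.le) hα.le)] at hE
  exact hE

/-- Telescoping over the radii r / 2^j: the steps form a geometric series with sum 2 κ r α, where κ
is `oscConst q D P`. -/
theorem abs_setAverage_sub_le_of_center [BorelSpace X] (hq : 1 ≤ q) (hD : Doubling μ D)
    (hpos : ∀ (x : X) (r : ℝ), 0 < r → 0 < μ (ball x r))
    (hfin : ∀ (x : X) (r : ℝ), μ (ball x r) < ⊤) (hf : Continuous f)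
    (hfint : ∀ x r, IntegrableOn f (ball x r) μ)
    (hP : HasPoincare μ q P f w) (hα : 0 < α) {z : X}
    (hz : z ∉ maximalSet μ w (ENNReal.ofReal α ^ q)) {r : ℝ} (hr : 0 < r) :
    |(⨍ u in ball z r, f u ∂μ) - f z| ≤ 2 * (oscConst q D P * r * α) := by
  have hlim : Filter.Tendsto (fun j : ℕ => ⨍ u in ball z (r / 2 ^ j), f u ∂μ) Filter.atTop
      (𝓝 (f z)) := by
    refine (tendsto_setAverage_ball hpos hfin hf hfint z).comp
      (tendsto_nhdsWithin_iff.2 ⟨?_, .of_forall fun j => by simp only [mem_Ioi]; positivity⟩)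
    have := (tendsto_pow_atTop_nhds_zero_of_lt_one (r := (1 / 2 : ℝ)) (by norm_num)
      (by norm_num)).const_mul r
    simpa [div_eq_mul_inv] using this
  have hstep : ∀ j : ℕ, dist (⨍ u in ball z (r / 2 ^ j), f u ∂μ)
      (⨍ u in ball z (r / 2 ^ (j + 1)), f u ∂μ) ≤ 2 * (oscConst q D P * r * α) / 2 / 2 ^ j := by
    intro j
    have hj : 0 < r / 2 ^ j := by positivity
    have hj1 : r / 2 ^ (j + 1) = r / 2 ^ j / 2 := by rw [pow_succ, div_div]
    rw [dist_comm, Real.dist_eq]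
    refine (abs_setAverage_sub_setAverage_le hq hD hpos hfin hfint hP hα hz (by positivity)
      (by rw [dist_self]; exact hj) ?_ ?_).trans_eq (by ring)
    · rw [dist_self, hj1]
      linarith
    · rw [dist_self, hj1]
      linarith
  have := dist_le_of_le_geometric_two_of_tendsto₀ hstep hlim
  simpa [Real.dist_eq] using this

/-- The intermediate ball has center z and radius 32 r, with 20 + 1 ≤ 32 and 32 + 20 ≤ 64; the
constants add up to 32 + 2 · 32 = 96. The range 20 r is what Whitney balls need: r = δ/10, and F has
points within 2δ of the center. -/
theorem abs_setAverage_sub_le [BorelSpace X] (hq : 1 ≤ q) (hD : Doubling μ D)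
    (hpos : ∀ (x : X) (r : ℝ), 0 < r → 0 < μ (ball x r))
    (hfin : ∀ (x : X) (r : ℝ), μ (ball x r) < ⊤) (hf : Continuous f)
    (hfint : ∀ x r, IntegrableOn f (ball x r) μ)
    (hP : HasPoincare μ q P f w) (hα : 0 < α) {z : X}
    (hz : z ∉ maximalSet μ w (ENNReal.ofReal α ^ q)) {x : X} {r : ℝ} (hr : 0 < r)
    (hxz : dist x z ≤ 20 * r) :
    |(⨍ u in ball x r, f u ∂μ) - f z| ≤ 96 * oscConst q D P * α * r := by
  have h1 := abs_setAverage_sub_setAverage_le hq hD hpos hfin hfint hP hα hz (x := x) (y := z)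
    (r := r) (R := 32 * r) hr (by rw [dist_self]; positivity) (by linarith)
    (by rw [dist_comm]; linarith)
  have h2 := abs_setAverage_sub_le_of_center hq hD hpos hfin hf hfint hP hα hz
    (r := 32 * r) (by positivity)
  refine (abs_sub_le _ _ _).trans ((add_le_add h1 h2).trans_eq (by ring))

/-- Both values are compared with the average over the ball about z of radius `dist z y`. -/
theorem abs_sub_le_of_notMem_maximalSet [BorelSpace X] (hq : 1 ≤ q) (hD : Doubling μ D)
    (hpos : ∀ (x : X) (r : ℝ), 0 < r → 0 < μ (ball x r))
    (hfin : ∀ (x : X) (r : ℝ), μ (ball x r) < ⊤) (hf : Continuous f)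
    (hfint : ∀ x r, IntegrableOn f (ball x r) μ)
    (hP : HasPoincare μ q P f w) (hα : 0 < α) {z y : X}
    (hz : z ∉ maximalSet μ w (ENNReal.ofReal α ^ q))
    (hy : y ∉ maximalSet μ w (ENNReal.ofReal α ^ q)) :
    |f z - f y| ≤ 192 * oscConst q D P * α * dist z y := by
  rcases eq_or_ne z y with rfl | hne
  · simp
  have hd := dist_pos.2 hne
  have h1 := abs_setAverage_sub_le hq hD hpos hfin hf hfint hP hα hz (x := z) hd
    (by rw [dist_self]; positivity)
  have h2 := abs_setAverage_sub_le hq hD hpos hfin hf hfint hP hα hy (x := z) hd (by linarith)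
  rw [abs_sub_comm] at h1
  exact (abs_sub_le _ _ _).trans ((add_le_add h1 h2).trans_eq (by ring))

/-- A Whitney ball misses F, so its mean of w is controlled only through a dilate that reaches F. -/
theorem lintegral_ball_le_of_dist_le (hD : Doubling μ D) {t : ℝ≥0∞} {z : X}
    (hz : z ∉ maximalSet μ w t) {x : X} {r : ℝ} (hr : 0 < r) (hxz : dist x z ≤ 20 * r) :
    ∫⁻ y in ball x r, w y ∂μ ≤ t * ((D : ℝ≥0∞) ^ 6 * μ (ball x r)) := by
  calc ∫⁻ y in ball x r, w y ∂μ ≤ ∫⁻ y in ball z (32 * r), w y ∂μ :=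
        lintegral_mono_set (ball_subset_ball' (by linarith))
    _ ≤ t * μ (ball z (32 * r)) := lintegral_ball_le_of_notMem_maximalSet hz
        (mem_ball_self (by positivity))
    _ ≤ _ := by
        gcongr
        exact hD.measure_ball_le hr 6 (by rw [dist_comm]; linarith)

end Oscillation

/-! ### Derivatives of charts and Riemannian norms on the model space -/

section TangentNorm

variable {E : Type*} [NormedAddCommGroup E] [InnerProductSpace ℝ E] [FiniteDimensional ℝ E]
  {M : Type*} [TopologicalSpace M] [ChartedSpace E M]

/-- The derivative at `y` of the preferred chart around `x`, as an endomorphism of the model. -/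
noncomputable def chartDeriv (E : Type*) [NormedAddCommGroup E] [InnerProductSpace ℝ E]
    {M : Type*} [TopologicalSpace M] [ChartedSpace E M] (x y : M) : E →L[ℝ] E :=
  mfderiv 𝓘(ℝ, E) 𝓘(ℝ, E) (extChartAt 𝓘(ℝ, E) x) y

/-- The derivative at `e` of the inverse of the preferred chart around `x`, as an endomorphism of
the model. -/
noncomputable def chartSymmDeriv (x : M) (e : E) : E →L[ℝ] E :=
  mfderiv 𝓘(ℝ, E) 𝓘(ℝ, E) (extChartAt 𝓘(ℝ, E) x).symm e

/-- The derivative of a real function on a manifold, as a linear form on the model. -/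
noncomputable def scalarDeriv (E : Type*) [NormedAddCommGroup E] [InnerProductSpace ℝ E]
    {M : Type*} [TopologicalSpace M] [ChartedSpace E M] (f : M → ℝ) (p : M) : E →L[ℝ] ℝ :=
  mfderiv 𝓘(ℝ, E) 𝓘(ℝ, ℝ) f p

section Charts

variable [IsManifold 𝓘(ℝ, E) 1 M]

theorem mdifferentiableAt_chart_symm {x : M} {e : E} (he : e ∈ (extChartAt 𝓘(ℝ, E) x).target) :
    MDifferentiableAt 𝓘(ℝ, E) 𝓘(ℝ, E) (extChartAt 𝓘(ℝ, E) x).symm e := by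
  have := mdifferentiableWithinAt_extChartAt_symm he
  rwa [ModelWithCorners.range_eq_univ, mdifferentiableWithinAt_univ] at this

theorem chartSymmDeriv_chartDeriv {x y : M} (hy : y ∈ (extChartAt 𝓘(ℝ, E) x).source) (v : E) :
    chartSymmDeriv x (extChartAt 𝓘(ℝ, E) x y) (chartDeriv E x y v) = v := by
  have h := mfderivWithin_extChartAt_symm_comp_mfderiv_extChartAt' (I := 𝓘(ℝ, E)) hy
  rw [ModelWithCorners.range_eq_univ, mfderivWithin_univ] at h
  exact congrArg (fun L : E →L[ℝ] E => L v) h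

theorem chartDeriv_chartSymmDeriv {x : M} {e : E} (he : e ∈ (extChartAt 𝓘(ℝ, E) x).target)
    (v : E) :
    chartDeriv E x ((extChartAt 𝓘(ℝ, E) x).symm e) (chartSymmDeriv x e v) = v := by
  have h := mfderiv_extChartAt_comp_mfderivWithin_extChartAt_symm (I := 𝓘(ℝ, E)) he
  rw [ModelWithCorners.range_eq_univ, mfderivWithin_univ] at h
  exact congrArg (fun L : E →L[ℝ] E => L v) h

/-- The tangent space at x is the model space read in the preferred chart around x, so this chart
has identity derivative at x. -/
theorem chartSymmDeriv_self (x : M) (v : E) :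
    chartSymmDeriv x (extChartAt 𝓘(ℝ, E) x x) v = v := by
  have h := mfderivWithin_range_extChartAt_symm (I := 𝓘(ℝ, E)) (x := x)
  rw [ModelWithCorners.range_eq_univ, mfderivWithin_univ] at h
  exact congrArg (fun L : E →L[ℝ] E => L v) h

theorem mdifferentiableAt_of_chart {g : M → ℝ} {x y : M}
    (hy : y ∈ (extChartAt 𝓘(ℝ, E) x).source)
    (hg : DifferentiableAt ℝ (fun e => g ((extChartAt 𝓘(ℝ, E) x).symm e))
      (extChartAt 𝓘(ℝ, E) x y)) :
    MDifferentiableAt 𝓘(ℝ, E) 𝓘(ℝ, ℝ) g y := by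
  have h1 : MDifferentiableAt 𝓘(ℝ, E) 𝓘(ℝ, E) (extChartAt 𝓘(ℝ, E) x) y :=
    mdifferentiableAt_extChartAt (by rwa [extChartAt_source] at hy)
  have h2 := (mdifferentiableAt_iff_differentiableAt.2 hg).comp y h1
  refine h2.congr_of_eventuallyEq ?_
  filter_upwards [(isOpen_extChartAt_source (I := 𝓘(ℝ, E)) x).mem_nhds hy] with z hz
  simp only [Function.comp_apply]
  rw [(extChartAt 𝓘(ℝ, E) x).left_inv hz]

theorem hasFDerivAt_comp_chart_symm {g : M → ℝ} {x : M} {e : E}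
    (he : e ∈ (extChartAt 𝓘(ℝ, E) x).target)
    (hg : MDifferentiableAt 𝓘(ℝ, E) 𝓘(ℝ, ℝ) g ((extChartAt 𝓘(ℝ, E) x).symm e)) :
    HasFDerivAt (fun e => g ((extChartAt 𝓘(ℝ, E) x).symm e))
      ((scalarDeriv E g ((extChartAt 𝓘(ℝ, E) x).symm e)).comp (chartSymmDeriv x e)) e :=
  (hg.hasMFDerivAt.comp e (mdifferentiableAt_chart_symm he).hasMFDerivAt).hasFDerivAt

theorem scalarDeriv_apply_eq {g : M → ℝ} {x y : M} (hy : y ∈ (extChartAt 𝓘(ℝ, E) x).source)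
    (hg : MDifferentiableAt 𝓘(ℝ, E) 𝓘(ℝ, ℝ) g y) (v : E) :
    scalarDeriv E g y v = fderiv ℝ (fun e => g ((extChartAt 𝓘(ℝ, E) x).symm e))
      (extChartAt 𝓘(ℝ, E) x y) (chartDeriv E x y v) := by
  have hl := (extChartAt 𝓘(ℝ, E) x).left_inv hy
  have h := hasFDerivAt_comp_chart_symm (g := g) ((extChartAt 𝓘(ℝ, E) x).map_source hy)
    (by rwa [hl])
  rw [h.fderiv, ContinuousLinearMap.comp_apply, chartSymmDeriv_chartDeriv hy, hl]

end Charts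

variable [RiemannianBundle (fun p : M => TangentSpace 𝓘(ℝ, E) p)]

/-- The Riemannian norm at `p` of a vector of the model space. -/
noncomputable def tangentNorm (p : M) (v : E) : ℝ := ‖(show TangentSpace 𝓘(ℝ, E) p from v)‖

/-- The Riemannian inner product at `p` of two vectors of the model space. -/
noncomputable def tangentInner (p : M) (v w : E) : ℝ :=
  inner ℝ (show TangentSpace 𝓘(ℝ, E) p from v) (show TangentSpace 𝓘(ℝ, E) p from w)

theorem tangentNorm_nonneg (p : M) (v : E) : 0 ≤ tangentNorm p v :=
  norm_nonneg (show TangentSpace 𝓘(ℝ, E) p from v)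

theorem tangentNorm_smul (p : M) (a : ℝ) (v : E) :
    tangentNorm p (a • v) = |a| * tangentNorm p v :=
  norm_smul (β := TangentSpace 𝓘(ℝ, E) p) a v

theorem tangentInner_eq (p : M) (v w : E) : tangentInner p v w =
    (tangentNorm p (v + w) * tangentNorm p (v + w) - tangentNorm p v * tangentNorm p v -
      tangentNorm p w * tangentNorm p w) / 2 :=
  real_inner_eq_norm_add_mul_self_sub_norm_mul_self_sub_norm_mul_self_div_two
    (F := TangentSpace 𝓘(ℝ, E) p) v w

/-- The Riemannian norm at a point is bounded by a multiple of the norm of the model space. -/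
theorem exists_tangentNorm_le (p : M) : ∃ C : ℝ, 0 < C ∧ ∀ v : E, tangentNorm p v ≤ C * ‖v‖ := by
  let L : E →L[ℝ] TangentSpace 𝓘(ℝ, E) p := ContinuousLinearMap.id ℝ E
  refine ⟨‖L‖ + 1, by positivity, fun v => ?_⟩
  have h : tangentNorm p v ≤ ‖L‖ * ‖v‖ := L.le_opNorm v
  nlinarith [norm_nonneg v]

theorem exists_norm_le_tangentNorm (p : M) :
    ∃ C : ℝ, 0 < C ∧ ∀ v : E, ‖v‖ ≤ C * tangentNorm p v := by
  let L : TangentSpace 𝓘(ℝ, E) p →L[ℝ] E := ContinuousLinearMap.id ℝ E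
  refine ⟨‖L‖ + 1, by positivity, fun v => ?_⟩
  have h : ‖v‖ ≤ ‖L‖ * tangentNorm p v := L.le_opNorm v
  nlinarith [tangentNorm_nonneg p v]

theorem inner_grad (f : M → ℝ) (p : M) (v : TangentSpace 𝓘(ℝ, E) p) :
    inner ℝ (grad (E := E) f p) v = scalarDeriv E f p v := by
  have : FiniteDimensional ℝ (TangentSpace 𝓘(ℝ, E) p) :=
    inferInstanceAs (FiniteDimensional ℝ E)
  have : CompleteSpace (TangentSpace 𝓘(ℝ, E) p) := FiniteDimensional.complete ℝ _
  exact InnerProductSpace.toDual_symm_apply (𝕜 := ℝ) (E := TangentSpace 𝓘(ℝ, E) p)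

theorem abs_scalarDeriv_le (f : M → ℝ) (p : M) (v : E) :
    |scalarDeriv E f p v| ≤ ‖grad (E := E) f p‖ * tangentNorm p v := by
  have h := abs_real_inner_le_norm (grad (E := E) f p) (show TangentSpace 𝓘(ℝ, E) p from v)
  rw [inner_grad] at h
  exact h

theorem norm_grad_le {f : M → ℝ} {p : M} {C : ℝ} (hC : 0 ≤ C)
    (h : ∀ v : E, |scalarDeriv E f p v| ≤ C * tangentNorm p v) : ‖grad (E := E) f p‖ ≤ C := by
  have h1 := (le_abs_self _).trans (h (grad (E := E) f p))
  have h2 := inner_grad f p (grad (E := E) f p)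
  rw [real_inner_self_eq_norm_mul_norm] at h2
  have h3 : ‖grad (E := E) f p‖ * ‖grad (E := E) f p‖ ≤ C * ‖grad (E := E) f p‖ := h2.trans_le h1
  by_contra! hlt
  nlinarith

variable [IsManifold 𝓘(ℝ, E) 1 M]
  [IsContinuousRiemannianBundle E (fun p : M => TangentSpace 𝓘(ℝ, E) p)]

/-- Continuity of the metric in the trivialization at x, which is the identity over x. Measured with
the Riemannian norm at x rather than the norm of the model, the distortion of a chart tends to 1 in
any dimension. -/
theorem eventually_tangentNorm_chartDeriv_le (x : M) {r : ℝ} (hr : 1 < r) :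
    ∀ᶠ y in 𝓝 x, ∀ v : E, tangentNorm x (chartDeriv E x y v) ≤ r * tangentNorm y v := by
  have h := eventually_norm_symmL_trivializationAt_self_comp_lt E
    (fun p : M => TangentSpace 𝓘(ℝ, E) p) x hr
  filter_upwards [h, chart_source_mem_nhds E x] with y hy hy' v
  rw [TangentBundle.continuousLinearMapAt_trivializationAt hy'] at hy
  have := ContinuousLinearMap.le_of_opNorm_le _ hy.le v
  refine le_trans (le_of_eq ?_) this
  have e : (trivializationAt E (TangentSpace 𝓘(ℝ, E)) x).symmL ℝ x =
      (ContinuousLinearMap.id ℝ E) := by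
    rw [TangentBundle.symmL_trivializationAt_eq_core (by simp)]
    ext w
    exact (tangentBundleCore 𝓘(ℝ, E) M).coordChange_self _ _ (by simp) _
  rw [e]
  rfl

theorem eventually_tangentNorm_chartSymmDeriv_le (x : M) {r : ℝ} (hr : 1 < r) :
    ∀ᶠ y in 𝓝 x, ∀ v : E,
      tangentNorm y (chartSymmDeriv x (extChartAt 𝓘(ℝ, E) x y) v) ≤ r * tangentNorm x v := by
  have h := eventually_norm_symmL_trivializationAt_comp_self_lt E
    (fun p : M => TangentSpace 𝓘(ℝ, E) p) x hr
  filter_upwards [h, chart_source_mem_nhds E x] with y hy hy' v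
  rw [TangentBundle.symmL_trivializationAt hy'] at hy
  have := ContinuousLinearMap.le_of_opNorm_le _ hy.le v
  refine le_trans (le_of_eq ?_) this
  have e : (trivializationAt E (TangentSpace 𝓘(ℝ, E)) x).continuousLinearMapAt ℝ x =
      (ContinuousLinearMap.id ℝ E) := by
    rw [TangentBundle.continuousLinearMapAt_trivializationAt_eq_core (by simp)]
    ext w
    exact (tangentBundleCore 𝓘(ℝ, E) M).coordChange_self _ _ (by simp) _
  rw [e, ModelWithCorners.range_eq_univ, mfderivWithin_univ]
  rfl

end TangentNorm

/-! ### Gradient bounds and Lipschitz constants -/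

section Gradient

variable {E : Type*} [NormedAddCommGroup E] [InnerProductSpace ℝ E] [FiniteDimensional ℝ E]
  {M : Type*} [MetricSpace M] [ChartedSpace E M] [IsManifold 𝓘(ℝ, E) 1 M]
  [RiemannianBundle (fun p : M => TangentSpace 𝓘(ℝ, E) p)]
  [IsContinuousRiemannianBundle E (fun p : M => TangentSpace 𝓘(ℝ, E) p)]

theorem contDiffAt_comp_chart_symm {f : M → ℝ} {n : ℕ∞ω} [IsManifold 𝓘(ℝ, E) n M]
    (hf : ContMDiff 𝓘(ℝ, E) 𝓘(ℝ, ℝ) n f) {x : M}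
    {e : E} (he : e ∈ (extChartAt 𝓘(ℝ, E) x).target) :
    ContDiffAt ℝ n (fun e => f ((extChartAt 𝓘(ℝ, E) x).symm e)) e := by
  have h : ContMDiffOn 𝓘(ℝ, E) 𝓘(ℝ, ℝ) n (f ∘ (extChartAt 𝓘(ℝ, E) x).symm)
      (extChartAt 𝓘(ℝ, E) x).target :=
    hf.comp_contMDiffOn (contMDiffOn_extChartAt_symm x)
  exact (contMDiffOn_iff_contDiffOn.1 h).contDiffAt ((isOpen_extChartAt_target x).mem_nhds he)

/-- The norm of the gradient of a `C^1` function is continuous. -/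
theorem continuous_norm_grad {f : M → ℝ} (hf : ContMDiff 𝓘(ℝ, E) 𝓘(ℝ, ℝ) 1 f) :
    Continuous fun p => ‖grad (E := E) f p‖ := by
  rw [continuous_iff_continuousAt]
  intro x
  set u : E → ℝ := fun e => f ((extChartAt 𝓘(ℝ, E) x).symm e) with hu
  obtain ⟨C, hC, hCv⟩ := exists_norm_le_tangentNorm (E := E) x
  have hcont : ContinuousAt (fun y => fderiv ℝ u (extChartAt 𝓘(ℝ, E) x y)) x :=
    ((contDiffAt_comp_chart_symm hf (mem_extChartAt_target x)).continuousAt_fderiv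
      one_ne_zero).comp (continuousAt_extChartAt x)
  have hself : ∀ w, fderiv ℝ u (extChartAt 𝓘(ℝ, E) x x) w = scalarDeriv E f x w := by
    intro w
    have h := hasFDerivAt_comp_chart_symm (g := f) (mem_extChartAt_target (I := 𝓘(ℝ, E)) x)
      (hf.mdifferentiable one_ne_zero _)
    rw [h.fderiv, ContinuousLinearMap.comp_apply, chartSymmDeriv_self,
      extChartAt_to_inv (I := 𝓘(ℝ, E)) x]
  have hnear : ∀ ε > 0, ∀ᶠ y in 𝓝 x, ∀ w, |fderiv ℝ u (extChartAt 𝓘(ℝ, E) x y) w -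
      scalarDeriv E f x w| ≤ ε * tangentNorm x w := by
    intro ε hε
    filter_upwards [Metric.continuousAt_iff'.1 hcont (ε / C) (by positivity)] with y hy w
    rw [← hself, ← sub_apply]
    calc _ ≤ ‖fderiv ℝ u (extChartAt 𝓘(ℝ, E) x y) - fderiv ℝ u (extChartAt 𝓘(ℝ, E) x x)‖ * ‖w‖ :=
          ContinuousLinearMap.le_opNorm _ w
      _ ≤ ε / C * (C * tangentNorm x w) := by
          rw [← dist_eq_norm]
          gcongr
          exact hCv w
      _ = _ := by field_simp
  have hsrc := extChartAt_source_mem_nhds (I := 𝓘(ℝ, E)) x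
  -- Near x the differential in coordinates is ε-close to the one at x, and the chart distorts norms
  -- by at most r in either direction.
  have key : ∀ r > 1, ∀ ε > 0, ∀ᶠ y in 𝓝 x,
      ‖grad (E := E) f y‖ ≤ (‖grad (E := E) f x‖ + ε) * r ∧
      ‖grad (E := E) f x‖ ≤ ‖grad (E := E) f y‖ * r + ε := by
    intro r hr ε hε
    filter_upwards [hnear ε hε, eventually_tangentNorm_chartDeriv_le (E := E) x hr,
      eventually_tangentNorm_chartSymmDeriv_le (E := E) x hr, hsrc] with y h1 h2 h3 hy
    have hr0 : 0 ≤ r := by linarith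
    have hd := scalarDeriv_apply_eq hy (hf.mdifferentiable one_ne_zero y)
    constructor
    · refine norm_grad_le (by positivity) fun v => ?_
      rw [hd v]
      have h4 := h1 (chartDeriv E x y v)
      have h5 := abs_scalarDeriv_le f x (chartDeriv E x y v)
      calc _ ≤ |fderiv ℝ u (extChartAt 𝓘(ℝ, E) x y) (chartDeriv E x y v) -
            scalarDeriv E f x (chartDeriv E x y v)| + |scalarDeriv E f x (chartDeriv E x y v)| := by
            have := abs_add_le (fderiv ℝ u (extChartAt 𝓘(ℝ, E) x y) (chartDeriv E x y v) -
              scalarDeriv E f x (chartDeriv E x y v)) (scalarDeriv E f x (chartDeriv E x y v))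
            rwa [sub_add_cancel] at this
        _ ≤ (‖grad (E := E) f x‖ + ε) * tangentNorm x (chartDeriv E x y v) := by linarith
        _ ≤ (‖grad (E := E) f x‖ + ε) * (r * tangentNorm y v) := by
            gcongr
            exact h2 v
        _ = _ := by ring
    · refine norm_grad_le (by positivity) fun w => ?_
      set v := chartSymmDeriv x (extChartAt 𝓘(ℝ, E) x y) w with hv
      have hw : chartDeriv E x y v = w := by
        have := chartDeriv_chartSymmDeriv ((extChartAt 𝓘(ℝ, E) x).map_source hy) w
        rwa [(extChartAt 𝓘(ℝ, E) x).left_inv hy] at this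
      have h4 := h1 w
      have h5 := abs_scalarDeriv_le f y v
      rw [hd v, hw] at h5
      have h6 := h3 w
      have h7 : ‖grad (E := E) f y‖ * tangentNorm y v ≤
          ‖grad (E := E) f y‖ * (r * tangentNorm x w) := by gcongr
      rw [abs_sub_comm] at h4
      have h8 := abs_add_le (scalarDeriv E f x w - fderiv ℝ u (extChartAt 𝓘(ℝ, E) x y) w)
        (fderiv ℝ u (extChartAt 𝓘(ℝ, E) x y) w)
      rw [sub_add_cancel] at h8
      linarith
  rw [ContinuousAt, tendsto_order]
  set G := ‖grad (E := E) f x‖ with hG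
  have hG0 : 0 ≤ G := norm_nonneg _
  constructor
  · intro a ha
    rcases lt_or_ge a 0 with ha0 | ha0
    · exact .of_forall fun y => ha0.trans_le (norm_nonneg _)
    -- The distortion and the error each use at most a quarter of the gap G - a; the summand 1 in
    -- the denominator covers a = 0.
    filter_upwards [key (1 + (G - a) / (4 * (a + 1))) (by
      have : 0 < (G - a) / (4 * (a + 1)) := div_pos (by linarith) (by linarith)
      linarith) ((G - a) / 4) (by linarith)] with y hy
    by_contra! hlt
    have h1 : ‖grad (E := E) f y‖ * (1 + (G - a) / (4 * (a + 1))) ≤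
        a * (1 + (G - a) / (4 * (a + 1))) := by
      have : 0 ≤ (G - a) / (4 * (a + 1)) := div_nonneg (by linarith) (by linarith)
      gcongr
    have h2 : a * ((G - a) / (4 * (a + 1))) ≤ (G - a) / 4 := by
      rw [mul_div_assoc', div_le_div_iff₀ (by positivity) (by norm_num)]
      nlinarith
    linarith [hy.2]
  · intro a ha
    filter_upwards [key (1 + (a - G) / (4 * (a + 1))) (by
      have : 0 < (a - G) / (4 * (a + 1)) := div_pos (by linarith) (by linarith)
      linarith) ((a - G) / 4) (by linarith)] with y hy
    have h1 : (G + (a - G) / 4) * ((a - G) / (4 * (a + 1))) ≤ (a - G) / 4 := by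
      rw [mul_div_assoc', div_le_div_iff₀ (by linarith) (by norm_num)]
      nlinarith
    linarith [hy.1]

theorem grad_eq_zero_of_notMem_tsupport {f : M → ℝ} {p : M} (hp : p ∉ tsupport f) :
    grad (E := E) f p = 0 := by
  have h : f =ᶠ[𝓝 p] fun _ => 0 := notMem_tsupport_iff_eventuallyEq.1 hp
  have h0 : scalarDeriv E f p = 0 := by
    rw [scalarDeriv, h.mfderiv_eq]
    exact mfderiv_const
  have := norm_grad_le (E := E) (f := f) (p := p) le_rfl fun v => by simp [h0]
  exact norm_le_zero_iff.1 this

theorem exists_norm_grad_le {f : M → ℝ} (hf : ContMDiff 𝓘(ℝ, E) 𝓘(ℝ, ℝ) 1 f)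
    (hf' : HasCompactSupport f) : ∃ L, ∀ p, ‖grad (E := E) f p‖ ≤ L := by
  have hs : HasCompactSupport fun p => ‖grad (E := E) f p‖ := by
    refine HasCompactSupport.intro hf' fun p hp => ?_
    rw [grad_eq_zero_of_notMem_tsupport hp, norm_zero]
  obtain ⟨L, hL⟩ := hs.exists_bound_of_continuous (continuous_norm_grad hf)
  exact ⟨L, fun p => by simpa using hL p⟩

variable [IsRiemannianManifold 𝓘(ℝ, E) M]

/-- Otherwise some C¹ path from x to y would be shorter than |f x - f y| / L, which contradicts
integrating the derivative of f along it. -/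
theorem lipschitzWith_of_norm_grad_le {f : M → ℝ} (hf : ContMDiff 𝓘(ℝ, E) 𝓘(ℝ, ℝ) 1 f) {L : ℝ≥0}
    (hL : ∀ p, ‖grad (E := E) f p‖ ≤ L) : LipschitzWith L f := by
  intro x y
  by_contra! hlt
  have h1 : edist x y < edist (f x) (f y) / L := by
    refine (ENNReal.lt_div_iff_mul_lt (Or.inr (edist_ne_top x y)) (Or.inl ENNReal.coe_ne_top)).2 ?_
    rwa [mul_comm]
  rw [IsRiemannianManifold.out (I := 𝓘(ℝ, E)) x y] at h1
  obtain ⟨γ, hγ0, hγ1, hγ, hlen, -⟩ := exists_lt_locally_constant_of_riemannianEDist_lt h1 one_pos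
  have hlen' : L * pathELength 𝓘(ℝ, E) γ 0 1 < edist (f x) (f y) := by
    rw [mul_comm]
    exact ENNReal.mul_lt_of_lt_div hlen
  refine absurd hlen' (not_lt.2 ?_)
  have hfγ : ContDiff ℝ 1 (f ∘ γ) := contMDiff_iff_contDiff.1 (hf.comp hγ)
  calc edist (f x) (f y) = ‖(f ∘ γ) 1 - (f ∘ γ) 0‖ₑ := by
        rw [Function.comp_apply, Function.comp_apply, hγ0, hγ1, edist_comm, edist_eq_enorm_sub]
    _ ≤ ∫⁻ t in Icc 0 1, ‖derivWithin (f ∘ γ) (Icc 0 1) t‖ₑ :=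
        enorm_sub_le_lintegral_derivWithin_Icc_of_contDiffOn_Icc hfγ.contDiffOn zero_le_one
    _ ≤ ∫⁻ t in Icc (0 : ℝ) 1, L * ‖mfderiv 𝓘(ℝ, ℝ) 𝓘(ℝ, E) γ t 1‖ₑ := by
        refine setLIntegral_mono' measurableSet_Icc fun t ht => ?_
        have hd : HasFDerivAt (f ∘ γ) ((scalarDeriv E f (γ t)).comp
            (mfderiv 𝓘(ℝ, ℝ) 𝓘(ℝ, E) γ t : ℝ →L[ℝ] E)) t :=
          ((hf.mdifferentiable one_ne_zero (γ t)).hasMFDerivAt.comp t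
            (hγ.mdifferentiable one_ne_zero t).hasMFDerivAt).hasFDerivAt
        rw [hd.hasDerivAt.hasDerivWithinAt.derivWithin (uniqueDiffOn_Icc_zero_one t ht),
          Real.enorm_eq_ofReal_abs, ← ofReal_norm, ← ENNReal.ofReal_coe_nnreal,
          ← ENNReal.ofReal_mul L.coe_nonneg]
        refine ENNReal.ofReal_le_ofReal ?_
        have h2 := abs_scalarDeriv_le (E := E) f (γ t) ((mfderiv 𝓘(ℝ, ℝ) 𝓘(ℝ, E) γ t : ℝ →L[ℝ] E) 1)
        exact h2.trans (mul_le_mul_of_nonneg_right (hL _) (tangentNorm_nonneg _ _))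
    _ = L * pathELength 𝓘(ℝ, E) γ 0 1 := by
        rw [lintegral_const_mul' _ _ ENNReal.coe_ne_top, pathELength_eq_lintegral_mfderiv_Icc]

/-- The inverse of a chart distorts distances by a factor close to `1`, if the model is endowed
with the Riemannian norm at the center of the chart. -/
theorem exists_dist_chart_symm_le (x : M) {r : ℝ} (hr : 1 < r) :
    ∃ ρ > 0, ball (extChartAt 𝓘(ℝ, E) x x) ρ ⊆ (extChartAt 𝓘(ℝ, E) x).target ∧
      ∀ a ∈ ball (extChartAt 𝓘(ℝ, E) x x) ρ, ∀ b ∈ ball (extChartAt 𝓘(ℝ, E) x x) ρ,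
        dist ((extChartAt 𝓘(ℝ, E) x).symm a) ((extChartAt 𝓘(ℝ, E) x).symm b) ≤
          r * tangentNorm x (b - a) := by
  have h1 : ∀ᶠ e in 𝓝 (extChartAt 𝓘(ℝ, E) x x), e ∈ (extChartAt 𝓘(ℝ, E) x).target ∧
      ∀ v : E, tangentNorm ((extChartAt 𝓘(ℝ, E) x).symm e) (chartSymmDeriv x e v) ≤
        r * tangentNorm x v := by
    have hc : Filter.Tendsto (extChartAt 𝓘(ℝ, E) x).symm (𝓝 (extChartAt 𝓘(ℝ, E) x x)) (𝓝 x) := by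
      have := continuousAt_extChartAt_symm (I := 𝓘(ℝ, E)) x
      rwa [ContinuousAt, extChartAt_to_inv (I := 𝓘(ℝ, E)) x] at this
    filter_upwards [hc.eventually (eventually_tangentNorm_chartSymmDeriv_le (E := E) x hr),
      extChartAt_target_mem_nhds (I := 𝓘(ℝ, E)) x] with e he he'
    refine ⟨he', fun v => ?_⟩
    have := he v
    rwa [(extChartAt 𝓘(ℝ, E) x).right_inv he'] at this
  obtain ⟨ρ, hρ, hsub⟩ := Metric.eventually_nhds_iff_ball.1 h1
  refine ⟨ρ, hρ, fun e he => (hsub e he).1, fun a ha b hb => ?_⟩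
  have hr0 : 0 ≤ r := by linarith
  -- The straight segment in the chart; the length of its image bounds the Riemannian distance.
  let η : ℝ → E := fun t => a + t • (b - a)
  have hη : ∀ t ∈ Icc (0 : ℝ) 1, η t ∈ ball (extChartAt 𝓘(ℝ, E) x x) ρ := fun t ht =>
    (convex_ball _ _).add_smul_sub_mem ha hb ht
  have hηd : ∀ t, HasFDerivAt η (ContinuousLinearMap.toSpanSingleton ℝ (b - a)) t := fun t =>
    ((ContinuousLinearMap.toSpanSingleton ℝ (b - a)).hasFDerivAt).const_add a
  have hηs : ContDiff ℝ 1 η := by fun_prop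
  have hle : edist ((extChartAt 𝓘(ℝ, E) x).symm a) ((extChartAt 𝓘(ℝ, E) x).symm b) ≤
      pathELength 𝓘(ℝ, E) ((extChartAt 𝓘(ℝ, E) x).symm ∘ η) 0 1 := by
    rw [IsRiemannianManifold.out (I := 𝓘(ℝ, E))]
    refine riemannianEDist_le_pathELength ?_ (by simp [η]) (by simp [η]) zero_le_one
    exact (contMDiffOn_extChartAt_symm x).comp (contMDiff_iff_contDiff.2 hηs).contMDiffOn
      fun t ht => (hsub _ (hη t ht)).1
  rw [← ENNReal.ofReal_le_ofReal_iff (mul_nonneg hr0 (tangentNorm_nonneg _ _)), ← edist_dist]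
  refine hle.trans ?_
  rw [pathELength_eq_lintegral_mfderiv_Icc]
  calc _ ≤ ∫⁻ t in Icc (0 : ℝ) 1, ENNReal.ofReal (r * tangentNorm x (b - a)) := by
        refine setLIntegral_mono' measurableSet_Icc fun t ht => ?_
        have hmem := hsub _ (hη t ht)
        have hd : mfderiv 𝓘(ℝ, ℝ) 𝓘(ℝ, E) ((extChartAt 𝓘(ℝ, E) x).symm ∘ η) t =
            (chartSymmDeriv x (η t)).comp (ContinuousLinearMap.toSpanSingleton ℝ (b - a)) :=
          ((mdifferentiableAt_chart_symm hmem.1).hasMFDerivAt.comp t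
            (hηd t).hasMFDerivAt).mfderiv
        rw [hd, ← ofReal_norm]
        refine ENNReal.ofReal_le_ofReal ?_
        have h3 := hmem.2 (ContinuousLinearMap.toSpanSingleton ℝ (b - a) 1)
        rw [ContinuousLinearMap.toSpanSingleton_apply, one_smul] at h3
        refine le_trans (le_of_eq ?_) h3
        change tangentNorm _ (chartSymmDeriv x (η t)
          (ContinuousLinearMap.toSpanSingleton ℝ (b - a) 1)) = _
        rw [ContinuousLinearMap.toSpanSingleton_apply, one_smul]
        rfl
    _ = _ := by simp

/-- The bound holds at every point: where f is not differentiable, `mfderiv` and hence `grad` take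
the default value 0. Elsewhere, take difference quotients along lines in the chart and let the
distortion r tend to 1. -/
theorem norm_grad_le_of_lipschitzWith {f : M → ℝ} {L : ℝ≥0} (hf : LipschitzWith L f) (p : M) :
    ‖grad (E := E) f p‖ ≤ L := by
  by_cases hd : MDifferentiableAt 𝓘(ℝ, E) 𝓘(ℝ, ℝ) f p
  swap
  · have h0 : scalarDeriv E f p = 0 := mfderiv_zero_of_not_mdifferentiableAt hd
    exact norm_grad_le L.coe_nonneg fun v => by
      rw [h0, zero_apply, abs_zero]
      exact mul_nonneg L.coe_nonneg (tangentNorm_nonneg p v)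
  refine norm_grad_le L.coe_nonneg fun v => ?_
  have key : ∀ r > 1, |scalarDeriv E f p v| ≤ L * (r * tangentNorm p v) := by
    intro r hr
    obtain ⟨ρ, hρ, hsub, hdist⟩ := exists_dist_chart_symm_le (E := E) p hr
    set e₀ := extChartAt 𝓘(ℝ, E) p p with he₀
    have h1 := hasFDerivAt_comp_chart_symm (g := f) (x := p) (e := e₀)
      (mem_extChartAt_target p) (by rwa [extChartAt_to_inv (I := 𝓘(ℝ, E)) p])
    have h2 : HasDerivAt (fun t : ℝ => f ((extChartAt 𝓘(ℝ, E) p).symm (e₀ + t • v)))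
        (scalarDeriv E f p v) 0 := by
      have hl : HasDerivAt (fun t : ℝ => e₀ + t • v) v 0 := by
        simpa using ((hasDerivAt_id (0 : ℝ)).smul_const v).const_add e₀
      have h1' := h1
      rw [show e₀ = e₀ + (0 : ℝ) • v by simp] at h1'
      have h3 := HasFDerivAt.comp_hasDerivAt (0 : ℝ) h1' hl
      rw [zero_smul, add_zero] at h3
      rwa [ContinuousLinearMap.comp_apply, chartSymmDeriv_self,
        extChartAt_to_inv (I := 𝓘(ℝ, E)) p] at h3
    have hmem : ∀ᶠ t : ℝ in 𝓝 0, e₀ + t • v ∈ ball e₀ ρ := by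
      have : Continuous fun t : ℝ => e₀ + t • v := by fun_prop
      exact this.continuousAt.eventually_mem (by simpa using ball_mem_nhds e₀ hρ)
    rw [← Real.norm_eq_abs]
    refine h2.le_of_lip' (mul_nonneg L.coe_nonneg (mul_nonneg (by linarith)
      (tangentNorm_nonneg _ _))) ?_
    filter_upwards [hmem] with t ht
    have h4 := hf.dist_le_mul ((extChartAt 𝓘(ℝ, E) p).symm (e₀ + t • v))
      ((extChartAt 𝓘(ℝ, E) p).symm e₀)
    have h5 := hdist e₀ (mem_ball_self hρ) _ ht
    rw [add_sub_cancel_left, tangentNorm_smul] at h5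
    rw [← dist_eq_norm, zero_smul, add_zero, sub_zero, Real.norm_eq_abs]
    refine h4.trans ?_
    rw [dist_comm]
    calc (L : ℝ) * _ ≤ L * (r * (|t| * tangentNorm p v)) := by gcongr
      _ = _ := by ring
  have hlim : Filter.Tendsto (fun r : ℝ => L * (r * tangentNorm p v)) (𝓝[>] 1)
      (𝓝 (L * (1 * tangentNorm p v))) :=
    ((by fun_prop : Continuous fun r : ℝ => L * (r * tangentNorm p v)).tendsto 1).mono_left
      nhdsWithin_le_nhds
  have := ge_of_tendsto hlim (Filter.eventually_of_mem self_mem_nhdsWithin fun r hr => key r hr)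
  rwa [one_mul] at this

end Gradient

/-! ### Locally Lipschitz functions on Euclidean space: Rademacher and integration by parts -/

section LocallyLipschitz

variable {E : Type*} [NormedAddCommGroup E] [InnerProductSpace ℝ E] [FiniteDimensional ℝ E]
  [MeasurableSpace E] [BorelSpace E] {U : Set E} {u : E → ℝ}

theorem exists_ball_lipschitzOnWith (hU : IsOpen U) (hu : LocallyLipschitzOn U u) {e : E}
    (he : e ∈ U) : ∃ K : ℝ≥0, ∃ ρ > 0, ball e ρ ⊆ U ∧ LipschitzOnWith K u (ball e ρ) := by
  obtain ⟨K, t, ht, hK⟩ := hu he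
  rw [hU.nhdsWithin_eq he] at ht
  obtain ⟨ρ, hρ, hsub⟩ := Metric.mem_nhds_iff.1 (Filter.inter_mem ht (hU.mem_nhds he))
  exact ⟨K, ρ, hρ, fun y hy => (hsub hy).2, hK.mono fun y hy => (hsub hy).1⟩

theorem ae_differentiableAt_of_locallyLipschitzOn (hU : IsOpen U) (hu : LocallyLipschitzOn U u) :
    ∀ᵐ e ∂(volume : Measure E), e ∈ U → DifferentiableAt ℝ u e := by
  rw [ae_iff]
  refine measure_null_of_locally_null _ fun e he => ?_
  have heU : e ∈ U := by
    by_contra h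
    exact he fun h' => absurd h' h
  obtain ⟨K, ρ, hρ, -, hK⟩ := exists_ball_lipschitzOnWith hU hu heU
  refine ⟨{y | ¬ (y ∈ ball e ρ → DifferentiableAt ℝ u y)}, ?_, ?_⟩
  · refine mem_nhdsWithin.2 ⟨ball e ρ, isOpen_ball, mem_ball_self hρ, ?_⟩
    rintro y ⟨hy, hy'⟩ h
    exact hy' fun _ => h hy
  · rw [← ae_iff]
    filter_upwards [hK.ae_differentiableWithinAt_of_mem (μ := volume)] with y hy hyb
    exact (hy hyb).differentiableAt (isOpen_ball.mem_nhds hyb)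

theorem locallyIntegrableOn_fderiv_of_locallyLipschitzOn (hU : IsOpen U)
    (hu : LocallyLipschitzOn U u) (v : E) :
    LocallyIntegrableOn (fun e => fderiv ℝ u e v) U volume := by
  intro e he
  obtain ⟨K, ρ, hρ, -, hK⟩ := exists_ball_lipschitzOnWith hU hu he
  refine ⟨ball e ρ, mem_nhdsWithin_of_mem_nhds (ball_mem_nhds e hρ), ?_⟩
  refine Measure.integrableOn_of_bounded measure_ball_lt_top.ne
    (measurable_fderiv_apply_const ℝ u v).aestronglyMeasurable (M := K * ‖v‖) ?_
  filter_upwards [ae_restrict_mem measurableSet_ball] with y hy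
  exact ContinuousLinearMap.le_of_opNorm_le _
    (norm_fderiv_le_of_lipschitzOn ℝ (isOpen_ball.mem_nhds hy) hK) v

/-- Integration by parts for locally Lipschitz functions. -/
theorem setIntegral_mul_fderiv_of_locallyLipschitzOn (hU : IsOpen U)
    (hu : LocallyLipschitzOn U u) (v : E) {ψ : E → ℝ} (hψ : ContDiff ℝ ∞ ψ)
    (hψc : HasCompactSupport ψ) (hψU : tsupport ψ ⊆ U) :
    ∫ e in U, u e * fderiv ℝ ψ e v = - ∫ e in U, fderiv ℝ u e v * ψ e := by
  -- On a compact neighborhood of the support of ψ, u is Lipschitz and extends to a globally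
  -- Lipschitz function, to which integration by parts on the whole space applies.
  obtain ⟨K', hK'c, hK'1, hK'2⟩ := exists_compact_between hψc hU hψU
  obtain ⟨K, hK⟩ := (hu.mono hK'2).exists_lipschitzOnWith_of_compact hK'c
  obtain ⟨g, hg, hgu⟩ := hK.extend_real
  obtain ⟨C, hC⟩ := hψ.lipschitzWith_of_hasCompactSupport hψc (by simp)
  have hmain := hg.integral_lineDeriv_mul_eq (μ := volume) hC hψc v
  have hψd : ∀ e, DifferentiableAt ℝ ψ e := fun e => hψ.differentiable (by simp) e
  have hzero : ∀ e ∉ tsupport ψ, fderiv ℝ ψ e v = 0 := fun e he => by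
    rw [image_eq_zero_of_notMem_tsupport (fun h => he (tsupport_fderiv_subset ℝ h)), zero_apply]
  have h1 : ∫ e in U, u e * fderiv ℝ ψ e v = ∫ e, g e * fderiv ℝ ψ e v := by
    rw [← integral_indicator hU.measurableSet]
    congr 1
    ext e
    by_cases he : e ∈ tsupport ψ
    · rw [indicator_of_mem (hψU he), hgu (interior_subset (hK'1 he))]
    · by_cases heU : e ∈ U
      · rw [indicator_of_mem heU, hzero e he, mul_zero, mul_zero]
      · rw [indicator_of_notMem heU, hzero e he, mul_zero]
  have h2 : ∫ e in U, fderiv ℝ u e v * ψ e = ∫ e, lineDeriv ℝ g e v * ψ e := by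
    rw [← integral_indicator hU.measurableSet]
    refine integral_congr_ae ?_
    filter_upwards [hg.ae_differentiableAt (μ := volume)] with e hge
    by_cases he : e ∈ tsupport ψ
    · rw [indicator_of_mem (hψU he), hge.lineDeriv_eq_fderiv]
      congr 2
      refine Filter.EventuallyEq.fderiv_eq ?_
      filter_upwards [isOpen_interior.mem_nhds (hK'1 he)] with y hy
      exact hgu (interior_subset hy)
    · have h0 := image_eq_zero_of_notMem_tsupport he
      by_cases heU : e ∈ U
      · rw [indicator_of_mem heU, h0, mul_zero, mul_zero]
      · rw [indicator_of_notMem heU, h0, mul_zero]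
  rw [h1, h2, hmain, ← integral_neg]
  congr 1
  ext e
  rw [(hψd e).lineDeriv_eq_fderiv, map_neg]
  ring

end LocallyLipschitz

/-! ### Weak gradients of Lipschitz functions on the manifold -/

section WeakGradient

variable {E : Type*} [NormedAddCommGroup E] [InnerProductSpace ℝ E] [FiniteDimensional ℝ E]
  {M : Type*} [MetricSpace M] [ChartedSpace E M] [IsManifold 𝓘(ℝ, E) 1 M]
  [RiemannianBundle (fun p : M => TangentSpace 𝓘(ℝ, E) p)]
  [IsContinuousRiemannianBundle E (fun p : M => TangentSpace 𝓘(ℝ, E) p)]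
  [IsRiemannianManifold 𝓘(ℝ, E) M]

/-- Distances are controlled only near the center of a chart. At another point p of the domain, the
chart around p is used together with the C¹ transition map. -/
theorem locallyLipschitzOn_chart_symm (x : M) :
    LocallyLipschitzOn (extChartAt 𝓘(ℝ, E) x).target (extChartAt 𝓘(ℝ, E) x).symm := by
  intro e he
  set p := (extChartAt 𝓘(ℝ, E) x).symm e with hp
  obtain ⟨ρ, hρ, -, hdist⟩ := exists_dist_chart_symm_le (E := E) p one_lt_two
  obtain ⟨C, hC, hCv⟩ := exists_tangentNorm_le (E := E) p
  set τ : E → E := extChartAt 𝓘(ℝ, E) p ∘ (extChartAt 𝓘(ℝ, E) x).symm with hτ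
  have hτe : τ e = extChartAt 𝓘(ℝ, E) p p := rfl
  have hmem : e ∈ ((extChartAt 𝓘(ℝ, E) x).symm ≫ extChartAt 𝓘(ℝ, E) p).source := by
    rw [PartialEquiv.trans_source]
    exact ⟨he, mem_extChartAt_source (I := 𝓘(ℝ, E)) p⟩
  have hτd : ContDiffAt ℝ 1 τ e := by
    have := contDiffWithinAt_ext_coord_change (I := 𝓘(ℝ, E)) (n := 1) p x hmem
    rwa [ModelWithCorners.range_eq_univ, contDiffWithinAt_univ] at this
  obtain ⟨K, t, ht, hK⟩ := hτd.exists_lipschitzOnWith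
  have h1 : ∀ᶠ y in 𝓝 e, τ y ∈ ball (extChartAt 𝓘(ℝ, E) p p) ρ :=
    hτd.continuousAt.eventually_mem (by rw [hτe]; exact ball_mem_nhds _ hρ)
  have h2 : ∀ᶠ y in 𝓝 e, (extChartAt 𝓘(ℝ, E) p).symm (τ y) = (extChartAt 𝓘(ℝ, E) x).symm y := by
    have hc : ContinuousAt (extChartAt 𝓘(ℝ, E) x).symm e := continuousAt_extChartAt_symm'' he
    filter_upwards [hc.eventually_mem (extChartAt_source_mem_nhds (I := 𝓘(ℝ, E)) p)] with y hy
    exact (extChartAt 𝓘(ℝ, E) p).left_inv hy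
  refine ⟨2 * C.toNNReal * K, t ∩ {y | τ y ∈ ball (extChartAt 𝓘(ℝ, E) p p) ρ ∧
    (extChartAt 𝓘(ℝ, E) p).symm (τ y) = (extChartAt 𝓘(ℝ, E) x).symm y},
    mem_nhdsWithin_of_mem_nhds (Filter.inter_mem ht (h1.and h2)), ?_⟩
  refine LipschitzOnWith.of_dist_le_mul fun a ha b hb => ?_
  rw [← ha.2.2, ← hb.2.2]
  refine (hdist _ ha.2.1 _ hb.2.1).trans ?_
  have h3 := hK.dist_le_mul a ha.1 b hb.1
  push_cast
  rw [Real.coe_toNNReal C hC.le]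
  calc 2 * tangentNorm p (τ b - τ a) ≤ 2 * (C * ‖τ b - τ a‖) := by
        gcongr
        exact hCv _
    _ ≤ 2 * (C * (K * dist a b)) := by
        rw [← dist_eq_norm, dist_comm]
        gcongr
    _ = _ := by ring

variable [MeasurableSpace E] [BorelSpace E]

/-- The almost everywhere defined gradient of a Lipschitz function is its weak gradient. -/
theorem isWeakGrad_grad_of_lipschitzWith {f : M → ℝ} {L : ℝ≥0} (hf : LipschitzWith L f) :
    IsWeakGrad f (grad (E := E) f) := by
  intro x
  have hU : IsOpen (extChartAt 𝓘(ℝ, E) x).target := isOpen_extChartAt_target x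
  set u : E → ℝ := fun y => f ((extChartAt 𝓘(ℝ, E) x).symm y) with hu
  have huL : LocallyLipschitzOn (extChartAt 𝓘(ℝ, E) x).target u := by
    intro e he
    obtain ⟨K, t, ht, hK⟩ := locallyLipschitzOn_chart_symm x he
    exact ⟨L * K, t, ht, hf.comp_lipschitzOnWith hK⟩
  -- By Rademacher the coordinate expression is differentiable almost everywhere in the chart, and
  -- there the chain rule applies.
  have hae : ∀ v : E, ∀ᵐ y ∂volume, y ∈ (extChartAt 𝓘(ℝ, E) x).target →
      fderiv ℝ u y v =
        inner ℝ (grad (E := E) f ((extChartAt 𝓘(ℝ, E) x).symm y)) (coordVec x y v) := by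
    intro v
    filter_upwards [ae_differentiableAt_of_locallyLipschitzOn hU huL] with y hy hyU
    have hr := (extChartAt 𝓘(ℝ, E) x).right_inv hyU
    have hd : MDifferentiableAt 𝓘(ℝ, E) 𝓘(ℝ, ℝ) f ((extChartAt 𝓘(ℝ, E) x).symm y) :=
      mdifferentiableAt_of_chart ((extChartAt 𝓘(ℝ, E) x).map_target hyU) (by rw [hr]; exact hy hyU)
    rw [inner_grad, (hasFDerivAt_comp_chart_symm hyU hd).fderiv]
    rfl
  refine ⟨huL.continuousOn.locallyIntegrableOn hU.measurableSet, fun v => ⟨?_, ?_⟩⟩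
  · intro e he
    obtain ⟨t, ht, hi⟩ := locallyIntegrableOn_fderiv_of_locallyLipschitzOn hU huL v e he
    obtain ⟨s, hs, hes, hst⟩ := mem_nhdsWithin.1 ht
    refine ⟨s ∩ (extChartAt 𝓘(ℝ, E) x).target,
      Filter.inter_mem (mem_nhdsWithin_of_mem_nhds (hs.mem_nhds hes)) self_mem_nhdsWithin, ?_⟩
    refine (hi.mono_set hst).congr_fun_ae ?_
    filter_upwards [ae_restrict_of_ae (hae v),
      ae_restrict_mem (hs.measurableSet.inter hU.measurableSet)] with y hy hyU
    exact hy hyU.2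
  · intro ψ hψ hψc hψU
    rw [setIntegral_mul_fderiv_of_locallyLipschitzOn hU huL v hψ hψc hψU]
    congr 1
    refine integral_congr_ae ?_
    filter_upwards [ae_restrict_of_ae (hae v), ae_restrict_mem hU.measurableSet] with y hy hyU
    rw [hy hyU]

end WeakGradient

/-! ### Smoothing and bump functions with dimension-free gradient bounds -/

open scoped Convolution in
/-- Mollification of a function which is Lipschitz on a ball with respect to the seminorm `T`: the
derivative is controlled by the same seminorm. -/
theorem exists_contDiff_approx {E : Type*} [NormedAddCommGroup E] [InnerProductSpace ℝ E]
    [FiniteDimensional ℝ E] [MeasurableSpace E] [BorelSpace E] {u T : E → ℝ} {e₀ : E} {ρ A C : ℝ}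
    (hρ : 0 < ρ) (hA : 0 ≤ A) (hC : 0 < C) (hT0 : ∀ v, 0 ≤ T v)
    (hTs : ∀ (t : ℝ) v, T (t • v) = |t| * T v) (hTC : ∀ v, T v ≤ C * ‖v‖)
    (hu : ∀ a ∈ ball e₀ ρ, ∀ b ∈ ball e₀ ρ, |u a - u b| ≤ A * T (b - a)) {ε : ℝ} (hε : 0 < ε) :
    ∃ k : E → ℝ, ContDiff ℝ ∞ k ∧ ∀ e ∈ ball e₀ (ρ / 4), |k e - u e| ≤ ε ∧
      ∀ v, |fderiv ℝ k e v| ≤ A * T v := by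
  have huc : ContinuousOn u (closedBall e₀ (ρ / 2)) := by
    have hlip : LipschitzOnWith (A * C).toNNReal u (ball e₀ ρ) := by
      refine LipschitzOnWith.of_dist_le_mul fun a ha b hb => ?_
      rw [Real.coe_toNNReal _ (by positivity), Real.dist_eq, dist_comm, dist_eq_norm, mul_assoc]
      exact (hu a ha b hb).trans (mul_le_mul_of_nonneg_left (hTC _) hA)
    exact hlip.continuousOn.mono (closedBall_subset_ball (by linarith))
  -- The cutoff makes w integrable; from `ball e₀ (ρ / 4)` a mollifier of radius δ ≤ ρ/4 only sees
  -- points where w = u.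
  set w : E → ℝ := (closedBall e₀ (ρ / 2)).indicator u with hw
  have hwi : Integrable w volume :=
    (huc.integrableOn_compact (isCompact_closedBall _ _)).integrable_indicator
      measurableSet_closedBall
  have hwu : ∀ e ∈ ball e₀ (ρ / 2), w e = u e := fun e he =>
    indicator_of_mem (ball_subset_closedBall he) u
  -- A + 1 in place of A keeps the denominator positive when A = 0.
  set δ := min (ρ / 4) (ε / ((A + 1) * C)) with hδ
  have hδ0 : 0 < δ := lt_min (by linarith) (by positivity)
  have hδρ : δ ≤ ρ / 4 := min_le_left _ _
  have hδε : A * (C * δ) ≤ ε := by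
    have h1 : δ ≤ ε / ((A + 1) * C) := min_le_right _ _
    rw [le_div_iff₀ (by positivity)] at h1
    have : 0 ≤ δ * C := by positivity
    nlinarith
  let φ : ContDiffBump (0 : E) := ⟨δ / 2, δ, by linarith, by linarith⟩
  have hφs : Function.support (φ.normed volume) ⊆ ball 0 δ := (φ.support_normed_eq).subset
  set k : E → ℝ := φ.normed volume ⋆[ContinuousLinearMap.lsmul ℝ ℝ, volume] w with hk
  have hkd : ContDiff ℝ ∞ k :=
    φ.hasCompactSupport_normed.contDiff_convolution_left _ φ.contDiff_normed
      hwi.locallyIntegrable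
  have hex : ConvolutionExists (φ.normed volume) w (ContinuousLinearMap.lsmul ℝ ℝ) volume :=
    φ.hasCompactSupport_normed.convolutionExists_left _ φ.continuous_normed
      hwi.locallyIntegrable
  refine ⟨k, hkd, fun e he => ⟨?_, fun v => ?_⟩⟩
  · rw [← hwu e (ball_subset_ball (by linarith) he), ← Real.dist_eq]
    refine dist_convolution_le hε.le hφs (fun x => φ.nonneg_normed x) φ.integral_normed
      hwi.aestronglyMeasurable fun y hy => ?_
    have hy2 : y ∈ ball e₀ (ρ / 2) := by
      rw [mem_ball] at *
      linarith [dist_triangle y e e₀]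
    rw [hwu e (ball_subset_ball (by linarith) he), hwu y hy2, Real.dist_eq]
    refine (hu y (ball_subset_ball (by linarith) hy2) e
      (ball_subset_ball (by linarith) he)).trans (le_trans ?_ hδε)
    gcongr
    refine (hTC _).trans ?_
    rw [← dist_eq_norm, dist_comm]
    gcongr
    exact (mem_ball.1 hy).le
  · have hline : HasDerivAt (fun t : ℝ => k (e + t • v)) (fderiv ℝ k e v) 0 := by
      have h1 := (hkd.differentiable (by simp) e).hasFDerivAt
      rw [show e = e + (0 : ℝ) • v by simp] at h1
      have h2 : HasDerivAt (fun t : ℝ => e + t • v) v 0 := by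
        simpa using ((hasDerivAt_id (0 : ℝ)).smul_const v).const_add e
      have h3 := HasFDerivAt.comp_hasDerivAt (0 : ℝ) h1 h2
      rw [zero_smul, add_zero] at h3
      exact h3
    rw [← Real.norm_eq_abs]
    refine hline.le_of_lip' (mul_nonneg hA (hT0 v)) ?_
    have hmem : ∀ᶠ t : ℝ in 𝓝 0, e + t • v ∈ ball e₀ (ρ / 4) := by
      have : Continuous fun t : ℝ => e + t • v := by fun_prop
      exact this.continuousAt.eventually_mem (by simpa using isOpen_ball.mem_nhds he)
    filter_upwards [hmem] with t ht
    -- Convolution commutes with translations: an increment of k is an average of increments of u,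
    -- each at most A T(v) |t|, so no dimensional constant appears.
    have hdiff : k (e + t • v) - k (e + (0 : ℝ) • v) =
        (φ.normed volume ⋆[ContinuousLinearMap.lsmul ℝ ℝ, volume]
          fun y => w (y + t • v) - w y) e := by
      rw [zero_smul, add_zero, hk, convolution, convolution, convolution,
        ← integral_sub (hex (e + t • v)).integrable (hex e).integrable]
      congr 1
      ext s
      rw [map_sub, show e - s + t • v = e + t • v - s by abel]
    have hgm : AEStronglyMeasurable (fun y => w (y + t • v) - w y) volume :=
      (hwi.comp_add_right (t • v)).aestronglyMeasurable.sub hwi.aestronglyMeasurable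
    have hb := dist_convolution_le (z₀ := (0 : ℝ)) (ε := A * T v * |t|) (x₀ := e)
      (mul_nonneg (mul_nonneg hA (hT0 v)) (abs_nonneg t)) hφs (fun x => φ.nonneg_normed x)
      φ.integral_normed hgm fun y hy => ?_
    · rw [hdiff, sub_zero, Real.norm_eq_abs t, ← dist_zero_right]
      exact hb
    · have hy2 : y ∈ ball e₀ (ρ / 2) := by
        rw [mem_ball] at *
        linarith [dist_triangle y e e₀]
      have hy3 : y + t • v ∈ ball e₀ (ρ / 2) := by
        have : dist (y + t • v) e₀ ≤ dist y e + dist (e + t • v) e₀ := by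
          rw [dist_eq_norm, dist_eq_norm, dist_eq_norm]
          refine le_trans (le_of_eq ?_) (norm_add_le _ _)
          congr 1
          abel
        rw [mem_ball] at *
        linarith
      rw [hwu _ hy2, hwu _ hy3, dist_zero_right, Real.norm_eq_abs, abs_sub_comm]
      refine (hu _ (ball_subset_ball (by linarith) hy2) _
        (ball_subset_ball (by linarith) hy3)).trans_eq ?_
      rw [add_sub_cancel_left, hTs]
      ring

section Smoothing

variable {E : Type*} [NormedAddCommGroup E] [InnerProductSpace ℝ E] [FiniteDimensional ℝ E]
  {M : Type*} [MetricSpace M] [ChartedSpace E M] [IsManifold 𝓘(ℝ, E) ∞ M]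
  [RiemannianBundle (fun p : M => TangentSpace 𝓘(ℝ, E) p)]
  [IsContinuousRiemannianBundle E (fun p : M => TangentSpace 𝓘(ℝ, E) p)]
  [IsRiemannianManifold 𝓘(ℝ, E) M]

/-- Local smoothing of a Lipschitz function, with a control of the gradient that does not depend
on the dimension. -/
theorem exists_local_smooth_approx {h : M → ℝ} {L : ℝ≥0} (hL : LipschitzWith L h) (x : M) :
    ∃ W : Set M, IsOpen W ∧ x ∈ W ∧ W ⊆ ball x 1 ∧ ∀ ε > 0, ∃ k : M → ℝ,
      ContMDiffOn 𝓘(ℝ, E) 𝓘(ℝ, ℝ) ∞ k W ∧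
      ∀ y ∈ W, |k y - h y| ≤ ε ∧ ∀ v : E, |scalarDeriv E k y v| ≤ 2 * L * tangentNorm y v := by
  borelize E
  -- One factor 5/4 is lost in passing to the norm at x and one in passing back; (5/4)² ≤ 2.
  obtain ⟨ρ, hρ, hsub, hdist⟩ := exists_dist_chart_symm_le (E := E) x
    (show (1 : ℝ) < 5 / 4 by norm_num)
  obtain ⟨C, hC, hCv⟩ := exists_tangentNorm_le (E := E) x
  obtain ⟨V, hV, hVo, hxV⟩ := _root_.mem_nhds_iff.1 (eventually_tangentNorm_chartDeriv_le (E := E) x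
    (show (1 : ℝ) < 5 / 4 by norm_num))
  have hWo := (continuousOn_extChartAt (I := 𝓘(ℝ, E)) x).isOpen_inter_preimage
    (isOpen_extChartAt_source x) (isOpen_ball (x := extChartAt 𝓘(ℝ, E) x x) (ε := ρ / 4))
  refine ⟨(extChartAt 𝓘(ℝ, E) x).source ∩
    extChartAt 𝓘(ℝ, E) x ⁻¹' ball (extChartAt 𝓘(ℝ, E) x x) (ρ / 4) ∩ (V ∩ ball x 1),
    hWo.inter (hVo.inter isOpen_ball),
    ⟨⟨mem_extChartAt_source x, mem_ball_self (by positivity)⟩, hxV, mem_ball_self one_pos⟩,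
    fun y hy => hy.2.2, fun ε hε => ?_⟩
  obtain ⟨k, hk, hke⟩ := exists_contDiff_approx (u := fun e => h ((extChartAt 𝓘(ℝ, E) x).symm e))
    (T := tangentNorm x) (e₀ := extChartAt 𝓘(ℝ, E) x x) (A := L * (5 / 4)) hρ (by positivity) hC
    (tangentNorm_nonneg x) (tangentNorm_smul x) hCv (fun a ha b hb => by
      have := hL.dist_le_mul ((extChartAt 𝓘(ℝ, E) x).symm a) ((extChartAt 𝓘(ℝ, E) x).symm b)
      rw [Real.dist_eq] at this
      refine this.trans ?_
      rw [mul_assoc]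
      gcongr
      exact hdist a ha b hb) hε
  have hkM : ContMDiffOn 𝓘(ℝ, E) 𝓘(ℝ, ℝ) ∞ (k ∘ extChartAt 𝓘(ℝ, E) x)
      (extChartAt 𝓘(ℝ, E) x).source := by
    rw [extChartAt_source]
    exact (contMDiff_iff_contDiff.2 hk).comp_contMDiffOn contMDiffOn_extChartAt
  refine ⟨k ∘ extChartAt 𝓘(ℝ, E) x, hkM.mono fun y hy => hy.1.1, fun y hy => ⟨?_, fun v => ?_⟩⟩
  · have := (hke _ hy.1.2).1
    rwa [(extChartAt 𝓘(ℝ, E) x).left_inv hy.1.1] at this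
  · have hd : scalarDeriv E (k ∘ extChartAt 𝓘(ℝ, E) x) y =
        (fderiv ℝ k (extChartAt 𝓘(ℝ, E) x y)).comp (chartDeriv E x y) :=
      ((hk.differentiable (by simp) _).hasFDerivAt.hasMFDerivAt.comp y
        (mdifferentiableAt_extChartAt (I := 𝓘(ℝ, E))
          (by simpa using hy.1.1)).hasMFDerivAt).mfderiv
    rw [hd, ContinuousLinearMap.comp_apply]
    refine ((hke _ hy.1.2).2 _).trans ?_
    calc (L : ℝ) * (5 / 4) * tangentNorm x (chartDeriv E x y v)
        ≤ L * (5 / 4) * (5 / 4 * tangentNorm y v) := by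
          gcongr
          exact hV hy.2.1 v
      _ ≤ _ := by nlinarith [mul_nonneg L.coe_nonneg (tangentNorm_nonneg y v)]

end Smoothing

section Smoothing

variable {E : Type*} [NormedAddCommGroup E] [InnerProductSpace ℝ E] [FiniteDimensional ℝ E]
  {M : Type*}

section ScalarDeriv

variable [TopologicalSpace M] [ChartedSpace E M]

theorem scalarDeriv_mul {f g : M → ℝ} {p : M} (hf : MDifferentiableAt 𝓘(ℝ, E) 𝓘(ℝ, ℝ) f p)
    (hg : MDifferentiableAt 𝓘(ℝ, E) 𝓘(ℝ, ℝ) g p) (v : E) :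
    scalarDeriv E (fun y => f y * g y) p v =
      f p * scalarDeriv E g p v + g p * scalarDeriv E f p v := by
  have h := (hf.hasMFDerivAt.mul hg.hasMFDerivAt).mfderiv
  exact congrArg (fun L : E →L[ℝ] ℝ => L v) h

theorem scalarDeriv_congr {f g : M → ℝ} {p : M} (h : f =ᶠ[𝓝 p] g) :
    scalarDeriv E f p = scalarDeriv E g p := h.mfderiv_eq

theorem scalarDeriv_const (a : ℝ) (p : M) : scalarDeriv E (fun _ : M => a) p = 0 := mfderiv_const

theorem scalarDeriv_add {f g : M → ℝ} {p : M} (hf : MDifferentiableAt 𝓘(ℝ, E) 𝓘(ℝ, ℝ) f p)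
    (hg : MDifferentiableAt 𝓘(ℝ, E) 𝓘(ℝ, ℝ) g p) :
    scalarDeriv E (fun y => f y + g y) p = scalarDeriv E f p + scalarDeriv E g p :=
  (hf.hasMFDerivAt.add hg.hasMFDerivAt).mfderiv

theorem scalarDeriv_sum {ι : Type*} (t : Finset ι) {f : ι → M → ℝ} {p : M}
    (hf : ∀ i ∈ t, MDifferentiableAt 𝓘(ℝ, E) 𝓘(ℝ, ℝ) (f i) p) (v : E) :
    scalarDeriv E (fun y => ∑ i ∈ t, f i y) p v = ∑ i ∈ t, scalarDeriv E (f i) p v := by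
  classical
  have h : MDifferentiableAt 𝓘(ℝ, E) 𝓘(ℝ, ℝ) (fun y => ∑ i ∈ t, f i y) p ∧
      scalarDeriv E (fun y => ∑ i ∈ t, f i y) p v = ∑ i ∈ t, scalarDeriv E (f i) p v := by
    induction t using Finset.induction_on with
    | empty =>
      simp only [Finset.sum_empty]
      exact ⟨mdifferentiableAt_const, by rw [scalarDeriv_const, zero_apply]⟩
    | insert i t hi ih =>
      obtain ⟨h1, h2⟩ := ih fun j hj => hf j (Finset.mem_insert_of_mem hj)
      have h3 := hf i (Finset.mem_insert_self i t)
      simp only [Finset.sum_insert hi]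
      exact ⟨h3.add h1, by rw [scalarDeriv_add h3 h1, add_apply, h2]⟩
  exact h.2

theorem scalarDeriv_sub_const {f : M → ℝ} {p : M} (hf : MDifferentiableAt 𝓘(ℝ, E) 𝓘(ℝ, ℝ) f p)
    (a : ℝ) : scalarDeriv E (fun y => f y - a) p = scalarDeriv E f p := by
  have h := (hf.hasMFDerivAt.sub (hasMFDerivAt_const a p)).mfderiv
  exact h.trans (sub_zero (scalarDeriv E f p))

end ScalarDeriv

variable [MetricSpace M] [ChartedSpace E M] [IsManifold 𝓘(ℝ, E) ∞ M]
  [RiemannianBundle (fun p : M => TangentSpace 𝓘(ℝ, E) p)]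
  [IsContinuousRiemannianBundle E (fun p : M => TangentSpace 𝓘(ℝ, E) p)]
  [IsRiemannianManifold 𝓘(ℝ, E) M]

/-- A compactly supported Lipschitz function can be approximated uniformly by smooth functions,
with a control of the gradient that does not depend on the dimension. -/
theorem exists_smooth_approx [ProperSpace M] {h : M → ℝ} {L : ℝ≥0} (hL : LipschitzWith L h)
    (hc : HasCompactSupport h) {ε : ℝ} (hε : 0 < ε) :
    ∃ k : M → ℝ, ContMDiff 𝓘(ℝ, E) 𝓘(ℝ, ℝ) ∞ k ∧ (∀ y, |k y - h y| ≤ ε) ∧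
      ∀ y, ‖grad (E := E) k y‖ ≤ 2 * L + ε := by
  choose W hWo hxW hW1 hWk using exists_local_smooth_approx (E := E) hL
  obtain ⟨t, ht⟩ := hc.elim_finite_subcover W hWo fun x _ => mem_iUnion.2 ⟨x, hxW x⟩
  obtain ⟨φ, hφ⟩ := SmoothPartitionOfUnity.exists_isSubordinate 𝓘(ℝ, E) (isClosed_tsupport h)
    (fun x : t => W x) (fun x => hWo x) (by simpa [iUnion_subtype] using ht)
  have hG : ∀ i : t, ∃ G, ∀ p, ‖grad (E := E) (φ i) p‖ ≤ G := fun i => by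
    refine exists_norm_grad_le ((φ i).contMDiff.of_le (by simp)) ?_
    exact (isCompact_closedBall (i : M) 1).of_isClosed_subset (isClosed_tsupport _)
      ((hφ i).trans ((hW1 i).trans ball_subset_closedBall))
  choose G hG using hG
  have hG0 : ∀ i, 0 ≤ G i := fun i => (norm_nonneg _).trans (hG i i)
  -- The local errors are small against the gradients of the partition functions, so that Σ (k i -
  -- h) dφ i contributes at most ε.
  set η := ε / (1 + ∑ i, G i) with hη
  have hsumG : 0 ≤ ∑ i, G i := Finset.sum_nonneg fun i _ => hG0 i
  have hη0 : 0 < η := by positivity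
  have hηε : η ≤ ε := div_le_self hε.le (by linarith)
  have hηG : ∑ i, η * G i ≤ ε := by
    rw [← Finset.mul_sum, hη, div_mul_eq_mul_div, div_le_iff₀ (by positivity)]
    nlinarith
  choose k hk hkW using fun i : t => hWk i η hη0
  have hφs : ∀ i y, y ∉ tsupport (φ i) → φ i y = 0 := fun i y hy =>
    image_eq_zero_of_notMem_tsupport hy
  have hφsum : ∀ y, ∑ i, φ i y ≤ 1 := fun y => by
    rw [← finsum_eq_sum_of_fintype]
    exact φ.sum_le_one y
  have hφone : ∀ y ∈ tsupport h, ∑ i, φ i y = 1 := fun y hy => by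
    rw [← finsum_eq_sum_of_fintype]
    exact φ.sum_eq_one hy
  have hsmooth : ∀ i, ContMDiff 𝓘(ℝ, E) 𝓘(ℝ, ℝ) ∞ fun y => φ i y * k i y := fun i =>
    φ.contMDiff_smul fun y hy => (hk i).contMDiffAt ((hWo i).mem_nhds (hφ i hy))
  have hmul : ∀ i y, |φ i y * (k i y - h y)| ≤ φ i y * η := fun i y => by
    by_cases hy : y ∈ tsupport (φ i)
    · rw [abs_mul, abs_of_nonneg (φ.nonneg i y)]
      exact mul_le_mul_of_nonneg_left (hkW i y (hφ i hy)).1 (φ.nonneg i y)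
    · simp [hφs i y hy]
  refine ⟨fun y => ∑ i, φ i y * k i y, contMDiff_finsetSum fun i _ => hsmooth i, fun y => ?_,
    fun y => norm_grad_le (by positivity) fun v => ?_⟩
  · have heq : ∑ i, φ i y * k i y - h y = ∑ i, φ i y * (k i y - h y) := by
      simp only [mul_sub, Finset.sum_sub_distrib]
      rw [← Finset.sum_mul]
      by_cases hy : y ∈ tsupport h
      · rw [hφone y hy, one_mul]
      · rw [image_eq_zero_of_notMem_tsupport hy, mul_zero]
    rw [heq]
    calc _ ≤ ∑ i, |φ i y * (k i y - h y)| := Finset.abs_sum_le_sum_abs _ _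
      _ ≤ ∑ i, φ i y * η := Finset.sum_le_sum fun i _ => hmul i y
      _ = (∑ i, φ i y) * η := (Finset.sum_mul _ _ _).symm
      _ ≤ 1 * η := by
          gcongr
          exact hφsum y
      _ ≤ ε := by rwa [one_mul]
  · have hφd : ∀ i, MDifferentiableAt 𝓘(ℝ, E) 𝓘(ℝ, ℝ) (φ i) y := fun i =>
      (φ i).contMDiff.mdifferentiable (by simp) y
    -- The derivative of Σ φ i · k i is Σ φ i dk i + Σ (k i - h) dφ i + h Σ dφ i. The last term
    -- vanishes because Σ φ i = 1 near every point where h ≠ 0.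
    have hzero : h y * ∑ i, scalarDeriv E (φ i) y v = 0 := by
      rcases eq_or_ne (h y) 0 with h0 | h0
      · rw [h0, zero_mul]
      have hev : (fun z => ∑ i, φ i z) =ᶠ[𝓝 y] fun _ => 1 := by
        filter_upwards [hL.continuous.continuousAt.eventually_ne h0] with z hz
        exact hφone z (subset_tsupport h hz)
      rw [← scalarDeriv_sum Finset.univ (fun i _ => hφd i), scalarDeriv_congr hev,
        scalarDeriv_const, zero_apply, mul_zero]
    have hT := tangentNorm_nonneg y v
    have hterm : ∀ i, |scalarDeriv E (fun z => φ i z * k i z) y v -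
        h y * scalarDeriv E (φ i) y v| ≤ φ i y * (2 * L * tangentNorm y v) +
          η * G i * tangentNorm y v := by
      intro i
      by_cases hy : y ∈ tsupport (φ i)
      · have hkd : MDifferentiableAt 𝓘(ℝ, E) 𝓘(ℝ, ℝ) (k i) y :=
          ((hk i).contMDiffAt ((hWo i).mem_nhds (hφ i hy))).mdifferentiableAt (by simp)
        rw [scalarDeriv_mul (hφd i) hkd, add_sub_assoc, ← sub_mul]
        refine (abs_add_le _ _).trans (add_le_add ?_ ?_)
        · rw [abs_mul, abs_of_nonneg (φ.nonneg i y)]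
          exact mul_le_mul_of_nonneg_left ((hkW i y (hφ i hy)).2 v) (φ.nonneg i y)
        · rw [abs_mul, mul_assoc]
          refine mul_le_mul (hkW i y (hφ i hy)).1 ?_ (abs_nonneg _) hη0.le
          exact (abs_scalarDeriv_le _ y v).trans (mul_le_mul_of_nonneg_right (hG i y) hT)
      · have e1 : (φ i : M → ℝ) =ᶠ[𝓝 y] fun _ => 0 := notMem_tsupport_iff_eventuallyEq.1 hy
        have e2 : (fun z => φ i z * k i z) =ᶠ[𝓝 y] fun _ => 0 := by
          filter_upwards [e1] with z hz
          rw [hz, zero_mul]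
        rw [scalarDeriv_congr e1, scalarDeriv_congr e2, scalarDeriv_const]
        simp only [zero_apply, mul_zero, sub_zero, abs_zero]
        have := φ.nonneg i y
        have := hG0 i
        positivity
    have heq : scalarDeriv E (fun y => ∑ i, φ i y * k i y) y v =
        ∑ i, (scalarDeriv E (fun z => φ i z * k i z) y v - h y * scalarDeriv E (φ i) y v) := by
      rw [scalarDeriv_sum Finset.univ (fun i _ => (hsmooth i).mdifferentiable (by simp) y),
        Finset.sum_sub_distrib, ← Finset.mul_sum, hzero, sub_zero]
    rw [heq]
    calc _ ≤ ∑ i, |scalarDeriv E (fun z => φ i z * k i z) y v - h y * scalarDeriv E (φ i) y v| :=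
          Finset.abs_sum_le_sum_abs _ _
      _ ≤ ∑ i, (φ i y * (2 * L * tangentNorm y v) + η * G i * tangentNorm y v) :=
          Finset.sum_le_sum fun i _ => hterm i
      _ = (∑ i, φ i y) * (2 * L * tangentNorm y v) + (∑ i, η * G i) * tangentNorm y v := by
          rw [Finset.sum_add_distrib, Finset.sum_mul, Finset.sum_mul]
      _ ≤ 1 * (2 * L * tangentNorm y v) + ε * tangentNorm y v := by
          gcongr
          exact hφsum y
      _ = _ := by ring

/-- The function factors through the projection onto [0, 1], so compactness suffices. The constant S
is absolute. -/
theorem exists_lipschitzWith_smoothTransition : ∃ S : ℝ≥0, LipschitzWith S Real.smoothTransition := by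
  have h1 : LocallyLipschitz Real.smoothTransition :=
    (Real.smoothTransition.contDiff (n := 1)).locallyLipschitz
  obtain ⟨S, hS⟩ := (h1.locallyLipschitzOn (s := Icc 0 1)).exists_lipschitzOnWith_of_compact
    isCompact_Icc
  refine ⟨S, fun x y => ?_⟩
  have h2 := hS (projIcc (0 : ℝ) 1 zero_le_one x).2 (projIcc (0 : ℝ) 1 zero_le_one y).2
  rw [Real.smoothTransition.projIcc, Real.smoothTransition.projIcc] at h2
  refine h2.trans ?_
  gcongr
  exact (LipschitzWith.projIcc (zero_le_one' ℝ) x y).trans_eq (by simp)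

/-- Smooth bump functions adapted to balls, with dimension-free Lipschitz constants. -/
theorem exists_smooth_bump {S : ℝ≥0} (hS : LipschitzWith S Real.smoothTransition) [ProperSpace M]
    (x : M) {r : ℝ} (hr : 0 < r) :
    ∃ ψ : M → ℝ, ContMDiff 𝓘(ℝ, E) 𝓘(ℝ, ℝ) ∞ ψ ∧ (∀ y, 0 ≤ ψ y) ∧ (∀ y, ψ y ≤ 1) ∧
      (∀ y ∈ closedBall x (r / 2), ψ y = 1) ∧ tsupport ψ ⊆ ball x r ∧
      ∀ y z, |ψ y - ψ z| ≤ 24 * S / r * dist y z := by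
  -- A tent function, 1/r-Lipschitz in any dimension. Its approximation k, with error at most 1/16
  -- and 1/r, is at least 7/16 on the half ball, exceeds 1/4 only within 13r/16 of x, and has
  -- gradient at most 2/r + 1/r. Cutting between the levels 1/4 and 3/8 with slope 8 gives the
  -- constant 8 · 3 = 24.
  set h : M → ℝ := fun y => max (1 - dist y x / r) 0 with hh
  have hL : LipschitzWith (1 / r).toNNReal h := by
    refine LipschitzWith.of_dist_le_mul fun y z => ?_
    rw [Real.coe_toNNReal _ (by positivity), Real.dist_eq]
    refine (abs_max_sub_max_le_abs _ _ _).trans ?_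
    rw [sub_sub_sub_cancel_left, ← sub_div, abs_div, abs_of_pos hr, one_div_mul_eq_div,
      dist_comm y z]
    gcongr
    exact abs_dist_sub_le z y x
  have hc : HasCompactSupport h := by
    refine HasCompactSupport.intro (isCompact_closedBall x r) fun y hy => ?_
    rw [mem_closedBall, not_le, ← one_lt_div hr] at hy
    exact max_eq_right (by linarith)
  have hε : 0 < min (1 / 16) (1 / r) := by positivity
  obtain ⟨k, hk, hkh, hkg⟩ := exists_smooth_approx (E := E) hL hc hε
  have hkL : LipschitzWith (3 / r).toNNReal k := by
    refine lipschitzWith_of_norm_grad_le (E := E) (hk.of_le (by simp)) fun p => (hkg p).trans ?_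
    rw [Real.coe_toNNReal _ (by positivity), Real.coe_toNNReal _ (by positivity)]
    have := min_le_right (1 / 16) (1 / r)
    calc _ ≤ 2 * (1 / r) + 1 / r := by linarith
      _ = _ := by ring
  have hk16 : ∀ y, |k y - h y| ≤ 1 / 16 := fun y => (hkh y).trans (min_le_left _ _)
  have hbig : ∀ y, 1 / 4 < k y → y ∈ closedBall x (13 / 16 * r) := by
    intro y hy
    have h1 := (abs_le.1 (hk16 y)).2
    have h2 : 3 / 16 < h y := by linarith
    have h3 : 3 / 16 < 1 - dist y x / r := by
      rcases lt_max_iff.1 h2 with h3 | h3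
      · exact h3
      · norm_num at h3
    rw [mem_closedBall, ← div_le_iff₀ hr]
    linarith
  refine ⟨fun y => Real.smoothTransition (8 * (k y - 1 / 4)), ?_,
    fun y => Real.smoothTransition.nonneg _, fun y => Real.smoothTransition.le_one _, fun y hy => ?_,
    ?_, fun y z => ?_⟩
  · have : ContDiff ℝ ∞ fun t => Real.smoothTransition (8 * (t - 1 / 4)) :=
      Real.smoothTransition.contDiff.comp (by fun_prop)
    exact (contMDiff_iff_contDiff.2 this).comp hk
  · refine Real.smoothTransition.one_of_one_le ?_
    have h1 := (abs_le.1 (hk16 y)).1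
    have h2 : 1 - dist y x / r ≤ h y := le_max_left _ _
    have h3 : dist y x / r ≤ 1 / 2 := by
      rw [div_le_iff₀ hr]
      linarith [mem_closedBall.1 hy]
    linarith
  · refine (closure_minimal ?_ isClosed_closedBall).trans
      (closedBall_subset_ball (show 13 / 16 * r < r by linarith))
    intro y hy
    refine hbig y ?_
    by_contra! hle
    exact hy (Real.smoothTransition.zero_of_nonpos (by linarith))
  · have h1 := hS.dist_le_mul (8 * (k y - 1 / 4)) (8 * (k z - 1 / 4))
    have h2 := hkL.dist_le_mul y z
    rw [Real.dist_eq, Real.dist_eq] at h1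
    rw [Real.coe_toNNReal _ (by positivity), Real.dist_eq] at h2
    rw [show 8 * (k y - 1 / 4) - 8 * (k z - 1 / 4) = 8 * (k y - k z) by ring, abs_mul] at h1
    refine h1.trans ?_
    calc (S : ℝ) * (|8| * |k y - k z|) ≤ S * (8 * (3 / r * dist y z)) := by
          rw [abs_of_pos (by norm_num : (0 : ℝ) < 8)]
          gcongr
      _ = _ := by ring

end Smoothing

/-! ### A ball of positive finite Riemannian measure -/

section ChartVolume

variable {E : Type*} [NormedAddCommGroup E] [InnerProductSpace ℝ E] [FiniteDimensional ℝ E]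
  {M : Type*} [TopologicalSpace M] [ChartedSpace E M] [IsManifold 𝓘(ℝ, E) 1 M]
  [RiemannianBundle (fun p : M => TangentSpace 𝓘(ℝ, E) p)]

theorem metricMatrix_apply (x : M) (y : E) (a b : Fin (Module.finrank ℝ E)) :
    metricMatrix x y a b = tangentInner ((extChartAt 𝓘(ℝ, E) x).symm y)
      (chartSymmDeriv x y (stdOrthonormalBasis ℝ E a))
      (chartSymmDeriv x y (stdOrthonormalBasis ℝ E b)) := rfl

/-- At the center of the chart the matrix is the Gram matrix of a basis. -/
theorem det_metricMatrix_self_pos (x : M) :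
    0 < (metricMatrix x (extChartAt 𝓘(ℝ, E) x x)).det := by
  have e : metricMatrix x (extChartAt 𝓘(ℝ, E) x x) =
      Matrix.gram ℝ (fun a => (show TangentSpace 𝓘(ℝ, E) x from stdOrthonormalBasis ℝ E a)) := by
    ext a b
    rw [metricMatrix_apply, chartSymmDeriv_self, chartSymmDeriv_self, extChartAt_to_inv]
    rfl
  rw [e]
  refine Matrix.PosDef.det_pos (Matrix.posDef_gram_of_linearIndependent ?_)
  exact (stdOrthonormalBasis ℝ E).toBasis.linearIndependent

variable [IsContinuousRiemannianBundle E (fun p : M => TangentSpace 𝓘(ℝ, E) p)]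

/-- Continuity of norms is enough for the metric coefficients, which are recovered by polarization.
-/
theorem continuousAt_tangentNorm_chartSymmDeriv (x : M) (v : E) :
    ContinuousAt (fun e => tangentNorm ((extChartAt 𝓘(ℝ, E) x).symm e) (chartSymmDeriv x e v))
      (extChartAt 𝓘(ℝ, E) x x) := by
  rw [Metric.continuousAt_iff']
  intro ε hε
  have hT := tangentNorm_nonneg x v
  have hr : 1 < 1 + ε / (2 * (tangentNorm x v + 1)) := by
    have : 0 < ε / (2 * (tangentNorm x v + 1)) := by positivity
    linarith
  have hc : Filter.Tendsto (extChartAt 𝓘(ℝ, E) x).symm (𝓝 (extChartAt 𝓘(ℝ, E) x x)) (𝓝 x) := by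
    have := continuousAt_extChartAt_symm (I := 𝓘(ℝ, E)) x
    rwa [ContinuousAt, extChartAt_to_inv] at this
  filter_upwards [hc.eventually (eventually_tangentNorm_chartDeriv_le (E := E) x hr),
    hc.eventually (eventually_tangentNorm_chartSymmDeriv_le (E := E) x hr),
    (isOpen_extChartAt_target (I := 𝓘(ℝ, E)) x).mem_nhds (mem_extChartAt_target x)]
    with e h1 h2 he
  have h1 := h1 (chartSymmDeriv x e v)
  have h2 := h2 v
  rw [(extChartAt 𝓘(ℝ, E) x).right_inv he] at h2
  rw [chartDeriv_chartSymmDeriv he] at h1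
  rw [chartSymmDeriv_self, extChartAt_to_inv, Real.dist_eq]
  set T := tangentNorm x v
  set T' := tangentNorm ((extChartAt 𝓘(ℝ, E) x).symm e) (chartSymmDeriv x e v)
  set s := ε / (2 * (T + 1)) with hs
  have hs0 : 0 < s := by positivity
  have hsT : s * (T + 1) = ε / 2 := by
    rw [hs]
    field_simp
  have hT' : 0 ≤ T' := tangentNorm_nonneg _ _
  rw [abs_lt]
  constructor
  · by_contra! hle
    have : T' ≤ T := by linarith
    nlinarith
  · nlinarith

theorem continuousAt_det_metricMatrix (x : M) :
    ContinuousAt (fun e => (metricMatrix x e).det) (extChartAt 𝓘(ℝ, E) x x) := by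
  have h : ContinuousAt (fun e => metricMatrix x e) (extChartAt 𝓘(ℝ, E) x x) := by
    refine continuousAt_pi.2 fun a => continuousAt_pi.2 fun b => ?_
    simp only [metricMatrix_apply, tangentInner_eq, ← map_add]
    have h1 := continuousAt_tangentNorm_chartSymmDeriv x (stdOrthonormalBasis ℝ E a)
    have h2 := continuousAt_tangentNorm_chartSymmDeriv x (stdOrthonormalBasis ℝ E b)
    have h3 := continuousAt_tangentNorm_chartSymmDeriv x
      (stdOrthonormalBasis ℝ E a + stdOrthonormalBasis ℝ E b)
    exact (((h3.mul h3).sub (h1.mul h1)).sub (h2.mul h2)).div_const 2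
  exact (continuous_id.matrix_det.continuousAt).comp h

variable [MeasurableSpace E] [BorelSpace E] [MeasurableSpace M] [BorelSpace M]

theorem chartVolume_apply (x : M) {s : Set M} (hs : IsOpen s) :
    chartVolume (E := E) x s =
      ∫⁻ y in (extChartAt 𝓘(ℝ, E) x).target ∩ (extChartAt 𝓘(ℝ, E) x).symm ⁻¹' s,
        ENNReal.ofReal (Real.sqrt (metricMatrix x y).det) := by
  have hT : MeasurableSet (extChartAt 𝓘(ℝ, E) x).target :=
    (isOpen_extChartAt_target (I := 𝓘(ℝ, E)) x).measurableSet
  have hm := ((continuousOn_extChartAt_symm (I := 𝓘(ℝ, E)) x).aemeasurable (μ := volume) hT)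
  rw [chartVolume, Measure.map_apply_of_aemeasurable
    (hm.mono_ac (withDensity_absolutelyContinuous _ _)) hs.measurableSet, withDensity_apply',
    Measure.restrict_restrict' hT, inter_comm]

/-- Near the center the density lies between √(d/2) and √(2d), where d > 0 is the determinant at the
center. -/
theorem exists_chartVolume_ne_zero_ne_top (x : M) : ∃ V ∈ 𝓝 x, ∀ s ⊆ V, IsOpen s → x ∈ s →
    chartVolume (E := E) x s ≠ 0 ∧ chartVolume (E := E) x s ≠ ⊤ := by
  set φ := extChartAt 𝓘(ℝ, E) x with hφ
  set d := (metricMatrix x (φ x)).det with hd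
  have hd0 : 0 < d := det_metricMatrix_self_pos x
  have hev : ∀ᶠ e in 𝓝 (φ x), (metricMatrix x e).det ∈ Ioo (d / 2) (2 * d) :=
    (continuousAt_det_metricMatrix x).eventually_mem
      (Ioo_mem_nhds (by linarith) (by linarith))
  obtain ⟨ρ, hρ, hball⟩ := Metric.eventually_nhds_iff_ball.1 hev
  have hTo : IsOpen φ.target := isOpen_extChartAt_target (I := 𝓘(ℝ, E)) x
  refine ⟨φ.source ∩ φ ⁻¹' ball (φ x) ρ, Filter.inter_mem (extChartAt_source_mem_nhds x)
    ((continuousAt_extChartAt x).preimage_mem_nhds (ball_mem_nhds _ hρ)), fun s hsV hs hxs => ?_⟩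
  rw [chartVolume_apply x hs]
  set U := φ.target ∩ φ.symm ⁻¹' s with hU
  have hUo : IsOpen U := (continuousOn_extChartAt_symm x).isOpen_inter_preimage hTo hs
  have hUb : U ⊆ ball (φ x) ρ := fun y hy => by
    have := (hsV hy.2).2
    rwa [mem_preimage, φ.right_inv hy.1] at this
  have hxU : φ x ∈ U := ⟨mem_extChartAt_target x, by rwa [mem_preimage, extChartAt_to_inv]⟩
  constructor
  · have h1 : ∫⁻ y in U, ENNReal.ofReal (Real.sqrt (d / 2)) ≤
        ∫⁻ y in U, ENNReal.ofReal (Real.sqrt (metricMatrix x y).det) :=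
      setLIntegral_mono' hUo.measurableSet fun y hy =>
        ENNReal.ofReal_le_ofReal (Real.sqrt_le_sqrt (hball y (hUb hy)).1.le)
    rw [setLIntegral_const] at h1
    refine (lt_of_lt_of_le (ENNReal.mul_pos ?_ (hUo.measure_pos volume ⟨_, hxU⟩).ne') h1).ne'
    exact (ENNReal.ofReal_pos.2 (Real.sqrt_pos.2 (by linarith))).ne'
  · have h1 : ∫⁻ y in U, ENNReal.ofReal (Real.sqrt (metricMatrix x y).det) ≤
        ∫⁻ y in U, ENNReal.ofReal (Real.sqrt (2 * d)) :=
      setLIntegral_mono' hUo.measurableSet fun y hy =>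
        ENNReal.ofReal_le_ofReal (Real.sqrt_le_sqrt (hball y (hUb hy)).2.le)
    rw [setLIntegral_const] at h1
    refine (lt_of_le_of_lt h1 (ENNReal.mul_lt_top ENNReal.ofReal_lt_top ?_)).ne
    exact (measure_mono hUb).trans_lt measure_ball_lt_top

variable [SecondCountableTopology M] [Nonempty M]

/-- At the center of chart 0 the first disjoint piece is the whole chart domain, so a single chart
measure matters and no change of variables is needed. -/
theorem exists_riemannianVolume_ne_zero_ne_top : ∃ x : M, ∃ V ∈ 𝓝 x, ∀ s ⊆ V, IsOpen s → x ∈ s →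
    riemannianVolume E M s ≠ 0 ∧ riemannianVolume E M s ≠ ⊤ := by
  set c := (exists_chart_cover E M).choose with hc
  obtain ⟨V, hV, h⟩ := exists_chartVolume_ne_zero_ne_top (E := E) (c 0)
  refine ⟨c 0, V ∩ (extChartAt 𝓘(ℝ, E) (c 0)).source,
    Filter.inter_mem hV (extChartAt_source_mem_nhds _), fun s hsV hs hx => ?_⟩
  have e : riemannianVolume E M s = chartVolume (E := E) (c 0) s := by
    rw [riemannianVolume, Measure.sum_apply _ hs.measurableSet, tsum_eq_single 0]
    · rw [Measure.restrict_apply hs.measurableSet, disjointed_zero,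
        inter_eq_left.2 (hsV.trans inter_subset_right)]
    · intro i hi
      rw [Measure.restrict_apply hs.measurableSet]
      refine measure_mono_null (t := ∅) ?_ measure_empty
      rintro p ⟨hp, hpi⟩
      have hdis := disjoint_disjointed
        (fun j => (extChartAt 𝓘(ℝ, E) (c j)).source) hi
      refine disjoint_left.1 hdis hpi ?_
      rw [disjointed_zero]
      exact (hsV hp).2
  rw [e]
  exact h s (hsV.trans inter_subset_left) hs hx

end ChartVolume

/-! ### The bad parts -/

section BadPart

/-- Outside `F` and on `F` alike, `f` minus its Whitney extension is the sum of the bad parts. -/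
theorem IsBumpFamily.hasSum_sub_whitneyExtension {X : Type*} [MetricSpace X] {F : Set X}
    {s : Set ℕ} {c : ℕ → X} {ψ : ℕ → X → ℝ} {L : ℝ} {N : ℕ} (h : IsBumpFamily F s c ψ L)
    (hW : IsWhitney F s c)
    (hN : ∀ x, {n ∈ s | x ∈ ball (c n) (infDist (c n) F / 10)}.encard ≤ N) (f : X → ℝ) (a : ℕ → ℝ)
    (x : X) :
    HasSum (fun n : s => (f x - a n) * bumpPartition ψ n x) (f x - whitneyExtension F f ψ a x) := by
  obtain ⟨T, -, hT⟩ := exists_finset_of_encard_le (hN x)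
  have hzero : ∀ n ∉ T, bumpPartition ψ n x = 0 := by
    intro n hn
    by_contra hne
    exact hn ((hT n).2 (h.partition_mem n x hne))
  have hsum : f x - whitneyExtension F f ψ a x = ∑ n ∈ T, (f x - a n) * bumpPartition ψ n x := by
    by_cases hx : x ∈ F
    · rw [whitneyExtension, if_pos hx, sub_self, eq_comm]
      refine Finset.sum_eq_zero fun n hn => ?_
      exact absurd hx (IsWhitney.notMem_of_mem_ball ((hT n).1 hn).2)
    · have hT' : ∀ n ∈ s, x ∈ ball (c n) (infDist (c n) F / 10) → n ∈ T :=
        fun n hn hxn => (hT n).2 ⟨hn, hxn⟩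
      rw [h.whitneyExtension_eq_sum hx hT']
      simp_rw [sub_mul]
      rw [Finset.sum_sub_distrib, ← Finset.mul_sum, h.sum_partition hW hx hT', mul_one]
  rw [hsum]
  refine (hasSum_subtype_iff_of_support_subset (f := fun n => (f x - a n) * bumpPartition ψ n x)
    fun n hn => ?_).2 (hasSum_sum_of_ne_finset_zero fun n hn => ?_)
  · exact (h.partition_mem n x (right_ne_zero_of_mul hn)).1
  · rw [hzero n hn, mul_zero]

variable {E : Type*} [NormedAddCommGroup E] [InnerProductSpace ℝ E] [FiniteDimensional ℝ E]
  {M : Type*} [MetricSpace M] [ChartedSpace E M] [IsManifold 𝓘(ℝ, E) ∞ M]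
  [RiemannianBundle (fun p : M => TangentSpace 𝓘(ℝ, E) p)]
  [IsContinuousRiemannianBundle E (fun p : M => TangentSpace 𝓘(ℝ, E) p)]
  [IsRiemannianManifold 𝓘(ℝ, E) M]

/-- With r = δ/10 the Lipschitz constant 24 S / r becomes 240 S / δ. Indices outside s receive the
zero function. -/
theorem IsWhitney.exists_isBumpFamily [ProperSpace M] {S : ℝ≥0}
    (hS : LipschitzWith S Real.smoothTransition) {F : Set M} {s : Set ℕ} {c : ℕ → M}
    (hW : IsWhitney F s c) (hF : IsClosed F) (hne : F.Nonempty) :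
    ∃ ψ : ℕ → M → ℝ, IsBumpFamily F s c ψ (240 * S) ∧
      (∀ n, ContMDiff 𝓘(ℝ, E) 𝓘(ℝ, ℝ) ∞ (ψ n)) ∧
      ∀ n ∈ s, tsupport (ψ n) ⊆ ball (c n) (infDist (c n) F / 10) := by
  have h : ∀ n, ∃ ψ : M → ℝ, ContMDiff 𝓘(ℝ, E) 𝓘(ℝ, ℝ) ∞ ψ ∧ (∀ y, 0 ≤ ψ y) ∧ (∀ y, ψ y ≤ 1) ∧
      (n ∈ s → (∀ y ∈ closedBall (c n) (infDist (c n) F / 20), ψ y = 1) ∧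
        tsupport ψ ⊆ ball (c n) (infDist (c n) F / 10) ∧
        ∀ y z, |ψ y - ψ z| ≤ 240 * S / infDist (c n) F * dist y z) ∧ (n ∉ s → ψ = 0) := by
    intro n
    by_cases hn : n ∈ s
    · have hδ := hW.infDist_pos hF hne hn
      obtain ⟨ψ, h1, h2, h3, h4, h5, h6⟩ := exists_smooth_bump (E := E) hS (c n)
        (show 0 < infDist (c n) F / 10 by positivity)
      refine ⟨ψ, h1, h2, h3, fun _ => ⟨fun y hy => h4 y ?_, h5, fun y z => (h6 y z).trans_eq ?_⟩,
        fun hn' => absurd hn hn'⟩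
      · rwa [div_div, show (10 : ℝ) * 2 = 20 by norm_num]
      · field_simp
        ring
    · exact ⟨0, contMDiff_const, fun _ => le_rfl, fun _ => zero_le_one, fun hn' => absurd hn' hn,
        fun _ => rfl⟩
  choose ψ h1 h2 h3 h4 h5 using h
  refine ⟨ψ, ⟨h2, h3, fun n x hx => ?_, fun n hn => (h4 n hn).1, fun n hn => (h4 n hn).2.2⟩, h1,
    fun n hn => (h4 n hn).2.1⟩
  have hn : n ∈ s := by
    by_contra hn
    exact hx (by rw [h5 n hn, Pi.zero_apply])
  exact ⟨hn, (h4 n hn).2.1 (subset_tsupport _ hx)⟩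

theorem contMDiff_bumpPartition {ψ : ℕ → M → ℝ} (h : ∀ n, ContMDiff 𝓘(ℝ, E) 𝓘(ℝ, ℝ) ∞ (ψ n))
    (n : ℕ) : ContMDiff 𝓘(ℝ, E) 𝓘(ℝ, ℝ) ∞ (bumpPartition ψ n) :=
  (h n).mul (contMDiff_finsetProd fun j _ => contMDiff_const.sub (h j))

theorem norm_grad_sub_const_mul_le {f χ : M → ℝ} {p : M} (a : ℝ) {K : ℝ}
    (hf : MDifferentiableAt 𝓘(ℝ, E) 𝓘(ℝ, ℝ) f p) (hχ : MDifferentiableAt 𝓘(ℝ, E) 𝓘(ℝ, ℝ) χ p)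
    (h0 : 0 ≤ χ p) (h1 : χ p ≤ 1) (hK : ‖grad (E := E) χ p‖ ≤ K) :
    ‖grad (E := E) (fun y => (f y - a) * χ y) p‖ ≤ ‖grad (E := E) f p‖ + K * |f p - a| := by
  have hK0 : 0 ≤ K := (norm_nonneg _).trans hK
  refine norm_grad_le (by positivity) fun v => ?_
  have hfa : MDifferentiableAt 𝓘(ℝ, E) 𝓘(ℝ, ℝ) (fun y => f y - a) p :=
    hf.sub mdifferentiableAt_const
  rw [scalarDeriv_mul hfa hχ, scalarDeriv_sub_const hf]
  have h2 := abs_scalarDeriv_le (E := E) f p v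
  have h3 := abs_scalarDeriv_le (E := E) χ p v
  have hv := tangentNorm_nonneg p v
  refine (abs_add_le _ _).trans ?_
  rw [abs_mul, abs_mul, abs_of_nonneg h0, add_comm, add_mul]
  refine add_le_add ?_ ?_
  · calc χ p * |scalarDeriv E f p v| ≤ 1 * (‖grad (E := E) f p‖ * tangentNorm p v) := by gcongr
      _ = _ := one_mul _
  · calc |f p - a| * |scalarDeriv E χ p v| ≤ |f p - a| * (K * tangentNorm p v) := by
          gcongr
          exact h3.trans (by gcongr)
      _ = _ := by ring

variable [MeasurableSpace M] [BorelSpace M]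

/-- The constant in the gradient estimate of the bad parts. -/
noncomputable def badConst (q : ℝ) (D P K : ℝ≥0) : ℝ≥0 := 2 ^ (q - 1) * ((1 + K ^ q * P) * D ^ 6)

/-- Product rule and (a + b)^q ≤ 2^(q-1) (a^q + b^q). The factor 1/r of the cutoff cancels the r of
Poincaré, and the remaining integral of |∇f|^q is controlled through the nearby point z. -/
theorem lintegral_grad_sub_const_mul_le {μ : Measure M} {q : ℝ} (hq : 1 ≤ q) {D P K : ℝ≥0}
    (hD : Doubling μ D) {f χ : M → ℝ} (hf : ContMDiff 𝓘(ℝ, E) 𝓘(ℝ, ℝ) 1 f)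
    (hP : HasPoincare μ q P f fun p => ‖grad (E := E) f p‖ₑ ^ q)
    (hχ : ContMDiff 𝓘(ℝ, E) 𝓘(ℝ, ℝ) 1 χ) (h0 : ∀ p, 0 ≤ χ p) (h1 : ∀ p, χ p ≤ 1) {t : ℝ≥0∞}
    {z : M} (hz : z ∉ maximalSet μ (fun p => ‖grad (E := E) f p‖ₑ ^ q) t) {x : M} {r : ℝ}
    (hr : 0 < r) (hxz : dist x z ≤ 20 * r)
    (hlip : ∀ p p', |χ p - χ p'| ≤ K / r * dist p p') :
    ∫⁻ p in ball x r, ‖grad (E := E)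
        (fun y => (f y - ⨍ u in ball x r, f u ∂μ) * χ y) p‖ₑ ^ q ∂μ ≤
      badConst q D P K * t * μ (ball x r) := by
  have hq0 : 0 ≤ q := by linarith
  set a := ⨍ u in ball x r, f u ∂μ with ha
  set X := ∫⁻ p in ball x r, ‖grad (E := E) f p‖ₑ ^ q ∂μ with hX
  have hKr : 0 ≤ K / r := by positivity
  have hχL : LipschitzWith (K / r).toNNReal χ := by
    refine LipschitzWith.of_dist_le_mul fun p p' => ?_
    rw [Real.coe_toNNReal _ hKr]
    exact hlip p p'
  have hpt : ∀ p, ‖grad (E := E) (fun y => (f y - a) * χ y) p‖ₑ ^ q ≤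
      2 ^ (q - 1) * (‖grad (E := E) f p‖ₑ ^ q +
        ENNReal.ofReal (K / r) ^ q * ‖f p - a‖ₑ ^ q) := by
    intro p
    rw [← ENNReal.mul_rpow_of_nonneg _ _ hq0]
    refine le_trans (ENNReal.rpow_le_rpow ?_ hq0) (ENNReal.rpow_add_le_mul_rpow_add_rpow _ _ hq)
    have h2 := norm_grad_sub_const_mul_le (E := E) (p := p) a (hf.mdifferentiable (by simp) p)
      (hχ.mdifferentiable (by simp) p) (h0 p) (h1 p) (norm_grad_le_of_lipschitzWith hχL p)
    rw [Real.coe_toNNReal _ hKr] at h2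
    rw [← ofReal_norm, ← ofReal_norm, ← ofReal_norm, ← ENNReal.ofReal_mul hKr,
      ← ENNReal.ofReal_add (norm_nonneg _) (by positivity)]
    exact ENNReal.ofReal_le_ofReal h2
  have hmeas : Measurable fun p => ‖grad (E := E) f p‖ₑ ^ q := by
    have : (fun p => ‖grad (E := E) f p‖ₑ ^ q) =
        fun p => ENNReal.ofReal ‖grad (E := E) f p‖ ^ q := by
      ext p
      rw [ofReal_norm]
    rw [this]
    exact (continuous_norm_grad hf).measurable.ennreal_ofReal.pow_const q
  have hXt : X ≤ t * ((D : ℝ≥0∞) ^ 6 * μ (ball x r)) := lintegral_ball_le_of_dist_le hD hz hr hxz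
  have hKr' : ENNReal.ofReal (K / r) * ENNReal.ofReal r = K := by
    rw [← ENNReal.ofReal_mul hKr, div_mul_cancel₀ _ hr.ne', ENNReal.ofReal_coe_nnreal]
  have hc : (badConst q D P K : ℝ≥0∞) =
      2 ^ (q - 1) * ((1 + (K : ℝ≥0∞) ^ q * P) * (D : ℝ≥0∞) ^ 6) := by
    rw [badConst]
    push_cast
    rw [ENNReal.coe_rpow_of_ne_zero two_ne_zero, ENNReal.coe_rpow_of_nonneg _ hq0]
    rfl
  calc _ ≤ ∫⁻ p in ball x r, 2 ^ (q - 1) * (‖grad (E := E) f p‖ₑ ^ q +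
        ENNReal.ofReal (K / r) ^ q * ‖f p - a‖ₑ ^ q) ∂μ := lintegral_mono hpt
    _ = 2 ^ (q - 1) * (X + ENNReal.ofReal (K / r) ^ q * ∫⁻ p in ball x r, ‖f p - a‖ₑ ^ q ∂μ) := by
      rw [lintegral_const_mul' _ _ (by finiteness), lintegral_add_left hmeas,
        lintegral_const_mul' _ _ (by finiteness)]
    _ ≤ 2 ^ (q - 1) * (X + ENNReal.ofReal (K / r) ^ q * (P * ENNReal.ofReal r ^ q * X)) := by
      gcongr
      exact hP x r hr
    _ = 2 ^ (q - 1) * ((1 + (K : ℝ≥0∞) ^ q * P) * X) := by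
      rw [← hKr', ENNReal.mul_rpow_of_nonneg _ _ hq0]
      ring
    _ ≤ 2 ^ (q - 1) * ((1 + (K : ℝ≥0∞) ^ q * P) * (t * ((D : ℝ≥0∞) ^ 6 * μ (ball x r)))) := by
      gcongr
    _ = _ := by
      rw [hc]
      ring

end BadPart

/-! ### The decomposition -/

section Decomposition

/-- For a compactly supported weight `w`, the maximal set is relatively small: its measure is
controlled, its complement is nonempty, and the distance to the complement is bounded. -/
theorem Doubling.maximalSet_bounds {X : Type*} [MetricSpace X] [MeasurableSpace X] [BorelSpace X]
    [SecondCountableTopology X] {μ : Measure X} {D : ℝ≥0} {w : X → ℝ≥0∞} {t : ℝ≥0∞}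
    (hD : Doubling μ D) (htop : μ univ = ⊤) (ht : t ≠ 0) (ht' : t ≠ ⊤) (hw : ∫⁻ y, w y ∂μ ≠ ⊤)
    {x₀ : X} {R₀ : ℝ} (hsupp : ∀ y, y ∉ ball x₀ R₀ → w y = 0) :
    μ (maximalSet μ w t) ≤ (D : ℝ≥0∞) ^ 3 * t⁻¹ * ∫⁻ y, w y ∂μ ∧ (maximalSet μ w t)ᶜ.Nonempty ∧
      ∃ R, ∀ x ∈ maximalSet μ w t, infDist x (maximalSet μ w t)ᶜ ≤ R := by
  obtain ⟨R, hR⟩ := hD.exists_radius_bound htop ht ht' hw hsupp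
  have hΩ : μ (maximalSet μ w t) ≤ (D : ℝ≥0∞) ^ 3 * t⁻¹ * ∫⁻ y, w y ∂μ := by
    have h := hD.mul_measure_maximalSet_le fun c r hr h => (hR c r hr h).1
    calc μ (maximalSet μ w t) = t⁻¹ * (t * μ (maximalSet μ w t)) := by
          rw [← mul_assoc, ENNReal.inv_mul_cancel ht ht', one_mul]
      _ ≤ t⁻¹ * ((D : ℝ≥0∞) ^ 3 * ∫⁻ y, w y ∂μ) := by gcongr
      _ = _ := by ring
  have hne : (maximalSet μ w t)ᶜ.Nonempty := by
    rw [nonempty_compl]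
    intro hu
    rw [hu, htop, top_le_iff] at hΩ
    exact ENNReal.mul_ne_top (ENNReal.mul_ne_top (by finiteness) (ENNReal.inv_ne_top.2 ht)) hw hΩ
  refine ⟨hΩ, hne, ?_⟩
  obtain ⟨z, hz⟩ := hne
  refine ⟨R₀ + 2 * R + dist x₀ z, fun x hx => (infDist_le_dist_of_mem hz).trans ?_⟩
  obtain ⟨c, r, hr, hxc, hlt⟩ := hx
  obtain ⟨h1, h2⟩ := hR c r hr hlt
  have h3 := dist_triangle4 x c x₀ z
  have h4 := mem_ball.1 hxc
  linarith

variable {E : Type*} [NormedAddCommGroup E] [InnerProductSpace ℝ E] [FiniteDimensional ℝ E]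
  [MeasurableSpace E] [BorelSpace E]
  {M : Type*} [MetricSpace M] [ChartedSpace E M] [IsManifold 𝓘(ℝ, E) ∞ M]
  [RiemannianBundle (fun p : M => TangentSpace 𝓘(ℝ, E) p)]
  [IsContinuousRiemannianBundle E (fun p : M => TangentSpace 𝓘(ℝ, E) p)]
  [IsRiemannianManifold 𝓘(ℝ, E) M] [MeasurableSpace M] [BorelSpace M]

/-- A compactly supported C¹ function is Lipschitz, so its pointwise gradient is an admissible weak
gradient. -/
theorem Poincare.hasPoincare {μ : Measure M} [IsLocallyFiniteMeasure μ] {q : ℝ} (hq : 0 ≤ q)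
    {P : ℝ≥0} (hP : Poincare E μ q P) {f : M → ℝ} (hf : ContMDiff 𝓘(ℝ, E) 𝓘(ℝ, ℝ) 1 f)
    (hf' : HasCompactSupport f) : HasPoincare μ q P f fun p => ‖grad (E := E) f p‖ₑ ^ q := by
  obtain ⟨L, hL⟩ := exists_norm_grad_le (E := E) hf hf'
  have hlip : LipschitzWith L.toNNReal f :=
    lipschitzWith_of_norm_grad_le (E := E) hf fun p => (hL p).trans (Real.le_coe_toNNReal L)
  exact fun x r hr => hP f (grad f) (isWeakGrad_grad_of_lipschitzWith hlip)
    (hf.continuous.abs.rpow_const fun _ => Or.inr hq).locallyIntegrable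
    ((continuous_norm_grad hf).rpow_const fun _ => Or.inr hq).locallyIntegrable x r hr

/-- The Lipschitz constant of the good part, for `α = 1`. -/
noncomputable def goodConst (q : ℝ) (D P S : ℝ≥0) (N : ℕ) : ℝ :=
  192 * oscConst q D P * (45 + 2 * N * (40 * ((4 * N + 1) * (240 * S))))

theorem goodConst_nonneg (q : ℝ) (D P S : ℝ≥0) (N : ℕ) : 0 ≤ goodConst q D P S N := by
  have := oscConst_nonneg (q := q) (D := D) (P := P)
  rw [goodConst]
  positivity

theorem exists_calderonZygmund_decomposition [SecondCountableTopology M] [Nonempty M]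
    [CompleteSpace M] [NoncompactSpace M] {S : ℝ≥0} (hS : LipschitzWith S Real.smoothTransition)
    {q : ℝ} (hq : 1 ≤ q) {D P : ℝ≥0} {N : ℕ} (hN : D ^ 7 ≤ N) {μ : Measure M}
    (hD : Doubling μ D) (hpos : ∀ (x : M) (r : ℝ), 0 < r → 0 < μ (ball x r))
    (hfin : ∀ (x : M) (r : ℝ), μ (ball x r) < ⊤) (hP : Poincare E μ q P) {f : M → ℝ}
    (hf : ContMDiff 𝓘(ℝ, E) 𝓘(ℝ, ℝ) ∞ f) (hf' : HasCompactSupport f)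
    (hfq : (∫⁻ p, ‖grad (E := E) f p‖ₑ ^ q ∂μ) < ⊤) {α : ℝ} (hα : 0 < α) :
    ∃ (ι : Type) (_ : Countable ι) (c : ι → M) (r : ι → ℝ) (b : ι → M → ℝ) (g : M → ℝ),
      (∀ i, 0 < r i) ∧
      (∀ i, ContMDiff 𝓘(ℝ, E) 𝓘(ℝ, ℝ) ∞ (b i)) ∧
      (∀ p p', |g p - g p'| ≤ goodConst q D P S N * α * dist p p') ∧
      (∀ p, HasSum (fun i => b i p) (f p - g p)) ∧
      (∀ i, tsupport (b i) ⊆ ball (c i) (r i)) ∧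
      (∀ i, (∫⁻ p in ball (c i) (r i), ‖grad (E := E) (b i) p‖ₑ ^ q ∂μ) ≤
        badConst q D P ((4 * N + 1) * (24 * S)) * ENNReal.ofReal α ^ q * μ (ball (c i) (r i))) ∧
      ((∑' i, μ (ball (c i) (r i))) ≤
        (D ^ 7 : ℝ≥0) * ENNReal.ofReal α ^ (-q) * (∫⁻ p, ‖grad (E := E) f p‖ₑ ^ q ∂μ)) ∧
      (∀ p : M, {i | p ∈ ball (c i) (r i)}.encard ≤ N) := by
  have hq0 : 0 < q := by linarith
  have : IsLocallyFiniteMeasure μ := ⟨fun x => ⟨ball x 1, ball_mem_nhds x one_pos, hfin x 1⟩⟩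
  have : ProperSpace M := hD.properSpace hpos hfin
  obtain ⟨x₀⟩ := ‹Nonempty M›
  have htop : μ univ = ⊤ := hD.measure_univ_eq_top hpos x₀ (exists_lt_dist_of_noncompactSpace x₀)
  have hf1 : ContMDiff 𝓘(ℝ, E) 𝓘(ℝ, ℝ) 1 f := hf.of_le (by simp)
  have hfint : ∀ x r, IntegrableOn f (ball x r) μ := fun x r =>
    (hf.continuous.integrable_of_hasCompactSupport hf').integrableOn
  set w : M → ℝ≥0∞ := fun p => ‖grad (E := E) f p‖ₑ ^ q with hw
  have hPf : HasPoincare μ q P f w := hP.hasPoincare hq0.le hf1 hf'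
  obtain ⟨R₀, hR₀⟩ := hf'.isCompact.isBounded.subset_ball x₀
  have hsupp : ∀ y, y ∉ ball x₀ R₀ → w y = 0 := fun y hy => by
    rw [hw]
    simp only
    rw [grad_eq_zero_of_notMem_tsupport fun h => hy (hR₀ h), enorm_zero, ENNReal.zero_rpow_of_pos hq0]
  set t := ENNReal.ofReal α ^ q with ht
  have ht0 : t ≠ 0 := (ENNReal.rpow_pos (ENNReal.ofReal_pos.2 hα) ENNReal.ofReal_ne_top).ne'
  have ht1 : t ≠ ⊤ := by finiteness
  obtain ⟨hΩ, hne, R, hR⟩ := hD.maximalSet_bounds htop ht0 ht1 hfq.ne hsupp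
  set F := (maximalSet μ w t)ᶜ with hF
  have hFc : IsClosed F := isOpen_maximalSet.isClosed_compl
  obtain ⟨s, c, hW⟩ := exists_isWhitney hFc hne fun x hx => hR x (not_not.1 hx)
  have hNx := hW.encard_le hD hpos hfin hN
  obtain ⟨ψ, hψ, hψs, hψt⟩ := hW.exists_isBumpFamily (E := E) hS hFc hne
  have hδ : ∀ n ∈ s, 0 < infDist (c n) F := fun n hn => hW.infDist_pos hFc hne hn
  set a : ℕ → ℝ := fun n => ⨍ u in ball (c n) (infDist (c n) F / 10), f u ∂μ with ha
  have hκ := oscConst_nonneg (q := q) (D := D) (P := P)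
  refine ⟨s, inferInstance, fun n => c n, fun n => infDist (c n) F / 10,
    fun n p => (f p - a n) * bumpPartition ψ n p, whitneyExtension F f ψ a,
    fun n => by have := hδ n n.2; positivity,
    fun n => (hf.sub contMDiff_const).mul (contMDiff_bumpPartition hψs n), fun p p' => ?_,
    hψ.hasSum_sub_whitneyExtension hW hNx f a, fun n => ?_, fun n => ?_, ?_, fun p => ?_⟩
  -- A = 192 κ α, with κ = `oscConst q D P`, is the Lipschitz constant of f on F; the averages only
  -- need 96 κ α · δ/10.
  · refine (hψ.abs_whitneyExtension_sub_whitneyExtension_le hFc hne hW hNx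
      (A := 192 * oscConst q D P * α) (by positivity) (by positivity)
      (fun z hz y hy => abs_sub_le_of_notMem_maximalSet hq hD hpos hfin hf.continuous hfint hPf hα
        hz hy) (fun n hn z hz hnz => ?_) p p').trans_eq ?_
    · have := hδ n hn
      refine (abs_setAverage_sub_le hq hD hpos hfin hf.continuous hfint hPf hα hz
        (show 0 < infDist (c n) F / 10 by positivity) (by linarith)).trans ?_
      have h : 0 ≤ oscConst q D P * α * infDist (c n) F := by positivity
      linarith
    · rw [goodConst]
      ring
  · refine (closure_mono fun p hp => ?_).trans (hψt n n.2)
    exact left_ne_zero_of_mul (right_ne_zero_of_mul hp)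
  · have hn := hδ n n.2
    obtain ⟨z, hz, hzn⟩ := (infDist_lt_iff hne).1 (show infDist (c n) F < 2 * infDist (c n) F by linarith)
    -- Here K = (4N + 1) · 24 S, because 240 S / δ = 24 S / r for r = δ/10.
    refine lintegral_grad_sub_const_mul_le hq hD hf1 hPf
      ((contMDiff_bumpPartition hψs n).of_le (by simp)) (hψ.partition_nonneg n)
      (fun p => (hψ.partition_le n p).trans (hψ.le_one n p)) hz (by positivity)
      (by linarith) fun p p' => (hψ.partition_lip hFc hne hW hNx n.2 p p').trans_eq ?_
    push_cast
    field_simp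
    ring
  -- D⁴ from the Whitney balls times D³ from the maximal set gives C₀ = D⁷.
  · refine (hW.tsum_measure_le hFc hne hD).trans ?_
    rw [hF, compl_compl, ENNReal.rpow_neg]
    calc (D : ℝ≥0∞) ^ 4 * μ (maximalSet μ w t) ≤
          (D : ℝ≥0∞) ^ 4 * ((D : ℝ≥0∞) ^ 3 * t⁻¹ * ∫⁻ y, w y ∂μ) := by gcongr
      _ = _ := by
        push_cast
        ring
  · rw [← Subtype.val_injective.encard_image]
    refine (encard_le_encard ?_).trans (hNx p)
    rintro _ ⟨n, hn, rfl⟩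
    exact ⟨n.2, hn⟩

end Decomposition

end RiemannianCZ

theorem mainTheorem8 (q : ℝ) (hq : 1 ≤ q) (D : ℝ≥0) :
    ∃ (N : ℕ) (C₀ : ℝ≥0), ∀ P : ℝ≥0, ∃ C : ℝ≥0,
      ∀ (E : Type*) [NormedAddCommGroup E] [InnerProductSpace ℝ E] [FiniteDimensional ℝ E]
        [MeasurableSpace E] [BorelSpace E]
        (M : Type*) [MetricSpace M] [ChartedSpace E M] [IsManifold 𝓘(ℝ, E) ∞ M]
        [RiemannianBundle (fun p : M => TangentSpace 𝓘(ℝ, E) p)]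
        [IsContMDiffRiemannianBundle 𝓘(ℝ, E) ∞ E (fun p : M => TangentSpace 𝓘(ℝ, E) p)]
        [IsRiemannianManifold 𝓘(ℝ, E) M] [SecondCountableTopology M] [Nonempty M]
        [CompleteSpace M] [NoncompactSpace M] [MeasurableSpace M] [BorelSpace M]
        (μ : Measure M), μ = riemannianVolume E M → Doubling μ D → Poincare E μ q P →
        ∀ f : M → ℝ, ContMDiff 𝓘(ℝ, E) 𝓘(ℝ, ℝ) ∞ f → HasCompactSupport f →
          (∫⁻ p, ‖grad (E := E) f p‖ₑ ^ q ∂μ) < ⊤ →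
          ∀ α : ℝ, 0 < α →
            ∃ (ι : Type) (_ : Countable ι) (c : ι → M) (r : ι → ℝ) (b : ι → M → ℝ) (g : M → ℝ)
              (G : ∀ p : M, TangentSpace 𝓘(ℝ, E) p),
              (∀ i, 0 < r i) ∧
              (∀ i, ContMDiff 𝓘(ℝ, E) 𝓘(ℝ, ℝ) 1 (b i)) ∧
              (∃ K : ℝ≥0, LipschitzWith K g) ∧
              (∀ p, HasSum (fun i => b i p) (f p - g p)) ∧
              IsWeakGrad g G ∧
              (∀ᵐ p ∂μ, ‖G p‖ ≤ C * α) ∧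
              (∀ i, tsupport (b i) ⊆ ball (c i) (r i)) ∧
              (∀ i, (∫⁻ p in ball (c i) (r i), ‖grad (E := E) (b i) p‖ₑ ^ q ∂μ) ≤
                C * ENNReal.ofReal α ^ q * μ (ball (c i) (r i))) ∧
              ((∑' i, μ (ball (c i) (r i))) ≤
                C₀ * ENNReal.ofReal α ^ (-q) * (∫⁻ p, ‖grad (E := E) f p‖ₑ ^ q ∂μ)) ∧
              (∀ p : M, {i | p ∈ ball (c i) (r i)}.encard ≤ N) := by
  obtain ⟨S, hS⟩ := exists_lipschitzWith_smoothTransition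
  -- S is absolute, so N and C₀ are fixed by D before P is introduced.
  obtain ⟨N, hN⟩ := exists_nat_ge (D ^ 7)
  refine ⟨N, D ^ 7, fun P => ⟨max (goodConst q D P S N).toNNReal
    (badConst q D P ((4 * N + 1) * (24 * S))), ?_⟩⟩
  intro E _ _ _ _ _ M _ _ _ _ _ _ _ _ _ _ _ _ μ hμ hD hP f hf hf' hfq α hα
  have : IsContinuousRiemannianBundle E (fun p : M => TangentSpace 𝓘(ℝ, E) p) := by
    obtain ⟨g, h, h'⟩ := IsContMDiffRiemannianBundle.exists_contMDiff (IB := 𝓘(ℝ, E)) (n := ∞)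
      (F := E) (E := fun p : M => TangentSpace 𝓘(ℝ, E) p)
    exact ⟨g, h.continuous, h'⟩
  -- One ball of positive finite measure; by doubling all balls have positive finite measure.
  obtain ⟨x, V, hV, h⟩ := exists_riemannianVolume_ne_zero_ne_top (E := E) (M := M)
  obtain ⟨ρ, hρ, hρV⟩ := Metric.mem_nhds_iff.1 hV
  obtain ⟨h0, h1⟩ := h (ball x ρ) hρV isOpen_ball (mem_ball_self hρ)
  rw [← hμ] at h0 h1
  obtain ⟨ι, hι, c, r, b, g, hr, hb, hg, hsum, hsupp, hint, hmeas, hcard⟩ :=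
    exists_calderonZygmund_decomposition (E := E) hS hq hN hD
      (fun y _ hs => hD.measure_ball_pos h0 y hs) (hD.measure_ball_lt_top hρ h1) hP hf hf' hfq hα
  have hC := goodConst_nonneg q D P S N
  have hgL : LipschitzWith (goodConst q D P S N * α).toNNReal g := by
    refine LipschitzWith.of_dist_le_mul fun p p' => ?_
    rw [Real.coe_toNNReal _ (by positivity)]
    exact hg p p'
  -- The weak gradient of g is taken to be its pointwise gradient, bounded everywhere by the
  -- Lipschitz constant.
  refine ⟨ι, hι, c, r, b, g, grad g, hr, fun i => (hb i).of_le (by simp), ⟨_, hgL⟩, hsum,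
    isWeakGrad_grad_of_lipschitzWith hgL, .of_forall fun p => ?_, hsupp, fun i => ?_, hmeas, hcard⟩
  · refine (norm_grad_le_of_lipschitzWith hgL p).trans ?_
    rw [Real.coe_toNNReal _ (by positivity)]
    refine mul_le_mul_of_nonneg_right ?_ hα.le
    exact (Real.le_coe_toNNReal _).trans (NNReal.coe_le_coe.2 (le_max_left _ _))
  · refine (hint i).trans ?_
    gcongr
    exact le_max_right _ _
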